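/- Let $p_1\ne p_2$ be primes with $p_1\equiv p_2\equiv 3\pmod 4$, put $p_0=2$, and let $M=2^{\beta_0}p_1^{\beta_1}p_2^{\beta_2}$ with integers $\beta_0\ge 2$, $\beta_1,\beta_2\ge 0$. For $\gamma=\begin{pmatrix}a&b\\c&d\end{pmatrix}\in\Gamma_0(4)$ and $z$ in the upper half-plane $\mathbb H$ let $$J(\gamma,z)=\epsilon_d^{-1}\left(\frac cd\right)e^{\frac i2\arg(cz+d)},\qquad -\pi<\arg\le\pi,$$ where $\epsilon_d=1$ if $d\equiv1\pmod 4$, $\epsilon_d=i$ if $d\equiv3\pmod 4$, and $\left(\frac cd\right)$ is Shimura's extended quadratic residue symbol, i.e. the Jacobi symbol $\left(\frac c{|d|}\right)$, multiplied by $-1$ if $c<0$ and $d<0$. Let $\Gamma_\infty$ be the stabilizer of $\infty$ in $\Gamma_0(M)$ (it contains $-1$), and for $z\in\mathbb H$ let $$E_{\infty,1/2}(z;s)=\sum_{\gamma\in\Gamma_\infty\backslash\Gamma_0(M)}J(\gamma,z)^{-1}\,\mathrm{Im}(\gamma z)^s\qquad(\mathrm{Re}(s)>1).$$ Then for every $z\in\mathbb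 H$ this series converges absolutely for $\mathrm{Re}(s)>1$, the function $s\mapsto E_{\infty,1/2}(z;s)$ has a meromorphic continuation to the half-plane $\mathrm{Re}(s)>\frac12$, the continuation has at most a simple pole at $s=\frac34$, and $$\operatorname*{Res}_{s=3/4}E_{\infty,1/2}(z;s)=\frac{\pi}{4\,\zeta_{(M)}(1)\,\zeta_M(2)}\Big(\prod_{j=0}^2p_j^{-\left[\frac{\beta_j+1}2\right]}\Big)\,\theta_{\chi_1,t_M}(z),\qquad t_M=2^{-2}\prod_{j=0}^2p_j^{2\left[\frac{\beta_j}2\right]}.$$ Here $[x]$ is the integer part of $x$, $\zeta_{(M)}(s)=\prod_{p\mid M}(1-p^{-s})^{-1}$ and, for $\mathrm{Re}(s)>1$, $\zeta_M(s)=\prod_{p\nmid M}(1-p^{-s})^{-1}$ (products over primes), and $\theta_{\chi_1,t}(z)=y^{1/4}\sum_{n\in\mathbb Z}e^{2\pi i t n^2z}$ with $y=\mathrm{Im}(z)$ is the theta series of the trivial character $\chi_1=1$. -/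

import Mathlib

noncomputable section

namespace HalfIntegralEisenstein

open Complex CongruenceSubgroup Filter Topology
open scoped MatrixGroups UpperHalfPlane

/-- `ε_d` for odd `d`: `1` if `d ≡ 1 (mod 4)` and `i` if `d ≡ 3 (mod 4)`. -/
def eps (d : ℤ) : ℂ := if d % 4 = 1 then 1 else I

/-- Shimura's extension of the Jacobi symbol `(c/d)` to all odd `d`, of either sign:
`(c/d) = (c/|d|)`, with an additional sign `-1` when `c` and `d` are both negative; in particular
`(0/±1) = 1`. -/
def kronecker (c d : ℤ) : ℤ :=
  (if c < 0 ∧ d < 0 then -1 else 1) * jacobiSym c d.natAbs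

/-- The theta multiplier `J(γ, z) = ε_d⁻¹ (c/d) exp((i/2) arg (cz+d))`, for a matrix `γ` with lower
row `(c, d)`, `d` odd. -/
def thetaMult (γ : SL(2, ℤ)) (z : ℍ) : ℂ :=
  (eps (γ 1 1))⁻¹ * (kronecker (γ 1 0) (γ 1 1) : ℂ) *
    exp (I / 2 * (arg ((γ 1 0 : ℂ) * (z : ℂ) + (γ 1 1 : ℂ)) : ℂ))

/-- The stabilizer `Γ_∞` of the cusp `∞` in `Γ₀(M)`: since `γ∞ = a/c`, these are the matrices
with `c = 0`. It contains `-1`. -/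
def stabInfty (M : ℕ) : Subgroup (Gamma0 M) where
  carrier := {γ | (γ : SL(2, ℤ)) 1 0 = 0}
  one_mem' := by simp
  mul_mem' := by
    intro a b ha hb
    simp only [Set.mem_ofPred_eq] at ha hb ⊢
    simp [Matrix.mul_apply, Fin.sum_univ_two, ha, hb]
  inv_mem' := by
    intro a ha
    simp only [Set.mem_ofPred_eq] at ha ⊢
    simp [Matrix.SpecialLinearGroup.coe_inv, Matrix.adjugate_fin_two, ha]

/-- The coset space `Γ_∞ \ Γ₀(M)`, i.e. the classes `Γ_∞ γ`. -/
abbrev CosetSpace (M : ℕ) : Type := Quotient (QuotientGroup.rightRel (stabInfty M))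

/-- The summand `J(γ, z)⁻¹ Im(γ z)^s` (that is, `J(γ, z)^{-2κ} Im(γ z)^s` with `κ = 1/2`). -/
def summand (z : ℍ) (s : ℂ) (γ : SL(2, ℤ)) : ℂ :=
  (thetaMult γ z)⁻¹ * (((γ • z : ℍ).im : ℝ) : ℂ) ^ s

/-- The summand as a function on `Γ_∞ \ Γ₀(M)`. When `4 ∣ M` it does not depend on the chosen
representatives, see `summand_eq_of_rel`. -/
def cosetSummand (M : ℕ) (z : ℍ) (s : ℂ) (q : CosetSpace M) : ℂ :=
  summand z s (q.out : Gamma0 M)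

/-- The Eisenstein series `E_{∞,1/2}(z; s) = ∑_{γ ∈ Γ_∞ \ Γ₀(M)} J(γ, z)⁻¹ Im(γ z)^s` of weight
`1/2` at the cusp `∞` of `Γ₀(M)`; the series is meant for `Re s > 1`. -/
def eisenstein (M : ℕ) (z : ℍ) (s : ℂ) : ℂ :=
  ∑' q : CosetSpace M, cosetSummand M z s q

/-- The theta series `θ_{ω,t}(z) = y^{1/4} ∑_{n ∈ ℤ} ω(n) e(t n² z)`, where `e(w) = exp(2πiw)`. -/
def theta {r : ℕ} (ω : DirichletCharacter ℂ r) (t : ℝ) (z : ℍ) : ℂ :=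
  ((z.im ^ (1 / 4 : ℝ) : ℝ) : ℂ) *
    ∑' n : ℤ, ω (n : ZMod r) * exp (2 * Real.pi * I * ((t : ℂ) * (n : ℂ) ^ 2 * (z : ℂ)))

/-- `ζ_{(M)}(s) = ∏_{p ∣ M} (1 - p^{-s})⁻¹`. -/
def zetaDividing (M : ℕ) (s : ℂ) : ℂ :=
  ∏ p ∈ M.primeFactors, (1 - (p : ℂ) ^ (-s))⁻¹

/-- `ζ_M(s) = ∏_{p ∤ M} (1 - p^{-s})⁻¹`, for `Re s > 1`. -/
def zetaCoprime (M : ℕ) (s : ℂ) : ℂ :=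
  ∏' p : {p : ℕ // p.Prime ∧ ¬ p ∣ M}, (1 - ((p : ℕ) : ℂ) ^ (-s))⁻¹

/-- Near `a` one has `f s = R / (s - a) + g s` with `g` holomorphic at `a`: the function `f` has at
most a simple pole at `a`, and its residue there is `R`. -/
def HasSimplePoleResidue (f : ℂ → ℂ) (a R : ℂ) : Prop :=
  ∃ g : ℂ → ℂ, AnalyticAt ℂ g a ∧ ∀ᶠ s in 𝓝[≠] a, f s = R / (s - a) + g s

/-! ### The summand is well defined on cosets -/

lemma eps_neg_inv {d : ℤ} (hd : d % 2 = 1) :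
    (eps (-d))⁻¹ = (if d % 4 = 1 then -I else I) * (eps d)⁻¹ := by
  unfold eps
  rcases (by omega : d % 4 = 1 ∨ d % 4 = 3) with h | h
  · have h' : (-d) % 4 = 3 := by omega
    simp [h, h']
  · have h' : (-d) % 4 = 1 := by omega
    simp [h, h']

lemma jacobi_neg {c d : ℤ} (hd : d % 2 = 1) :
    jacobiSym (-c) d.natAbs = (if d.natAbs % 4 = 1 then 1 else -1) * jacobiSym c d.natAbs := by
  have hodd : Odd d.natAbs := by rw [Int.natAbs_odd]; exact Int.odd_iff.2 hd
  rw [jacobiSym.neg _ hodd]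
  rcases (by omega : d.natAbs % 4 = 1 ∨ d.natAbs % 4 = 3) with h | h
  · rw [ZMod.χ₄_nat_one_mod_four h]; simp [h]
  · rw [ZMod.χ₄_nat_three_mod_four h]; simp [h]

lemma exp_half_pi_sub (x : ℝ) : exp (I / 2 * ((x - Real.pi : ℝ) : ℂ)) = -I * exp (I / 2 * x) := by
  have : I / 2 * ((x - Real.pi : ℝ) : ℂ) = I / 2 * x - Real.pi / 2 * I := by push_cast; ring
  rw [this, exp_sub, exp_pi_div_two_mul_I, div_eq_mul_inv, inv_I, mul_comm]

/-- The multiplier as a function of the lower row. -/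
def rowMult (c d : ℤ) (z : ℍ) : ℂ :=
  (eps d)⁻¹ * (kronecker c d : ℂ) * exp (I / 2 * (arg ((c : ℂ) * (z : ℂ) + (d : ℂ)) : ℂ))

lemma rowMult_neg_of_pos {c d : ℤ} (hd : d % 2 = 1) (z : ℍ) (hc : 0 < c) :
    rowMult (-c) (-d) z = rowMult c d z := by
  have him : 0 < ((c : ℂ) * (z : ℂ) + (d : ℂ)).im := by
    simp
    exact mul_pos (by exact_mod_cast hc) z.im_pos
  have hw : ((-c : ℤ) : ℂ) * (z : ℂ) + ((-d : ℤ) : ℂ) = -((c : ℂ) * (z : ℂ) + (d : ℂ)) := by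
    push_cast; ring
  unfold rowMult
  rw [hw, arg_neg_eq_arg_sub_pi_of_im_pos him, exp_half_pi_sub, eps_neg_inv hd]
  have hk : (kronecker (-c) (-d) : ℤ) = (if d % 4 = 1 then -1 else 1) * kronecker c d := by
    unfold kronecker
    rw [Int.natAbs_neg, jacobi_neg hd]
    have h1 : -c < 0 := by omega
    have h2 : ¬ c < 0 := by omega
    rcases lt_or_gt_of_ne (show d ≠ 0 by omega) with h0 | h0
    · have h3 : ¬ (0 < d) := by omega
      rcases (by omega : d % 4 = 1 ∨ d % 4 = 3) with h | h
      · have : d.natAbs % 4 = 3 := by omega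
        simp [h, this, h2, h3]
      · have : d.natAbs % 4 = 1 := by omega
        simp [h, this, h2, h3]
    · rcases (by omega : d % 4 = 1 ∨ d % 4 = 3) with h | h
      · have : d.natAbs % 4 = 1 := by omega
        simp [h, this, h0, h2, hc]
      · have : d.natAbs % 4 = 3 := by omega
        simp [h, this, h0, h2, hc]
  rw [hk]
  rcases (by omega : d % 4 = 1 ∨ d % 4 = 3) with h | h
  · simp only [h, if_true]
    push_cast
    linear_combination (-(eps d)⁻¹ * (kronecker c d : ℂ) *
      exp (I / 2 * (arg ((c : ℂ) * (z : ℂ) + (d : ℂ)) : ℂ))) * I_mul_I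
  · simp only [h, show ¬ ((3 : ℤ) = 1) by norm_num, if_false]
    push_cast
    linear_combination (-(eps d)⁻¹ * (kronecker c d : ℂ) *
      exp (I / 2 * (arg ((c : ℂ) * (z : ℂ) + (d : ℂ)) : ℂ))) * I_mul_I

lemma rowMult_zero_one (z : ℍ) : rowMult 0 1 z = 1 := by
  simp [rowMult, eps, kronecker]

lemma rowMult_zero_neg_one (z : ℍ) : rowMult 0 (-1) z = 1 := by
  have h : I / 2 * (Real.pi : ℂ) = Real.pi / 2 * I := by ring
  simp [rowMult, eps, kronecker, h, exp_pi_div_two_mul_I]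

lemma rowMult_neg {c d : ℤ} (hd : d % 2 = 1) (h0 : c = 0 → d = 1 ∨ d = -1) (z : ℍ) :
    rowMult (-c) (-d) z = rowMult c d z := by
  rcases lt_trichotomy c 0 with hc | hc | hc
  · have := rowMult_neg_of_pos (c := -c) (d := -d) (by omega) z (by omega)
    simpa using this.symm
  · subst hc
    rcases h0 rfl with rfl | rfl
    · simpa using (rowMult_zero_neg_one z).trans (rowMult_zero_one z).symm
    · simpa using (rowMult_zero_one z).trans (rowMult_zero_neg_one z).symm
  · exact rowMult_neg_of_pos hd z hc

/-- For `4 ∣ M` the summand takes the same value on all representatives of a class `Γ_∞ γ`. -/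
theorem summand_eq_of_rel {M : ℕ} (hM : 4 ∣ M) (z : ℍ) (s : ℂ) (δ γ : Gamma0 M)
    (hδ : δ ∈ stabInfty M) :
    summand z s (δ * γ : Gamma0 M) = summand z s (γ : Gamma0 M) := by
  have hδ0 : (δ : SL(2, ℤ)) 1 0 = 0 := hδ
  have hdetδ := Matrix.det_fin_two (δ : SL(2, ℤ)).1
  have hdetγ := Matrix.det_fin_two (γ : SL(2, ℤ)).1
  rw [Matrix.SpecialLinearGroup.det_coe] at hdetδ hdetγ
  have hδ0' : (δ : SL(2, ℤ)).1 1 0 = 0 := hδ0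
  rw [hδ0', mul_zero, sub_zero] at hdetδ
  have hu : (δ : SL(2, ℤ)).1 1 1 = 1 ∨ (δ : SL(2, ℤ)).1 1 1 = -1 := by
    rw [mul_comm] at hdetδ
    exact Int.eq_one_or_neg_one_of_mul_eq_one hdetδ.symm
  have hc4 : (4 : ℤ) ∣ (γ : SL(2, ℤ)).1 1 0 := by
    have h := γ.2
    rw [Gamma0_mem, ZMod.intCast_zmod_eq_zero_iff_dvd] at h
    exact dvd_trans (by exact_mod_cast hM) h
  have hodd : (γ : SL(2, ℤ)).1 1 1 % 2 = 1 := by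
    obtain ⟨k, hk⟩ := hc4
    rcases Int.emod_two_eq_zero_or_one ((γ : SL(2, ℤ)).1 1 1) with h | h
    · obtain ⟨l, hl⟩ := Int.dvd_of_emod_eq_zero h
      rw [hk, hl] at hdetγ
      have : (2 : ℤ) ∣ 1 := ⟨(γ : SL(2, ℤ)).1 0 0 * l - (γ : SL(2, ℤ)).1 0 1 * (2 * k), by
        linear_combination hdetγ⟩
      norm_num at this
    · exact h
  have hz : (γ : SL(2, ℤ)).1 1 0 = 0 →
      (γ : SL(2, ℤ)).1 1 1 = 1 ∨ (γ : SL(2, ℤ)).1 1 1 = -1 := by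
    intro h
    rw [h, mul_zero, sub_zero, mul_comm] at hdetγ
    exact Int.eq_one_or_neg_one_of_mul_eq_one hdetγ.symm
  have hrow0 : ((δ : SL(2, ℤ)) * (γ : SL(2, ℤ))).1 1 0 =
      (δ : SL(2, ℤ)).1 1 1 * (γ : SL(2, ℤ)).1 1 0 := by
    simp [Matrix.mul_apply, Fin.sum_univ_two, hδ0]
  have hrow1 : ((δ : SL(2, ℤ)) * (γ : SL(2, ℤ))).1 1 1 =
      (δ : SL(2, ℤ)).1 1 1 * (γ : SL(2, ℤ)).1 1 1 := by
    simp [Matrix.mul_apply, Fin.sum_univ_two, hδ0]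
  have hmult : thetaMult ((δ : SL(2, ℤ)) * (γ : SL(2, ℤ))) z = thetaMult (γ : SL(2, ℤ)) z := by
    change rowMult (((δ : SL(2, ℤ)) * (γ : SL(2, ℤ))).1 1 0)
      (((δ : SL(2, ℤ)) * (γ : SL(2, ℤ))).1 1 1) z =
      rowMult ((γ : SL(2, ℤ)).1 1 0) ((γ : SL(2, ℤ)).1 1 1) z
    rw [hrow0, hrow1]
    rcases hu with h | h
    · rw [h, one_mul, one_mul]
    · rw [h, neg_one_mul, neg_one_mul]
      exact rowMult_neg hodd hz z
  have him : (((δ : SL(2, ℤ)) * (γ : SL(2, ℤ))) • z : ℍ).im = ((γ : SL(2, ℤ)) • z : ℍ).im := by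
    rw [mul_smul, ModularGroup.im_smul_eq_div_normSq, ModularGroup.denom_apply]
    rcases hu with h | h <;> simp [hδ0, h]
  change (thetaMult ((δ : SL(2, ℤ)) * (γ : SL(2, ℤ))) z)⁻¹ *
    ((((((δ : SL(2, ℤ)) * (γ : SL(2, ℤ))) • z : ℍ).im : ℝ) : ℂ)) ^ s = _
  rw [hmult, him]
  rfl

/-- The product defining `ζ_M(s)` converges for `Re s > 1`. -/
theorem hasProd_zetaCoprime {M : ℕ} {s : ℂ} (hs : 1 < s.re) :
    HasProd (fun p : {p : ℕ // p.Prime ∧ ¬ p ∣ M} => (1 - ((p : ℕ) : ℂ) ^ (-s))⁻¹)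
      (zetaCoprime M s) := by
  have h := DirichletCharacter.LSeries_eulerProduct_hasProd (1 : DirichletCharacter ℂ M) hs
  let f : {p : ℕ // p.Prime ∧ ¬ p ∣ M} → Nat.Primes := fun p => ⟨p.1, p.2.1⟩
  have hf : Function.Injective f := fun a b hab => Subtype.ext (congrArg (fun q => q.1) hab)
  have h1 := (hf.hasProd_iff ?_).2 h
  · have h2 : ((fun p : Nat.Primes => (1 - (1 : DirichletCharacter ℂ M) ((p : ℕ) : ZMod M) *
        ((p : ℕ) : ℂ) ^ (-s))⁻¹) ∘ f) =
        fun p : {p : ℕ // p.Prime ∧ ¬ p ∣ M} => (1 - ((p : ℕ) : ℂ) ^ (-s))⁻¹ := by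
      funext p
      have hu : IsUnit ((p.1 : ℕ) : ZMod M) :=
        (ZMod.isUnit_iff_coprime _ _).2 ((Nat.Prime.coprime_iff_not_dvd p.2.1).2 p.2.2)
      change (1 - (1 : DirichletCharacter ℂ M) ((p.1 : ℕ) : ZMod M) *
        ((p.1 : ℕ) : ℂ) ^ (-s))⁻¹ = _
      rw [MulChar.one_apply hu, one_mul]
    rw [h2] at h1
    exact h1.multipliable.hasProd
  · intro p hp
    have hd : (p : ℕ) ∣ M := by
      by_contra hd
      exact hp ⟨⟨p.1, p.2, hd⟩, rfl⟩
    have hu : ¬ IsUnit ((p.1 : ℕ) : ZMod M) := by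
      rw [ZMod.isUnit_iff_coprime, Nat.Prime.coprime_iff_not_dvd p.2]
      exact fun h => h hd
    have h0 : (1 : DirichletCharacter ℂ M) ((p : ℕ) : ZMod M) = 0 := MulChar.map_nonunit _ hu
    simp [h0]

end HalfIntegralEisenstein

end

/-!
# The residue of the Eisenstein series of weight one half at `s = 3/4`

The Fourier expansion of the Eisenstein series is computed explicitly, continued term by term, and
found to be a theta series at `s = 3/4`.

*Fourier expansion.* The classes in `Γ_∞ \ Γ₀(M)` correspond to the lower rows `(c, d)` with
`M ∣ c`, up to sign (`cosetEquiv`). For `4 ∣ c` the factor `ε_d (c/d)` is a quadratic Gauss sum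
modulo `c` (`eps_mul_kronecker`); this follows from the reciprocity law `quadGauss_reciprocity`,
proved with Jacobi's theta function, and Dirichlet's theorem on primes in progressions, which
reduces to prime `d`. Poisson summation over `d` then gives (`eisenstein_eq_fourier`)

  `E(z; s) = y^s + y^s (1 + i)/2 ∑_n F_n(s) e(n x) D_n(2 s - 1/2)`,
  `D_n(w) = ∑_{M ∣ c} h_n(c) c^{-w}`,

where `F_n(s)` is the Fourier transform at `n` of `e^{-(i/2) arg(x + i y)} |x + i y|^{-2s}`, and
`h_n = μ * N_n` with `N_n(c)` the number of solutions of `x² ≡ n` modulo `c` (`rootMoebius`).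

*Continuation.* The part of `D_n` supported on the primes dividing `n M` converges for
`Re w > 1/2`, because the Gauss sums give `h_n(c) = O(√c)`. For `n ≠ 0` the remaining part is
`∑ (n/b) b^{-w} / ∑ b^{-2w}` over `b` prime to `n M` (`LSeries_roughCoef_mul`). The coefficients
of the numerator are periodic, so summation by parts continues it to `Re w > 0`, with at most a
simple pole at `w = 1`, whose residue is the mean of the symbol `b ↦ (n/b)`; the inverse zeta
function is harmless for `Re w > 1/2`. The term `n = 0` is similar. Hence `(w - 1) D_n(w)`
continues holomorphically to `Re w > 1/2` (`coefExt`), with polynomial growth in `n`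
(`exists_norm_coefExt_le`), whereas `F_n(s)` decays faster than any power of `n`; the series of
products converges locally uniformly in `Re s > 1/2`. Since `w - 1 = 2 (s - 3/4)`, the only
possible pole is at `s = 3/4` (`hasSimplePoleResidue_eisensteinExt`).

*Residue.* The mean of `(n/b)` vanishes unless `n = m²` is a square (`coefExt_one_of_not_sq`). For
squares, the value of `(w - 1) D_n(w)` at `w = 1` is an Euler product whose factors at `p ∣ M` are
`p^{-⌈β/2⌉}` or zero, according to whether a certain power of `p` divides `m`
(`hasSum_localTerm_odd`, `hasSum_localTerm_two`). Together these powers require `√t ∣ m`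
(`squareValue_eq`). Closing the contour in the lower half-plane gives
`F_n(3/4) = π (1 - i) y^{-1/2} e^{-2π n y}` for `n ≥ 0` (`fourier_kernel_three_quarters`), so the
residue is a multiple of `∑ e(m² z)` over the multiples `m` of `√t`, which is the theta series.
-/

namespace HalfIntegralEisenstein

open Complex CongruenceSubgroup Filter Topology
open scoped MatrixGroups UpperHalfPlane

/-! ### Theta sums with periodic coefficients -/

/-- Division with remainder: `(r, k) ↦ r + N k` as an equivalence `ZMod N × ℤ ≃ ℤ`. -/
def residueEquiv (N : ℕ) [NeZero N] : ZMod N × ℤ ≃ ℤ where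
  toFun p := p.1.val + N * p.2
  invFun n := ((n : ZMod N), n / N)
  left_inv := by
    rintro ⟨r, k⟩
    have hN : (0 : ℤ) < N := by exact_mod_cast Nat.pos_of_ne_zero (NeZero.ne N)
    have h1 : (r.val : ℤ) < N := by exact_mod_cast ZMod.val_lt r
    ext
    · simp
    · simp only
      rw [Int.add_mul_ediv_left _ _ hN.ne', Int.ediv_eq_zero_of_lt (by positivity) h1, zero_add]
  right_inv := by
    intro n
    simp only [ZMod.val_intCast]
    exact Int.emod_add_mul_ediv n N

lemma tsum_int_eq_sum_residues (N : ℕ) [NeZero N] {f : ℤ → ℂ} (hf : Summable f) :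
    ∑' n, f n = ∑ r : ZMod N, ∑' k : ℤ, f (r.val + N * k) := by
  have hf' : Summable (f ∘ residueEquiv N) := (residueEquiv N).summable_iff.2 hf
  rw [← (residueEquiv N).tsum_eq f]
  exact (Summable.tsum_prod hf').trans (tsum_fintype _)

lemma tendsto_jacobiTheta₂_ofReal (x : ℝ) {ι : Type*} {l : Filter ι} {τ : ι → ℂ}
    (hτ : Tendsto (fun i => (τ i).im) l atTop) :
    Tendsto (fun i => jacobiTheta₂ x (τ i)) l (𝓝 1) := by
  by_cases hl : l.NeBot
  swap
  · rw [not_neBot.1 hl]; exact tendsto_bot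
  have hbound : Summable fun n : ℤ => ‖jacobiTheta₂_term n 0 I‖ :=
    ((summable_jacobiTheta₂_term_iff 0 I).2 (by simp)).norm
  have h1 : (1 : ℂ) = ∑' n : ℤ, if n = 0 then (1 : ℂ) else 0 := by rw [tsum_ite_eq]
  rw [h1]
  refine tendsto_tsum_of_dominated_convergence hbound ?_ ?_
  · intro n
    split_ifs with hn
    · subst hn
      simp [jacobiTheta₂_term]
    · rw [tendsto_zero_iff_norm_tendsto_zero]
      simp only [norm_jacobiTheta₂_term, ofReal_im, mul_zero, sub_zero]
      refine Real.tendsto_exp_atBot.comp ?_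
      have : (0 : ℝ) < Real.pi * n ^ 2 := by positivity
      refine (hτ.const_mul_atTop this |> tendsto_neg_atTop_atBot.comp).congr ?_
      intro i; simp
  · filter_upwards [hτ.eventually_ge_atTop 1] with i hi n
    simp only [norm_jacobiTheta₂_term, ofReal_im, mul_zero, sub_zero, I_im, zero_im]
    refine Real.exp_le_exp.2 ?_
    have : (0 : ℝ) ≤ Real.pi * n ^ 2 := by positivity
    nlinarith

lemma summable_exp_neg_sq {w : ℂ} (hw : 0 < w.re) (a : ℤ → ℂ) {C : ℝ} (ha : ∀ n, ‖a n‖ ≤ C) :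
    Summable fun n : ℤ => a n * exp (-Real.pi * n ^ 2 * w) := by
  have h := ((summable_jacobiTheta₂_term_iff 0 (I * w)).2 (by simpa using hw)).norm.mul_left C
  refine Summable.of_norm_bounded h fun n => ?_
  rw [norm_mul]
  have : jacobiTheta₂_term n 0 (I * w) = exp (-Real.pi * n ^ 2 * w) := by
    unfold jacobiTheta₂_term
    congr 1
    linear_combination (Real.pi * n ^ 2 * w) * I_mul_I
  rw [this]
  exact mul_le_mul_of_nonneg_right (ha n) (norm_nonneg _)

lemma ofReal_mul_cpow {r : ℝ} (hr : 0 < r) {z : ℂ} (hz : z ≠ 0) (a : ℂ) :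
    ((r : ℂ) * z) ^ a = (r : ℂ) ^ a * z ^ a := by
  have hr' : (r : ℂ) ≠ 0 := by exact_mod_cast hr.ne'
  rw [cpow_def_of_ne_zero (mul_ne_zero hr' hz), cpow_def_of_ne_zero hr', cpow_def_of_ne_zero hz,
    log_ofReal_mul hr hz, ofReal_log hr.le, add_mul, exp_add]

lemma ofReal_cpow_half {x : ℝ} (hx : 0 ≤ x) : (x : ℂ) ^ (1 / 2 : ℂ) = (Real.sqrt x : ℝ) := by
  rw [Real.sqrt_eq_rpow, ofReal_cpow hx]; norm_num

/-- The Gaussian sum over a residue class, transformed by the functional equation of Jacobi's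
theta function. -/
lemma tsum_exp_neg_sq_residue (N : ℕ) [NeZero N] (r : ℕ) {w : ℂ} (hw : 0 < w.re) :
    ∑' k : ℤ, exp (-Real.pi * ((r : ℂ) + N * k) ^ 2 * w) =
      1 / (N ^ 2 * w) ^ (1 / 2 : ℂ) * jacobiTheta₂ ((r / N : ℝ) : ℂ) (I / (N ^ 2 * w)) := by
  have hN : (N : ℂ) ≠ 0 := by exact_mod_cast NeZero.ne N
  have hw0 : w ≠ 0 := by rintro rfl; simp at hw
  have h := jacobiTheta₂_functional_equation (I * (N * r * w)) (I * (N ^ 2 * w))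
  have e1 : -I * (I * (N ^ 2 * w)) = N ^ 2 * w := by
    linear_combination (-(N ^ 2 * w)) * I_mul_I
  have e2 : -Real.pi * I * (I * (N * r * w)) ^ 2 / (I * (N ^ 2 * w)) = Real.pi * r ^ 2 * w := by
    field_simp [I_ne_zero]
    linear_combination (-(r : ℂ) ^ 2) * I_sq
  have e3 : I * (N * r * w) / (I * (N ^ 2 * w)) = ((r / N : ℝ) : ℂ) := by
    push_cast
    field_simp [I_ne_zero]
  have e4 : -1 / (I * (N ^ 2 * w)) = I / (N ^ 2 * w) := by
    field_simp [I_ne_zero]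
    linear_combination (-1 : ℂ) * I_sq
  rw [e1, e2, e3, e4] at h
  have h2 : ∑' k : ℤ, exp (-Real.pi * ((r : ℂ) + N * k) ^ 2 * w) =
      exp (-(Real.pi * r ^ 2 * w)) * jacobiTheta₂ (I * (N * r * w)) (I * (N ^ 2 * w)) := by
    unfold jacobiTheta₂
    rw [← tsum_mul_left]
    refine tsum_congr fun k => ?_
    rw [jacobiTheta₂_term, ← exp_add]
    congr 1
    linear_combination (-(2 * Real.pi * k * N * r * w + Real.pi * k ^ 2 * N ^ 2 * w)) * I_mul_I
  have h3 : exp (-(Real.pi * r ^ 2 * w)) * exp (Real.pi * r ^ 2 * w) = 1 := by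
    rw [← exp_add, neg_add_cancel, exp_zero]
  rw [h2, h]
  linear_combination (1 / (N ^ 2 * w) ^ (1 / 2 : ℂ) *
    jacobiTheta₂ ((r / N : ℝ) : ℂ) (I / (N ^ 2 * w))) * h3

/-- For a function `a` on `ℤ/N`, the sum `∑ a(n) exp(-π n² w)` is asymptotic to
`(N² w)^{-1/2} ∑_{r mod N} a(r)` as `Re (1/w) → ∞`. -/
lemma tendsto_tsum_periodic_exp_neg_sq (N : ℕ) [NeZero N] (a : ZMod N → ℂ) {ι : Type*}
    {l : Filter ι} {w : ι → ℂ} (hw : Tendsto (fun i => ((w i)⁻¹).re) l atTop) :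
    Tendsto (fun i => (N ^ 2 * w i) ^ (1 / 2 : ℂ) *
      ∑' n : ℤ, a n * exp (-Real.pi * n ^ 2 * w i)) l (𝓝 (∑ r, a r)) := by
  have hN : (N : ℂ) ≠ 0 := by exact_mod_cast NeZero.ne N
  have hN' : (0 : ℝ) < (N : ℝ) ^ 2 := by
    have : (0 : ℝ) < N := by exact_mod_cast Nat.pos_of_ne_zero (NeZero.ne N)
    positivity
  have hT : Tendsto (fun i => (I / (N ^ 2 * w i)).im) l atTop := by
    refine (hw.const_mul_atTop (inv_pos.2 hN')).congr fun i => ?_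
    have : I / (N ^ 2 * w i) = I * ((((N : ℝ) ^ 2)⁻¹ : ℝ) * (w i)⁻¹) := by
      push_cast
      rw [div_eq_mul_inv, mul_inv]
    rw [this, I_mul_im, re_ofReal_mul]
  have key : Tendsto (fun i => ∑ r : ZMod N, a r *
      jacobiTheta₂ ((r.val / N : ℝ) : ℂ) (I / (N ^ 2 * w i))) l (𝓝 (∑ r, a r)) := by
    refine tendsto_finsetSum _ fun r _ => ?_
    simpa using (tendsto_jacobiTheta₂_ofReal (r.val / N : ℝ) hT).const_mul (a r)
  refine key.congr' ?_
  filter_upwards [hw.eventually_gt_atTop 0] with i hi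
  have hwi0 : w i ≠ 0 := by intro h; simp [h] at hi
  have hwi : 0 < (w i).re := by
    rw [inv_re] at hi
    by_contra hcon
    exact absurd hi (not_lt.2 (div_nonpos_of_nonpos_of_nonneg (not_lt.1 hcon) (normSq_nonneg _)))
  obtain ⟨C, hC⟩ : ∃ C, ∀ r, ‖a r‖ ≤ C := ⟨∑ r, ‖a r‖, fun r =>
    Finset.single_le_sum (f := fun r => ‖a r‖) (fun _ _ => norm_nonneg _) (Finset.mem_univ r)⟩
  rw [tsum_int_eq_sum_residues N (summable_exp_neg_sq hwi (fun n => a n) fun n => hC n),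
    Finset.mul_sum]
  refine Finset.sum_congr rfl fun r _ => ?_
  have h0 : ((N : ℂ) ^ 2 * w i) ^ (1 / 2 : ℂ) ≠ 0 := by
    rw [Ne, cpow_eq_zero_iff]
    simp [hN, hwi0]
  have h1 := tsum_exp_neg_sq_residue N r.val hwi
  have h2 : ∀ k : ℤ, a ((((r.val : ℤ) + N * k : ℤ)) : ZMod N) *
      exp (-Real.pi * (((r.val : ℤ) + N * k : ℤ) : ℂ) ^ 2 * w i) =
      a r * exp (-Real.pi * ((r.val : ℂ) + N * k) ^ 2 * w i) := by
    intro k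
    congr 2
    · simp
    · push_cast; ring
  simp_rw [h2]
  rw [tsum_mul_left, h1]
  field_simp

/-! ### Quadratic Gauss sums -/

/-- The quadratic Gauss sum `S(d, c) = ∑_{x mod c} e(d x² / c)`. -/
noncomputable def quadGauss (d : ℤ) (c : ℕ) [NeZero c] : ℂ :=
  ∑ x : ZMod c, ZMod.stdAddChar ((d : ZMod c) * x ^ 2)

lemma quadGauss_neg (d : ℤ) (c : ℕ) [NeZero c] :
    quadGauss (-d) c = (starRingEnd ℂ) (quadGauss d c) := by
  unfold quadGauss
  rw [map_sum]
  refine Finset.sum_congr rfl fun x _ => ?_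
  rw [← AddChar.map_neg_eq_conj]
  congr 1
  push_cast; ring

/-- Reciprocity for quadratic Gauss sums, `S(q, 4m) = (1 + i) √(4m/q) S(-m, q)`. It is obtained by
comparing both sides of the functional equation of Jacobi's theta function as the argument tends
to the rational point `q / (2m)`. -/
lemma quadGauss_reciprocity (m q : ℕ) [NeZero m] [NeZero q] [NeZero (4 * m)] :
    quadGauss q (4 * m) = (1 + I) * (Real.sqrt (4 * m / q) : ℝ) * quadGauss (-m) q := by
  have hm : (0 : ℝ) < m := by exact_mod_cast Nat.pos_of_ne_zero (NeZero.ne m)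
  have hq : (0 : ℝ) < q := by exact_mod_cast Nat.pos_of_ne_zero (NeZero.ne q)
  have hmC : (m : ℂ) ≠ 0 := by exact_mod_cast hm.ne'
  have hqC : (q : ℂ) ≠ 0 := by exact_mod_cast hq.ne'
  set τ : ℝ → ℂ := fun ε => q / (2 * m) + I * ε with hτ
  have hτim : ∀ ε, (τ ε).im = ε := by
    intro ε
    have : (q : ℂ) / (2 * m) = ((q / (2 * m) : ℝ) : ℂ) := by push_cast; ring
    rw [hτ]; simp only; rw [this]; simp only [add_im, ofReal_im, ofReal_re, I_mul_im]; simp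
  have hτre : ∀ ε, (τ ε).re = q / (2 * m) := by
    intro ε
    have : (q : ℂ) / (2 * m) = ((q / (2 * m) : ℝ) : ℂ) := by push_cast; ring
    rw [hτ]; simp only; rw [this]; simp only [add_re, ofReal_im, ofReal_re, I_mul_re]; simp
  have hτ0 : ∀ ε, τ ε ≠ 0 := by
    intro ε h
    have := hτre ε
    rw [h] at this
    have h2 : 0 < (q : ℝ) / (2 * m) := by positivity
    rw [zero_re] at this
    linarith
  -- in terms of `w`, the theta series at `-1/τ` has coefficients of period `q` in `n`
  set w : ℝ → ℂ := fun ε => 2 * m * ε / (q * τ ε) with hwdef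
  -- the two asymptotic expansions
  have A1 : Tendsto (fun ε : ℝ => (((4 * m : ℕ) : ℂ) ^ 2 * (ε : ℂ)) ^ (1 / 2 : ℂ) *
      jacobiTheta₂ 0 (τ ε)) (𝓝[>] 0) (𝓝 (quadGauss q (4 * m))) := by
    have h := tendsto_tsum_periodic_exp_neg_sq (4 * m)
      (fun x => ZMod.stdAddChar ((q : ZMod (4 * m)) * x ^ 2)) (l := 𝓝[>] (0 : ℝ))
      (w := fun ε => (ε : ℂ)) (by
        refine tendsto_inv_nhdsGT_zero.congr fun ε => ?_
        rw [← ofReal_inv, ofReal_re])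
    simp only [quadGauss, Int.cast_natCast]
    refine h.congr fun ε => ?_
    congr 1
    unfold jacobiTheta₂
    refine tsum_congr fun n => ?_
    have : ((q : ZMod (4 * m)) * (n : ZMod (4 * m)) ^ 2) = ((q * n ^ 2 : ℤ) : ZMod (4 * m)) := by
      push_cast; ring
    rw [this, ZMod.stdAddChar_coe, jacobiTheta₂_term, ← exp_add, hτ]
    congr 1
    push_cast
    field_simp
    linear_combination (-8 * (n : ℂ) ^ 2 * ε * m) * I_mul_I
  have A2 : Tendsto (fun ε : ℝ => ((q : ℂ) ^ 2 * w ε) ^ (1 / 2 : ℂ) *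
      jacobiTheta₂ 0 (-1 / τ ε)) (𝓝[>] 0) (𝓝 (quadGauss (-m) q)) := by
    have h := tendsto_tsum_periodic_exp_neg_sq q
      (fun x => ZMod.stdAddChar (((-m : ℤ) : ZMod q) * x ^ 2)) (l := 𝓝[>] (0 : ℝ))
      (w := w) (by
        have hpos : (0 : ℝ) < q ^ 2 / (4 * m ^ 2) := by positivity
        refine (tendsto_inv_nhdsGT_zero.const_mul_atTop hpos).congr fun ε => ?_
        have : (w ε)⁻¹ = ((q / (2 * m) * ε⁻¹ : ℝ) : ℂ) * τ ε := by
          rw [hwdef]; simp only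
          push_cast
          rw [inv_div]
          field_simp
        rw [this, re_ofReal_mul, hτre]
        field_simp
        ring)
    refine h.congr fun ε => ?_
    congr 1
    unfold jacobiTheta₂
    refine tsum_congr fun n => ?_
    have : ((((-m : ℤ)) : ZMod q) * (n : ZMod q) ^ 2) = ((-m * n ^ 2 : ℤ) : ZMod q) := by
      push_cast; ring
    rw [this, ZMod.stdAddChar_coe, jacobiTheta₂_term, ← exp_add, hwdef]
    congr 1
    push_cast
    have h0 := hτ0 ε
    field_simp
    rw [hτ]
    field_simp
    ring_nf
    rw [I_sq]
    ring
  -- the comparison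
  have ratio : ∀ ε : ℝ, 0 < ε → (((4 * m : ℕ) : ℂ) ^ 2 * (ε : ℂ)) ^ (1 / 2 : ℂ) *
      jacobiTheta₂ 0 (τ ε) = ((Real.sqrt (16 * m ^ 2 / (2 * q * m)) : ℝ) : ℂ) /
        ((-I * τ ε) ^ (1 / 2 : ℂ) * ((τ ε)⁻¹) ^ (1 / 2 : ℂ)) *
      (((q : ℂ) ^ 2 * w ε) ^ (1 / 2 : ℂ) * jacobiTheta₂ 0 (-1 / τ ε)) := by
    intro ε hε
    have h := jacobiTheta₂_functional_equation 0 (τ ε)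
    have hz : (-I * τ ε) ^ (1 / 2 : ℂ) ≠ 0 := by
      rw [Ne, cpow_eq_zero_iff]; simp [hτ0]
    have hz' : ((τ ε)⁻¹) ^ (1 / 2 : ℂ) ≠ 0 := by
      rw [Ne, cpow_eq_zero_iff]; simp [hτ0]
    have hw1 : (q : ℂ) ^ 2 * w ε = ((2 * q * m * ε : ℝ) : ℂ) * (τ ε)⁻¹ := by
      rw [hwdef]; simp only
      push_cast
      have := hτ0 ε
      field_simp
    have hw2 : ((4 * m : ℕ) : ℂ) ^ 2 * (ε : ℂ) =
        ((16 * m ^ 2 / (2 * q * m) : ℝ) : ℂ) * ((2 * q * m * ε : ℝ) : ℂ) := by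
      push_cast; field_simp; ring
    have hτi := inv_ne_zero (hτ0 ε)
    rw [hw1, hw2, mul_cpow_ofReal_nonneg (by positivity) (by positivity),
      ofReal_mul_cpow (by positivity) hτi, h, ofReal_cpow_half (by positivity)]
    simp only [ne_eq, OfNat.ofNat_ne_zero, not_false_eq_true, zero_pow, mul_zero, zero_div,
      exp_zero, mul_one]
    generalize (-I * τ ε) ^ (1 / 2 : ℂ) = A at *
    generalize (τ ε)⁻¹ ^ (1 / 2 : ℂ) = B at *
    field_simp
  -- passage to the limit
  have hτlim : Tendsto τ (𝓝[>] 0) (𝓝 ((q / (2 * m) : ℝ) : ℂ)) := by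
    have h : ContinuousAt τ 0 := by rw [hτ]; fun_prop
    have h2 := h.tendsto.mono_left (nhdsWithin_le_nhds (s := Set.Ioi 0))
    simpa [hτ] using h2
  set x : ℝ := q / (2 * m) with hx
  have hx0 : 0 < x := by positivity
  have hx0C : (x : ℂ) ≠ 0 := by exact_mod_cast hx0.ne'
  have L1 : Tendsto (fun ε => (-I * τ ε) ^ (1 / 2 : ℂ)) (𝓝[>] 0) (𝓝 ((-I * x) ^ (1 / 2 : ℂ))) := by
    refine (hτlim.const_mul (-I)).cpow tendsto_const_nhds ?_
    right
    simp [hx0.ne']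
  have L2 : Tendsto (fun ε => ((τ ε)⁻¹) ^ (1 / 2 : ℂ)) (𝓝[>] 0)
      (𝓝 (((x : ℂ)⁻¹) ^ (1 / 2 : ℂ))) := by
    refine (hτlim.inv₀ hx0C).cpow tendsto_const_nhds ?_
    left
    rw [← ofReal_inv, ofReal_re]
    positivity
  have v2 : ((x : ℂ)⁻¹) ^ (1 / 2 : ℂ) = ((Real.sqrt x)⁻¹ : ℝ) := by
    rw [← ofReal_inv, ofReal_cpow_half (by positivity), Real.sqrt_inv]
  have v1 : (-I * x) ^ (1 / 2 : ℂ) = (Real.sqrt x : ℝ) * ((1 - I) / (Real.sqrt 2 : ℝ)) := by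
    rw [mul_comm (-I), ofReal_mul_cpow hx0 (by simp), ofReal_cpow_half hx0.le]
    congr 1
    rw [cpow_def_of_ne_zero (by simp), log_neg_I]
    have : -(↑Real.pi / 2) * I * (1 / 2) = ((-(Real.pi / 4) : ℝ) : ℂ) * I := by
      push_cast; ring
    rw [this, exp_mul_I, ← ofReal_cos, ← ofReal_sin, Real.cos_neg, Real.sin_neg,
      Real.cos_pi_div_four, Real.sin_pi_div_four]
    have h2 : ((Real.sqrt 2 : ℝ) : ℂ) ^ 2 = 2 := by
      rw [← ofReal_pow, Real.sq_sqrt (by norm_num)]; norm_num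
    have h3 : ((Real.sqrt 2 : ℝ) : ℂ) ≠ 0 := by
      intro h; rw [h] at h2; norm_num at h2
    push_cast
    field_simp
    rw [h2]
    ring
  have hsx : ((Real.sqrt x : ℝ) : ℂ) ≠ 0 := by exact_mod_cast (Real.sqrt_pos.2 hx0).ne'
  have hs2 : ((Real.sqrt 2 : ℝ) : ℂ) ≠ 0 := by
    exact_mod_cast (Real.sqrt_pos.2 (by norm_num : (0 : ℝ) < 2)).ne'
  have h1I : (1 - I : ℂ) ≠ 0 := by
    intro h; have := congrArg re h; have := congrArg im h; simp at this
  have vprod : (-I * x) ^ (1 / 2 : ℂ) * ((x : ℂ)⁻¹) ^ (1 / 2 : ℂ) =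
      (1 - I) / (Real.sqrt 2 : ℝ) := by
    rw [v1, v2]; push_cast; field_simp
  have L3 := ((tendsto_const_nhds (x := ((Real.sqrt (16 * m ^ 2 / (2 * q * m)) : ℝ) : ℂ))).div
    (L1.mul L2) (by rw [vprod]; exact div_ne_zero h1I hs2)).mul A2
  have key := tendsto_nhds_unique A1 (L3.congr' (by
    filter_upwards [self_mem_nhdsWithin] with ε hε
    exact (ratio ε hε).symm))
  rw [key, vprod]
  congr 1
  have e2 : (16 * m ^ 2 / (2 * q * m) : ℝ) = 2 * (4 * m / q) := by
    field_simp; ring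
  rw [e2, Real.sqrt_mul (by norm_num), div_div_eq_mul_div, div_eq_iff h1I]
  have h2 : ((Real.sqrt 2 : ℝ) : ℂ) * (Real.sqrt 2 : ℝ) = 2 := by
    rw [← ofReal_mul, Real.mul_self_sqrt (by norm_num)]; norm_num
  push_cast
  linear_combination ((Real.sqrt (4 * m / q) : ℝ) : ℂ) * h2 +
    ((Real.sqrt (4 * m / q) : ℝ) : ℂ) * I_mul_I

/-- Grouping the sum by the values of `x²` turns `S(a, p)` into the Gauss sum of the quadratic
character. -/
lemma quadGauss_prime (p : ℕ) [Fact p.Prime] (hp : p ≠ 2) (a : ℤ) (ha : (a : ZMod p) ≠ 0) :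
    quadGauss a p = (jacobiSym a p : ℂ) * quadGauss 1 p := by
  have hF : ringChar (ZMod p) ≠ 2 := by rwa [ZMod.ringChar_zmod_n]
  have hχ := quadraticChar_card_sqrts hF
  set ψ : AddChar (ZMod p) ℂ := ZMod.stdAddChar with hψ
  set χ : MulChar (ZMod p) ℂ := (quadraticChar (ZMod p)).ringHomComp (Int.castRingHom ℂ) with hχdef
  have hprim : ψ.IsPrimitive := ZMod.isPrimitive_stdAddChar p
  have main : ∀ b : ZMod p, b ≠ 0 → ∑ x : ZMod p, ψ (b * x ^ 2) = gaussSum χ (ψ.mulShift b) := by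
    intro b hb
    have h1 : ∑ x : ZMod p, ψ (b * x ^ 2) = ∑ y : ZMod p, (χ y + 1) * ψ (b * y) := by
      rw [← Finset.sum_fiberwise Finset.univ (fun x : ZMod p => x ^ 2)]
      refine Finset.sum_congr rfl fun y _ => ?_
      rw [Finset.sum_congr rfl (g := fun _ => ψ (b * y)) (by
        intro x hx
        rw [(Finset.mem_filter.1 hx).2])]
      rw [Finset.sum_const, nsmul_eq_mul]
      congr 1
      have := hχ y
      rw [hχdef, MulChar.ringHomComp_apply]
      have h2 : ((((Finset.univ.filter fun x : ZMod p => x ^ 2 = y).card : ℕ) : ℤ) : ℂ) =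
          ((quadraticChar (ZMod p) y + 1 : ℤ) : ℂ) := by
        rw [← this]
        congr 3
        ext x
        simp
      simpa using h2
    rw [h1]
    simp_rw [add_mul, one_mul]
    rw [Finset.sum_add_distrib]
    have h2 : ∑ y : ZMod p, ψ (b * y) = 0 := by
      have := AddChar.sum_mulShift (ψ := ψ) b hprim
      rw [if_neg hb] at this
      simpa [mul_comm] using this
    rw [h2, add_zero]
    rfl
  have hu := gaussSum_mulShift χ ψ (Units.mk0 _ ha)
  simp only [Units.val_mk0] at hu
  have hsq : χ (a : ZMod p) * χ (a : ZMod p) = 1 := by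
    rw [hχdef, MulChar.ringHomComp_apply, ← map_mul, ← sq, quadraticChar_sq_one ha, map_one]
  have hJ : (jacobiSym a p : ℂ) = χ (a : ZMod p) := by
    rw [← jacobiSym.legendreSym.to_jacobiSym, hχdef, MulChar.ringHomComp_apply]
    rfl
  have e1 : quadGauss a p = gaussSum χ (ψ.mulShift a) := main a ha
  have e2 : quadGauss 1 p = gaussSum χ ψ := by
    have := main 1 one_ne_zero
    rw [AddChar.mulShift_one] at this
    rw [← this]
    simp [quadGauss, hψ]
  rw [e1, e2, hJ, ← hu]
  linear_combination (-gaussSum χ (ψ.mulShift a)) * hsq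

lemma stdAddChar_four_one : ZMod.stdAddChar (1 : ZMod 4) = I := by
  have h := ZMod.stdAddChar_coe (N := 4) 1
  rw [Int.cast_one] at h
  rw [h]
  have : 2 * Real.pi * I * ((1 : ℤ) : ℂ) / ((4 : ℕ) : ℂ) = Real.pi / 2 * I := by
    push_cast; ring
  rw [this, exp_pi_div_two_mul_I]

lemma quadGauss_four (q : ℤ) : quadGauss q 4 = 2 + 2 * ZMod.stdAddChar (q : ZMod 4) := by
  have h : ∀ f : ZMod 4 → ℂ, ∑ x, f x = f 0 + f 1 + f 2 + f 3 := fun f => Fin.sum_univ_four f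
  unfold quadGauss
  rw [h]
  have h2 : (2 : ZMod 4) ^ 2 = 0 := by decide
  have h3 : (3 : ZMod 4) ^ 2 = 1 := by decide
  rw [h2, h3]
  simp
  ring

lemma one_add_I_mul_one_sub_I : (1 + I) * (1 - I) = 2 := by
  linear_combination -I_mul_I

/-- The sign of the quadratic Gauss sum: reciprocity reduces it to a sum modulo four. -/
lemma quadGauss_one (q : ℕ) (hq : q % 2 = 1) [NeZero q] :
    quadGauss 1 q = eps q * (Real.sqrt q : ℝ) := by
  have h := quadGauss_reciprocity 1 q
  have hqpos : (0 : ℝ) < q := by exact_mod_cast Nat.pos_of_ne_zero (NeZero.ne q)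
  have hs : ((Real.sqrt q : ℝ) : ℂ) ≠ 0 := by exact_mod_cast (Real.sqrt_pos.2 hqpos).ne'
  have h4 : (Real.sqrt (4 * ((1 : ℕ) : ℝ) / q) : ℝ) = 2 / Real.sqrt q := by
    rw [Real.sqrt_div (by norm_num)]
    congr 1
    rw [show (4 * ((1 : ℕ) : ℝ)) = 2 ^ 2 by norm_num, Real.sqrt_sq (by norm_num)]
  rw [h4, quadGauss_neg] at h
  change quadGauss (q : ℤ) 4 = _ at h
  rw [quadGauss_four] at h
  push_cast at h
  have key : (starRingEnd ℂ) (quadGauss 1 q) = (1 - I) / 2 * (Real.sqrt q : ℝ) *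
      (1 + ZMod.stdAddChar (q : ZMod 4)) := by
    have h' : (1 + ZMod.stdAddChar (q : ZMod 4)) * (Real.sqrt q : ℝ) =
      (1 + I) * (starRingEnd ℂ) (quadGauss 1 q) := by
      field_simp at h
      linear_combination h
    linear_combination (-(1 - I) / 2) * h' - ((starRingEnd ℂ) (quadGauss 1 q) / 2) *
      one_add_I_mul_one_sub_I
  have key2 := congrArg (starRingEnd ℂ) key
  rw [conj_conj] at key2
  rw [key2]
  rcases (by omega : q % 4 = 1 ∨ q % 4 = 3) with h1 | h1
  · have hc : ((q : ℕ) : ZMod 4) = 1 := by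
      have : ((q : ℕ) : ZMod 4) = ((1 : ℕ) : ZMod 4) := by
        rw [ZMod.natCast_eq_natCast_iff]; exact h1
      simpa using this
    have he : eps (q : ℤ) = 1 := if_pos (by omega)
    rw [hc, stdAddChar_four_one, he]
    simp only [map_mul, map_add, map_sub, map_div₀, map_one, conj_I, conj_ofReal, map_ofNat]
    linear_combination ((Real.sqrt q : ℝ) : ℂ) / 2 * one_add_I_mul_one_sub_I
  · have hc : ((q : ℕ) : ZMod 4) = -1 := by
      have : ((q : ℕ) : ZMod 4) = ((3 : ℕ) : ZMod 4) := by
        rw [ZMod.natCast_eq_natCast_iff]; exact h1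
      rw [this]; decide
    have he : eps (q : ℤ) = I := if_neg (by omega)
    rw [hc, AddChar.map_neg_eq_conj, stdAddChar_four_one, he]
    simp only [map_mul, map_add, map_sub, map_div₀, map_one, map_neg, conj_I, conj_ofReal,
      map_ofNat]
    linear_combination ((Real.sqrt q : ℝ) : ℂ) / 2 * I_mul_I

lemma jacobiSym_four_mul (m : ℕ) {d : ℕ} (hd : d % 2 = 1) :
    jacobiSym ((4 * m : ℕ) : ℤ) d = jacobiSym m d := by
  have h2 : Int.gcd 2 d = 1 := by
    have h : Nat.Coprime 2 d := Nat.coprime_two_left.2 (Nat.odd_iff.2 hd)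
    exact h
  rw [Nat.cast_mul, jacobiSym.mul_left, show ((4 : ℕ) : ℤ) = 2 ^ 2 by norm_num,
    jacobiSym.sq_one' h2, one_mul]

/-- Evaluation of quadratic Gauss sums for a modulus divisible by four and positive `d`; a prime in
the residue class of `d` may be substituted for `d`. -/
lemma quadGauss_eq_of_pos (m : ℕ) [NeZero m] [NeZero (4 * m)] (d : ℕ) (hd : Nat.Coprime d (4 * m)) :
    quadGauss d (4 * m) =
      (1 + I) * (eps d)⁻¹ * (jacobiSym ((4 * m : ℕ) : ℤ) d : ℂ) * (Real.sqrt (4 * m) : ℝ) := by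
  obtain ⟨p, hpgt, hp, hpd⟩ := Nat.forall_exists_prime_gt_and_eq_mod
    ((ZMod.isUnit_iff_coprime d (4 * m)).2 hd) (4 * m)
  have := Fact.mk hp
  have : NeZero p := ⟨hp.ne_zero⟩
  have hmod : p % (4 * m) = d % (4 * m) := (ZMod.natCast_eq_natCast_iff _ _ _).1 hpd
  have hmod4 : p % 4 = d % 4 := by
    rw [← Nat.mod_mul_right_mod p 4 m, hmod, Nat.mod_mul_right_mod]
  have hdodd : d % 2 = 1 := by
    have : Nat.Coprime d 2 := Nat.Coprime.coprime_dvd_right ⟨2 * m, by ring⟩ hd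
    exact Nat.odd_iff.1 (Nat.coprime_two_right.1 this)
  have hpodd : p % 2 = 1 := by omega
  have hm0 : 0 < m := Nat.pos_of_ne_zero (NeZero.ne m)
  have hppos : (0 : ℝ) < p := by exact_mod_cast hp.pos
  have e1 : quadGauss d (4 * m) = quadGauss p (4 * m) := by
    unfold quadGauss
    simp only [Int.cast_natCast, hpd]
  have e2 : eps d = eps p := by
    unfold eps
    have : ((d : ℤ) % 4 = 1) ↔ ((p : ℤ) % 4 = 1) := by omega
    simp [this]
  have e3 : jacobiSym ((4 * m : ℕ) : ℤ) d = jacobiSym ((m : ℕ) : ℤ) p := by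
    rw [jacobiSym_four_mul m hdodd, jacobiSym.mod_right' m (Nat.odd_iff.2 hdodd), ← hmod,
      ← jacobiSym.mod_right' m (Nat.odd_iff.2 hpodd)]
  have hmp : ((m : ℤ) : ZMod p) ≠ 0 := by
    rw [Int.cast_natCast, Ne, ZMod.natCast_eq_zero_iff]
    intro h
    have := Nat.le_of_dvd hm0 h
    omega
  rw [e1, e2, e3, quadGauss_reciprocity, quadGauss_neg, quadGauss_prime p (by omega) m hmp,
    quadGauss_one p hpodd]
  have hsp : ((Real.sqrt p : ℝ) : ℂ) ≠ 0 := by exact_mod_cast (Real.sqrt_pos.2 hppos).ne'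
  have hconj : (starRingEnd ℂ) (eps p) = (eps p)⁻¹ := by
    unfold eps
    split_ifs <;> simp
  rw [Real.sqrt_div (by positivity)]
  simp only [map_mul, conj_ofReal, hconj, map_intCast]
  push_cast
  field_simp

/-- Evaluation of quadratic Gauss sums, `S(d, c) = (1 + i) ε_d⁻¹ (c/d) √c` for `4 ∣ c`. -/
theorem quadGauss_eq (c : ℕ) [NeZero c] (hc : 4 ∣ c) (d : ℤ) (hd : IsCoprime (c : ℤ) d) :
    quadGauss d c = (1 + I) * (eps d)⁻¹ * (kronecker c d : ℂ) * (Real.sqrt c : ℝ) := by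
  obtain ⟨m, rfl⟩ := hc
  have : NeZero m := ⟨by rintro rfl; exact NeZero.ne (4 * 0) rfl⟩
  have hcop : Nat.Coprime d.natAbs (4 * m) := by
    have := Int.isCoprime_iff_gcd_eq_one.1 hd
    rw [Nat.coprime_comm]
    exact this
  have hk : kronecker ((4 * m : ℕ) : ℤ) d = jacobiSym ((4 * m : ℕ) : ℤ) d.natAbs := by
    unfold kronecker
    rw [if_neg (by rintro ⟨h, -⟩; omega), one_mul]
  have hdodd : d.natAbs % 2 = 1 := by
    have : Nat.Coprime d.natAbs 2 := Nat.Coprime.coprime_dvd_right ⟨2 * m, by ring⟩ hcop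
    exact Nat.odd_iff.1 (Nat.coprime_two_right.1 this)
  have hpos := quadGauss_eq_of_pos m d.natAbs hcop
  have hsqrt : Real.sqrt ((4 * m : ℕ) : ℝ) = Real.sqrt (4 * m) := by push_cast; rfl
  rw [hk, hsqrt]
  rcases Int.natAbs_eq d with h | h
  · rw [← h] at hpos
    exact hpos
  · have h' : d = -(d.natAbs : ℤ) := h
    set e := d.natAbs with he
    rw [h', quadGauss_neg, hpos]
    simp only [map_mul, conj_ofReal, map_intCast, map_add, map_one, conj_I, map_inv₀]
    congr 2
    unfold eps
    rcases (by omega : e % 4 = 1 ∨ e % 4 = 3) with h1 | h1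
    · rw [if_pos (by omega), if_neg (by omega)]
      simp
      linear_combination I_mul_I
    · rw [if_neg (by omega), if_pos (by omega)]
      simp
      linear_combination (-1 : ℂ) * I_mul_I

/-- For `4 ∣ c` the factor `ε_d (c/d)` of the Eisenstein series is a Gauss sum, and therefore
extends to a function of `d` modulo `c`. -/
theorem eps_mul_kronecker (c : ℕ) [NeZero c] (hc : 4 ∣ c) (d : ℤ) (hd : IsCoprime (c : ℤ) d) :
    eps d * (kronecker c d : ℂ) = (1 + I) / 2 * ((Real.sqrt c : ℝ) : ℂ)⁻¹ * quadGauss (-d) c := by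
  have hs : ((Real.sqrt c : ℝ) : ℂ) ≠ 0 := by
    have : (0 : ℝ) < c := by exact_mod_cast Nat.pos_of_ne_zero (NeZero.ne c)
    exact_mod_cast (Real.sqrt_pos.2 this).ne'
  have hconj : (starRingEnd ℂ) (eps d) = (eps d)⁻¹ := by
    unfold eps
    split_ifs <;> simp
  rw [quadGauss_neg, quadGauss_eq c hc d hd]
  simp only [map_mul, conj_ofReal, map_intCast, map_add, map_one, conj_I, ← hconj, conj_conj]
  field_simp
  linear_combination (-(eps d * (kronecker c d : ℂ))) * one_add_I_mul_one_sub_I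

/-! ### Counting square roots modulo `c` -/

lemma sum_zmod_eq_sum_range (c : ℕ) [NeZero c] {A : Type*} [AddCommMonoid A] (f : ZMod c → A) :
    ∑ x, f x = ∑ i ∈ Finset.range c, f (i : ZMod c) := by
  obtain ⟨k, rfl⟩ := Nat.exists_eq_succ_of_ne_zero (NeZero.ne c)
  rw [← Fin.sum_univ_eq_sum_range (fun i => f ((i : ℕ) : ZMod (k + 1)))]
  exact Finset.sum_congr rfl fun x _ => congrArg f (ZMod.natCast_zmod_val (n := k + 1) x).symm

lemma sum_range_mul_of_periodic {A : Type*} [AddCommMonoid A] (g : ℕ → A) (e : ℕ)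
    (hg : ∀ i, g (e + i) = g i) (k : ℕ) :
    ∑ i ∈ Finset.range (k * e), g i = k • ∑ i ∈ Finset.range e, g i := by
  induction k with
  | zero => simp
  | succ k ih =>
    rw [show (k + 1) * e = e + k * e by ring, Finset.sum_range_add]
    simp_rw [hg]
    rw [ih, succ_nsmul, add_comm]

/-- The number of solutions of `x² ≡ n (mod c)`. -/
def rootCount (n : ℤ) (c : ℕ) : ℕ := ((Finset.range c).filter fun x : ℕ => (c : ℤ) ∣ x ^ 2 - n).card

lemma rootCount_eq_zmod (n : ℤ) (c : ℕ) [NeZero c] :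
    rootCount n c = (Finset.univ.filter fun x : ZMod c => x ^ 2 = n).card := by
  rw [rootCount, Finset.card_filter, Finset.card_filter, sum_zmod_eq_sum_range]
  refine Finset.sum_congr rfl fun i _ => ?_
  have : ((c : ℤ) ∣ i ^ 2 - n) ↔ ((i : ZMod c) ^ 2 = n) := by
    rw [← ZMod.intCast_eq_intCast_iff_dvd_sub n (i ^ 2) c]
    push_cast
    exact eq_comm
  simp only [this]

lemma rootCount_one (n : ℤ) : rootCount n 1 = 1 := by
  simp [rootCount]

lemma rootCount_mul (n : ℤ) {a b : ℕ} (ha : a ≠ 0) (hb : b ≠ 0) (hab : a.Coprime b) :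
    rootCount n (a * b) = rootCount n a * rootCount n b := by
  have : NeZero a := ⟨ha⟩
  have : NeZero b := ⟨hb⟩
  have : NeZero (a * b) := ⟨mul_ne_zero ha hb⟩
  rw [rootCount_eq_zmod, rootCount_eq_zmod, rootCount_eq_zmod, ← Finset.card_product]
  refine Finset.card_equiv (ZMod.chineseRemainder hab).toEquiv fun x => ?_
  simp only [Finset.mem_filter, Finset.mem_univ, true_and, Finset.mem_product]
  rw [← (ZMod.chineseRemainder hab).injective.eq_iff, map_pow, map_intCast, Prod.ext_iff]
  rfl

lemma rootCount_congr {n n' : ℤ} {c : ℕ} (h : (c : ℤ) ∣ n - n') :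
    rootCount n c = rootCount n' c := by
  unfold rootCount
  congr 1
  refine Finset.filter_congr fun x _ => ?_
  rw [show (x : ℤ) ^ 2 - n' = (x ^ 2 - n) + (n - n') by ring]
  exact (dvd_add_left h).symm

/-- `rootCount n` as an arithmetic function. -/
def rootFun (n : ℤ) : ArithmeticFunction ℤ := ⟨fun c => rootCount n c, by simp [rootCount]⟩

lemma rootFun_isMultiplicative (n : ℤ) : (rootFun n).IsMultiplicative := by
  rw [ArithmeticFunction.IsMultiplicative.iff_ne_zero]
  refine ⟨by simp [rootFun, rootCount_one], fun {a b} ha hb hab => ?_⟩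
  simp [rootFun, rootCount_mul n ha hb hab]

/-- The function `h_n = μ * rootCount n`, whose Dirichlet series is the `n`-th Fourier coefficient
of the Eisenstein series. -/
def rootMoebius (n : ℤ) : ArithmeticFunction ℤ := ArithmeticFunction.moebius * rootFun n

lemma rootMoebius_isMultiplicative (n : ℤ) : (rootMoebius n).IsMultiplicative :=
  ArithmeticFunction.isMultiplicative_moebius.mul (rootFun_isMultiplicative n)

lemma sum_rootMoebius_divisors (n : ℤ) (c : ℕ) (hc : 0 < c) :
    ∑ e ∈ c.divisors, rootMoebius n e = rootCount n c := by
  refine (ArithmeticFunction.sum_eq_iff_sum_mul_moebius_eq (f := fun e => rootMoebius n e)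
    (g := fun e => (rootCount n e : ℤ))).2 (fun k hk => ?_) c hc
  rfl

lemma rootMoebius_one (n : ℤ) : rootMoebius n 1 = 1 := (rootMoebius_isMultiplicative n).1

lemma rootMoebius_prime_pow_succ (n : ℤ) {p : ℕ} (hp : p.Prime) (k : ℕ) :
    rootMoebius n (p ^ (k + 1)) = rootCount n (p ^ (k + 1)) - rootCount n (p ^ k) := by
  rw [← sum_rootMoebius_divisors n _ (pow_pos hp.pos _),
    ← sum_rootMoebius_divisors n _ (pow_pos hp.pos _),
    Nat.sum_divisors_prime_pow hp, Nat.sum_divisors_prime_pow hp, Finset.sum_range_succ _ (k + 1)]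
  ring

/-! ### The exponential sum attached to `h_n` -/

/-- `∑_{x mod c} e(r (n - x²) / c)`. -/
noncomputable def shiftedGauss (n : ℤ) (c : ℕ) [NeZero c] (r : ZMod c) : ℂ :=
  ∑ x : ZMod c, ZMod.stdAddChar (r * ((n : ZMod c) - x ^ 2))

lemma shiftedGauss_eq (n : ℤ) (c : ℕ) [NeZero c] (r : ℤ) :
    shiftedGauss n c r = ZMod.stdAddChar ((n : ZMod c) * (r : ZMod c)) * quadGauss (-r) c := by
  unfold shiftedGauss quadGauss
  rw [Finset.mul_sum]
  refine Finset.sum_congr rfl fun x _ => ?_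
  rw [← AddChar.map_add_eq_mul]
  congr 1
  push_cast
  ring

lemma stdAddChar_mul_mul (k e : ℕ) [NeZero k] [NeZero e] [NeZero (k * e)] (j : ℤ) :
    ZMod.stdAddChar ((k * j : ℤ) : ZMod (k * e)) = ZMod.stdAddChar (j : ZMod e) := by
  rw [ZMod.stdAddChar_coe, ZMod.stdAddChar_coe]
  have hk : (k : ℂ) ≠ 0 := by exact_mod_cast NeZero.ne k
  have he : (e : ℂ) ≠ 0 := by exact_mod_cast NeZero.ne e
  congr 1
  push_cast
  field_simp

lemma shiftedGauss_mul (n : ℤ) (k e : ℕ) [NeZero k] [NeZero e] [NeZero (k * e)] (r : ℕ) :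
    shiftedGauss n (k * e) ((k * r : ℕ) : ZMod (k * e)) = k * shiftedGauss n e (r : ZMod e) := by
  unfold shiftedGauss
  rw [sum_zmod_eq_sum_range, sum_zmod_eq_sum_range, ← nsmul_eq_mul,
    ← sum_range_mul_of_periodic (fun i : ℕ => ZMod.stdAddChar ((r : ZMod e) *
      ((n : ZMod e) - (i : ZMod e) ^ 2))) e (by intro i; simp)]
  refine Finset.sum_congr rfl fun i _ => ?_
  have := stdAddChar_mul_mul k e (r * (n - i ^ 2))
  convert this using 2
  · push_cast; ring
  · push_cast; ring

/-- Summation over fractions `r / c` according to their reduced denominators. -/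
lemma sum_range_eq_sum_divisors {A : Type*} [AddCommMonoid A] (c : ℕ) (hc : 0 < c) (f : ℕ → A) :
    ∑ r ∈ Finset.range c, f r = ∑ e ∈ c.divisors,
      ∑ r ∈ (Finset.range e).filter (fun r => Nat.Coprime r e), f ((c / e) * r) := by
  rw [← Finset.sum_fiberwise_of_maps_to (s := Finset.range c) (t := c.divisors)
    (g := fun r => c / Nat.gcd r c)
    (fun r _ => Nat.mem_divisors.2 ⟨Nat.div_dvd_of_dvd (Nat.gcd_dvd_right r c), hc.ne'⟩)]
  refine Finset.sum_congr rfl fun e he => ?_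
  obtain ⟨k, hk⟩ := (Nat.mem_divisors.1 he).1
  have he0 : 0 < e := Nat.pos_of_mem_divisors he
  have hk0 : 0 < k := Nat.pos_of_ne_zero (by rintro rfl; omega)
  have hce : c / e = k := by rw [hk, Nat.mul_div_cancel_left _ he0]
  rw [hce]
  symm
  refine Finset.sum_bij (fun r _ => k * r) ?_ ?_ ?_ ?_
  · intro r hr
    obtain ⟨hr1, hr2⟩ := Finset.mem_filter.1 hr
    refine Finset.mem_filter.2 ⟨Finset.mem_range.2 ?_, ?_⟩
    · rw [hk, mul_comm e k]
      exact Nat.mul_lt_mul_of_pos_left (Finset.mem_range.1 hr1) hk0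
    · rw [hk, mul_comm e k, Nat.gcd_mul_left, hr2, mul_one, Nat.mul_div_cancel_left _ hk0]
  · intro a _ b _ h
    exact Nat.eq_of_mul_eq_mul_left hk0 h
  · intro r hr
    obtain ⟨hr1, hr2⟩ := Finset.mem_filter.1 hr
    have hg : Nat.gcd r c = k := by
      have h1 := Nat.div_mul_cancel (Nat.gcd_dvd_right r c)
      rw [hr2, hk] at h1
      rw [hk]
      exact Nat.eq_of_mul_eq_mul_left he0 h1
    obtain ⟨r', hr'⟩ : k ∣ r := hg ▸ Nat.gcd_dvd_left r c
    refine ⟨r', Finset.mem_filter.2 ⟨Finset.mem_range.2 ?_, ?_⟩, hr'.symm⟩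
    · have := Finset.mem_range.1 hr1
      rw [hr', hk, mul_comm e k] at this
      exact Nat.lt_of_mul_lt_mul_left this
    · rw [hr', hk, mul_comm e k, Nat.gcd_mul_left] at hg
      exact Nat.eq_of_mul_eq_mul_left hk0 (by rw [hg, mul_one])
  · intros; rfl

/-- The sum of `shiftedGauss n c r` over the units `r` modulo `c`. -/
noncomputable def unitGaussSum (n : ℤ) (c : ℕ) [NeZero c] : ℂ :=
  ∑ r ∈ (Finset.range c).filter (fun r => Nat.Coprime r c), shiftedGauss n c (r : ZMod c)

lemma sum_shiftedGauss (n : ℤ) (c : ℕ) [NeZero c] :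
    ∑ r : ZMod c, shiftedGauss n c r = c * rootCount n c := by
  unfold shiftedGauss
  rw [Finset.sum_comm]
  have h : ∀ x : ZMod c, ∑ r : ZMod c, ZMod.stdAddChar (r * ((n : ZMod c) - x ^ 2)) =
      if x ^ 2 = n then (c : ℂ) else 0 := by
    intro x
    rw [AddChar.sum_mulShift _ (ZMod.isPrimitive_stdAddChar c), ZMod.card]
    simp only [sub_eq_zero, eq_comm]
    split_ifs <;> simp
  simp_rw [h]
  rw [rootCount_eq_zmod, ← Finset.sum_filter, Finset.sum_const, nsmul_eq_mul, mul_comm]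

/-- Both sides, divided by `c`, have `rootCount n` as their divisor sum. -/
lemma unitGaussSum_eq (n : ℤ) (c : ℕ) [NeZero c] :
    unitGaussSum n c = c * (rootMoebius n c : ℂ) := by
  -- `V e` is `unitGaussSum n e / e`; the sum needs a nonzero modulus, whence the case `e = 0`
  let V : ℕ → ℂ := fun e => if h : e = 0 then 0 else
    (e : ℂ)⁻¹ * @unitGaussSum n e ⟨h⟩
  have hV : ∀ e : ℕ, 0 < e → ∑ i ∈ e.divisors, V i = (rootCount n e : ℂ) := by
    intro e he
    have : NeZero e := ⟨he.ne'⟩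
    have heC : (e : ℂ) ≠ 0 := by exact_mod_cast he.ne'
    have h1 := sum_shiftedGauss n e
    rw [sum_zmod_eq_sum_range, sum_range_eq_sum_divisors e he] at h1
    have h2 : ∀ i ∈ e.divisors, ∑ r ∈ (Finset.range i).filter (fun r => Nat.Coprime r i),
        shiftedGauss n e (((e / i * r : ℕ)) : ZMod e) = e * V i := by
      intro i hi
      obtain ⟨k, hk⟩ := (Nat.mem_divisors.1 hi).1
      have hi0 : 0 < i := Nat.pos_of_mem_divisors hi
      have hk0 : k ≠ 0 := by rintro rfl; omega
      have : NeZero i := ⟨hi0.ne'⟩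
      have : NeZero k := ⟨hk0⟩
      have hiC : (i : ℂ) ≠ 0 := by exact_mod_cast hi0.ne'
      obtain rfl : e = k * i := by rw [hk, mul_comm]
      rw [Nat.mul_div_cancel _ hi0]
      simp only [shiftedGauss_mul]
      rw [← Finset.mul_sum]
      simp only [V, dif_neg hi0.ne']
      change _ * unitGaussSum n i = _
      push_cast
      field_simp
    rw [Finset.sum_congr rfl h2, ← Finset.mul_sum] at h1
    exact mul_left_cancel₀ heC h1
  have hW : ∀ e : ℕ, 0 < e → ∑ i ∈ e.divisors, (rootMoebius n i : ℂ) = (rootCount n e : ℂ) := by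
    intro e he
    exact_mod_cast sum_rootMoebius_divisors n e he
  have hc : 0 < c := Nat.pos_of_ne_zero (NeZero.ne c)
  have hcC : (c : ℂ) ≠ 0 := by exact_mod_cast hc.ne'
  have h1 := ArithmeticFunction.sum_eq_iff_sum_mul_moebius_eq.1 hV c hc
  have h2 := ArithmeticFunction.sum_eq_iff_sum_mul_moebius_eq.1 hW c hc
  have h3 : V c = (rootMoebius n c : ℂ) := h1.symm.trans h2
  rw [← h3]
  simp only [V, dif_neg hc.ne']
  field_simp

lemma norm_eps (d : ℤ) : ‖eps d‖ = 1 := by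
  unfold eps; split_ifs <;> simp

lemma norm_kronecker_le (c d : ℤ) : ‖(kronecker c d : ℂ)‖ ≤ 1 := by
  unfold kronecker
  push_cast
  rw [norm_mul]
  have h1 : ‖(if c < 0 ∧ d < 0 then -1 else 1 : ℂ)‖ = 1 := by split_ifs <;> simp
  rw [h1, one_mul]
  rcases jacobiSym.trichotomy c d.natAbs with h | h | h <;> simp [h]

lemma norm_one_add_I : ‖1 + I‖ = Real.sqrt 2 := by
  have : Complex.normSq (1 + I) = 2 := by simp [normSq_apply]; norm_num
  rw [Complex.norm_def, this]

/-- Square-root cancellation in quadratic Gauss sums. -/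
lemma norm_quadGauss_le (c : ℕ) [NeZero c] (hc : 4 ∣ c) (d : ℤ) (hd : IsCoprime (c : ℤ) d) :
    ‖quadGauss d c‖ ≤ Real.sqrt 2 * Real.sqrt c := by
  rw [quadGauss_eq c hc d hd, norm_mul, norm_mul, norm_mul, norm_inv, norm_eps, norm_one_add_I,
    inv_one, mul_one, norm_real, Real.norm_of_nonneg (Real.sqrt_nonneg _)]
  have := norm_kronecker_le c d
  gcongr
  exact mul_le_of_le_one_right (Real.sqrt_nonneg _) this

/-- Square-root cancellation in the sums defining `h_n(c)`. -/
lemma norm_rootMoebius_le (n : ℤ) (c : ℕ) (hc0 : c ≠ 0) (hc : 4 ∣ c) :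
    ‖(rootMoebius n c : ℂ)‖ ≤ Real.sqrt 2 * Real.sqrt c := by
  have : NeZero c := ⟨hc0⟩
  have hcpos : (0 : ℝ) < c := by exact_mod_cast Nat.pos_of_ne_zero hc0
  have h := unitGaussSum_eq n c
  have h2 : ‖unitGaussSum n c‖ ≤ c * (Real.sqrt 2 * Real.sqrt c) := by
    unfold unitGaussSum
    refine (norm_sum_le_of_le (f := fun r : ℕ => shiftedGauss n c (r : ZMod c))
      (n := fun _ => Real.sqrt 2 * Real.sqrt c) _ fun r hr => ?_).trans ?_
    · have hr2 := (Finset.mem_filter.1 hr).2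
      have h3 := shiftedGauss_eq n c r
      rw [Int.cast_natCast] at h3
      rw [h3, norm_mul, AddChar.norm_apply, one_mul]
      refine norm_quadGauss_le c hc _ ?_
      rw [IsCoprime.neg_right_iff]
      exact (Nat.isCoprime_iff_coprime.2 hr2.symm)
    · rw [Finset.sum_const, nsmul_eq_mul]
      gcongr
      have := (Finset.card_filter_le (Finset.range c) (fun r => Nat.Coprime r c))
      simpa using this
  rw [h, norm_mul, norm_natCast] at h2
  exact le_of_mul_le_mul_left h2 hcpos

/-! ### Square roots modulo prime powers -/

/-- The square roots of `p² n` modulo `p^{k+2}` are the multiples `p x` of the square roots `x` of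
`n` modulo `p^k`. -/
lemma rootCount_sq_mul (n : ℤ) {p : ℕ} (hp : p.Prime) (k : ℕ) :
    rootCount (p ^ 2 * n) (p ^ (k + 2)) = p * rootCount n (p ^ k) := by
  have hp0 : (p : ℤ) ≠ 0 := by exact_mod_cast hp.ne_zero
  have h1 : p * rootCount n (p ^ k) =
      ((Finset.range (p * p ^ k)).filter fun x : ℕ => ((p ^ k : ℕ) : ℤ) ∣ x ^ 2 - n).card := by
    rw [rootCount, Finset.card_filter, Finset.card_filter, sum_range_mul_of_periodic, smul_eq_mul]
    intro i
    have : (((p ^ k : ℕ) : ℤ) ∣ ((p ^ k + i : ℕ) : ℤ) ^ 2 - n) ↔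
        (((p ^ k : ℕ) : ℤ) ∣ (i : ℤ) ^ 2 - n) := by
      rw [show ((p ^ k + i : ℕ) : ℤ) ^ 2 - n =
        ((p ^ k : ℕ) : ℤ) * (((p ^ k : ℕ) : ℤ) + 2 * i) + ((i : ℤ) ^ 2 - n) by push_cast; ring]
      exact dvd_add_right (dvd_mul_right _ _)
    simp only [this]
  rw [h1, rootCount]
  symm
  refine Finset.card_bij (fun x _ => p * x) ?_ ?_ ?_
  · intro x hx
    obtain ⟨hx1, hx2⟩ := Finset.mem_filter.1 hx
    refine Finset.mem_filter.2 ⟨Finset.mem_range.2 ?_, ?_⟩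
    · rw [show p ^ (k + 2) = p * (p * p ^ k) by ring]
      exact Nat.mul_lt_mul_of_pos_left (Finset.mem_range.1 hx1) hp.pos
    · obtain ⟨q, hq⟩ := hx2
      refine ⟨q, ?_⟩
      push_cast at hq ⊢
      linear_combination (p : ℤ) ^ 2 * hq
  · intro a _ b _ h
    exact Nat.eq_of_mul_eq_mul_left hp.pos h
  · intro x hx
    obtain ⟨hx1, hx2⟩ := Finset.mem_filter.1 hx
    obtain ⟨q, hq⟩ := hx2
    have hpx : p ∣ x := by
      have : (p : ℤ) ∣ (x : ℤ) ^ 2 := ⟨p * n + p ^ (k + 1) * q, by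
        push_cast at hq; linear_combination hq⟩
      exact hp.dvd_of_dvd_pow (by exact_mod_cast this)
    obtain ⟨y, rfl⟩ := hpx
    refine ⟨y, Finset.mem_filter.2 ⟨Finset.mem_range.2 ?_, q, ?_⟩, rfl⟩
    · have := Finset.mem_range.1 hx1
      rw [show p ^ (k + 2) = p * (p * p ^ k) by ring] at this
      exact Nat.lt_of_mul_lt_mul_left this
    · have hp2 : (p : ℤ) ^ 2 ≠ 0 := pow_ne_zero _ hp0
      apply mul_left_cancel₀ hp2
      push_cast at hq ⊢
      linear_combination hq

lemma rootMoebius_sq_mul (n : ℤ) {p : ℕ} (hp : p.Prime) (k : ℕ) :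
    rootMoebius (p ^ 2 * n) (p ^ (k + 3)) = p * rootMoebius n (p ^ (k + 1)) := by
  rw [rootMoebius_prime_pow_succ _ hp (k + 2), rootMoebius_prime_pow_succ _ hp k,
    show k + 2 + 1 = (k + 1) + 2 by ring, rootCount_sq_mul _ hp, rootCount_sq_mul _ hp]
  push_cast
  ring

/-- Modulo a power of an odd prime, the only square roots of a unit `m²` are `±m`. -/
lemma rootCount_odd_prime_pow {p : ℕ} (hp : p.Prime) (hp2 : p ≠ 2) (m : ℤ) (hm : ¬ (p : ℤ) ∣ m)
    (k : ℕ) : rootCount (m ^ 2) (p ^ (k + 1)) = 2 := by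
  have : NeZero (p ^ (k + 1)) := ⟨(pow_pos hp.pos _).ne'⟩
  have hpZ : Prime (p : ℤ) := Nat.prime_iff_prime_int.1 hp
  have h2m : ¬ (p : ℤ) ∣ 2 * m := by
    rw [hpZ.dvd_mul]
    rintro (h | h)
    · have : p ∣ 2 := by exact_mod_cast h
      exact hp2 ((Nat.prime_dvd_prime_iff_eq hp Nat.prime_two).1 this)
    · exact hm h
  rw [rootCount_eq_zmod]
  have hset : (Finset.univ.filter fun x : ZMod (p ^ (k + 1)) => x ^ 2 = ((m ^ 2 : ℤ) : ZMod _)) =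
      {(m : ZMod (p ^ (k + 1))), -(m : ZMod (p ^ (k + 1)))} := by
    ext x
    simp only [Finset.mem_filter, Finset.mem_univ, true_and, Finset.mem_insert,
      Finset.mem_singleton]
    constructor
    · intro hx
      obtain ⟨y, rfl⟩ := ZMod.intCast_surjective x
      have hdvd : ((p ^ (k + 1) : ℕ) : ℤ) ∣ (y - m) * (y + m) := by
        rw [← ZMod.intCast_zmod_eq_zero_iff_dvd]
        push_cast at hx ⊢
        linear_combination hx
      by_cases hy : (p : ℤ) ∣ y - m
      · left
        have hcop : IsCoprime (((p ^ (k + 1) : ℕ) : ℤ)) (y + m) := by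
          push_cast
          refine IsCoprime.pow_left ((Prime.coprime_iff_not_dvd hpZ).2 fun h => h2m ?_)
          have := dvd_sub h hy
          rwa [show y + m - (y - m) = 2 * m by ring] at this
        have := hcop.dvd_of_dvd_mul_right hdvd
        exact ((ZMod.intCast_eq_intCast_iff_dvd_sub _ _ _).2 this).symm
      · right
        have hcop : IsCoprime (((p ^ (k + 1) : ℕ) : ℤ)) (y - m) := by
          push_cast
          exact IsCoprime.pow_left ((Prime.coprime_iff_not_dvd hpZ).2 hy)
        have := hcop.dvd_of_dvd_mul_left hdvd
        rw [← Int.cast_neg]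
        refine ((ZMod.intCast_eq_intCast_iff_dvd_sub _ _ _).2 ?_).symm
        rwa [sub_neg_eq_add]
    · rintro (rfl | rfl) <;> push_cast <;> ring
  rw [hset, Finset.card_pair]
  intro h
  have h0 : ((2 * m : ℤ) : ZMod (p ^ (k + 1))) = 0 := by
    push_cast
    linear_combination h
  rw [ZMod.intCast_zmod_eq_zero_iff_dvd] at h0
  refine h2m (dvd_trans ?_ h0)
  exact_mod_cast dvd_pow_self p (Nat.succ_ne_zero k)

lemma rootCount_two (n : ℤ) : rootCount n 2 = 1 := by
  rcases Int.emod_two_eq_zero_or_one n with h | h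
  · rw [rootCount_congr (n := n) (n' := 0) (by simpa using Int.dvd_of_emod_eq_zero h)]; decide
  · rw [rootCount_congr (n := n) (n' := 1) (by push_cast; omega)]; decide

lemma rootCount_odd_sq_four (m : ℤ) (hm : m % 2 = 1) : rootCount (m ^ 2) 4 = 2 := by
  have h : (4 : ℤ) ∣ m ^ 2 - 1 := by
    obtain ⟨a, rfl⟩ : ∃ a, m = 2 * a + 1 := ⟨m / 2, by omega⟩
    exact ⟨a ^ 2 + a, by ring⟩
  rw [rootCount_congr (n := m ^ 2) (n' := 1) (by exact_mod_cast h)]; decide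

/-- For odd `m` the square roots of `m²` modulo `2^{j+3}` are `±m` and `±m + 2^{j+2}`. -/
lemma rootCount_odd_sq_two_pow (m : ℤ) (hm : m % 2 = 1) (j : ℕ) :
    rootCount (m ^ 2) (2 ^ (j + 3)) = 4 := by
  have : NeZero (2 ^ (j + 3)) := ⟨by positivity⟩
  rw [rootCount_eq_zmod]
  set R := ZMod (2 ^ (j + 3))
  have hzero : ∀ a : ℤ, ((a : ℤ) : R) = 0 ↔ (8 * 2 ^ j : ℤ) ∣ a := by
    intro a
    rw [ZMod.intCast_zmod_eq_zero_iff_dvd]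
    push_cast
    rw [pow_add, mul_comm]
    norm_num
  set P : ℤ := 2 ^ j with hP
  have hPpos : 0 < P := by positivity
  have hset : (Finset.univ.filter fun x : R => x ^ 2 = ((m ^ 2 : ℤ) : R)) =
      {((m : ℤ) : R), ((-m : ℤ) : R), ((m + 4 * P : ℤ) : R), ((-m + 4 * P : ℤ) : R)} := by
    ext x
    simp only [Finset.mem_filter, Finset.mem_univ, true_and, Finset.mem_insert,
      Finset.mem_singleton]
    have hsub : ∀ a b : ℤ, ((a : ℤ) : R) = (b : R) ↔ (8 * P) ∣ a - b := by
      intro a b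
      rw [← hzero, Int.cast_sub, sub_eq_zero]
    obtain ⟨y, rfl⟩ := ZMod.intCast_surjective x
    rw [← Int.cast_pow]
    simp only [hsub]
    constructor
    · intro hdvd
      have hyodd : y % 2 = 1 := by
        obtain ⟨q, hq⟩ := hdvd
        have h1 : (y ^ 2) % 2 = 1 := by
          have h2 : (m ^ 2) % 2 = 1 := by
            obtain ⟨a, rfl⟩ : ∃ a, m = 2 * a + 1 := ⟨m / 2, by omega⟩
            have : (2 * a + 1) ^ 2 = 2 * (2 * a ^ 2 + 2 * a) + 1 := by ring
            omega
          have h3 : y ^ 2 = m ^ 2 + 2 * (4 * P * q) := by linear_combination hq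
          omega
        rcases Int.emod_two_eq_zero_or_one y with h | h
        · obtain ⟨a, rfl⟩ := Int.dvd_of_emod_eq_zero h
          have : (2 * a) ^ 2 = 2 * (2 * a ^ 2) := by ring
          omega
        · exact h
      -- `y² - m² = 4 a (a + m)`; as `m` is odd, one of the two factors is odd, and the other one
      -- absorbs the power of two
      obtain ⟨a, ha⟩ : ∃ a, y - m = 2 * a := ⟨(y - m) / 2, by omega⟩
      have hb : y + m = 2 * (a + m) := by linarith
      have hab : 2 * P ∣ a * (a + m) := by
        obtain ⟨q, hq⟩ := hdvd
        refine ⟨q, ?_⟩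
        have : y ^ 2 - m ^ 2 = 4 * (a * (a + m)) := by
          rw [show y ^ 2 - m ^ 2 = (y - m) * (y + m) by ring, ha, hb]; ring
        linarith
      have h2P : 2 * P = 2 ^ (j + 1) := by rw [hP]; ring
      rcases Int.emod_two_eq_zero_or_one a with h | h
      · have hcop : IsCoprime (2 * P) (a + m) := by
          rw [h2P]
          refine IsCoprime.pow_left ((Prime.coprime_iff_not_dvd Int.prime_two).2 ?_)
          omega
        obtain ⟨t, ht⟩ := hcop.dvd_of_dvd_mul_right hab
        rcases Int.even_or_odd' t with ⟨s, hs | hs⟩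
        · exact Or.inl ⟨s, by rw [ha, ht, hs]; ring⟩
        · refine Or.inr (Or.inr (Or.inl ⟨s, ?_⟩))
          have : y = m + 2 * a := by linarith
          rw [this, ht, hs]; ring
      · have hcop : IsCoprime (2 * P) a := by
          rw [h2P]
          refine IsCoprime.pow_left ((Prime.coprime_iff_not_dvd Int.prime_two).2 ?_)
          omega
        obtain ⟨t, ht⟩ := hcop.dvd_of_dvd_mul_left hab
        have hy : y = -m + 2 * (a + m) := by linarith
        rcases Int.even_or_odd' t with ⟨s, hs | hs⟩
        · exact Or.inr (Or.inl ⟨s, by rw [hy, ht, hs]; ring⟩)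
        · refine Or.inr (Or.inr (Or.inr ⟨s, ?_⟩))
          rw [hy, ht, hs]; ring
    · rintro (⟨s, hs⟩ | ⟨s, hs⟩ | ⟨s, hs⟩ | ⟨s, hs⟩)
      · exact ⟨s * (y + m), by linear_combination (y + m) * hs⟩
      · exact ⟨s * (y - m), by linear_combination (y - m) * hs⟩
      · obtain rfl : y = m + 4 * P + 8 * P * s := by linarith
        exact ⟨8 * P * s ^ 2 + 8 * P * s + 2 * m * s + m + 2 * P, by ring⟩
      · obtain rfl : y = -m + 4 * P + 8 * P * s := by linarith
        exact ⟨8 * P * s ^ 2 + 8 * P * s - 2 * m * s - m + 2 * P, by ring⟩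
  have hne : ∀ a b : ℤ, ¬ (8 * P) ∣ a - b → ((a : ℤ) : R) ≠ (b : R) := by
    intro a b h h'
    apply h
    rw [← hzero, Int.cast_sub, sub_eq_zero]
    exact h'
  have h2m : ∀ t : ℤ, ¬ (8 * P) ∣ 2 * m + 4 * t := by
    rintro t ⟨q, hq⟩
    have : m + 2 * t = 2 * (2 * (P * q)) := by linarith
    omega
  have h4 : ∀ ε : ℤ, ε % 2 = 1 → ¬ (8 * P) ∣ 4 * P * ε := by
    rintro ε hε ⟨q, hq⟩
    have : ε = 2 * q := by
      have h8 : (4 * P) * ε = (4 * P) * (2 * q) := by linarith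
      exact mul_left_cancel₀ (by positivity) h8
    omega
  rw [hset, Finset.card_insert_of_notMem, Finset.card_insert_of_notMem, Finset.card_pair]
  · refine hne _ _ fun h => h2m 0 ?_
    obtain ⟨q, hq⟩ := h
    exact ⟨q, by linear_combination hq⟩
  · simp only [Finset.mem_insert, Finset.mem_singleton, not_or]
    constructor
    · refine hne _ _ fun h => h2m P ?_
      obtain ⟨q, hq⟩ := h
      exact ⟨-q, by linear_combination -hq⟩
    · refine hne _ _ fun h => h4 (-1) (by norm_num) ?_
      obtain ⟨q, hq⟩ := h
      exact ⟨q, by linear_combination hq⟩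
  · simp only [Finset.mem_insert, Finset.mem_singleton, not_or]
    refine ⟨?_, ?_, ?_⟩
    · refine hne _ _ fun h => h2m 0 ?_
      obtain ⟨q, hq⟩ := h
      exact ⟨q, by linear_combination hq⟩
    · refine hne _ _ fun h => h4 (-1) (by norm_num) ?_
      obtain ⟨q, hq⟩ := h
      exact ⟨q, by linear_combination hq⟩
    · refine hne _ _ fun h => h2m (-P) ?_
      obtain ⟨q, hq⟩ := h
      exact ⟨q, by linear_combination hq⟩

/-! ### Local factors at `w = 1` for square `n` -/

/-- The `k`-th term of the local factor of `∑ h_{m²}(c) c⁻¹` at `p`. -/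
noncomputable def localTerm (m : ℤ) (p k : ℕ) : ℂ :=
  (rootMoebius (m ^ 2) (p ^ k) : ℂ) * ((p : ℂ) ^ k)⁻¹

lemma localTerm_sq_mul (m : ℤ) {p : ℕ} (hp : p.Prime) (k : ℕ) :
    localTerm (p * m) p (k + 3) = (p : ℂ)⁻¹ * localTerm m p (k + 1) := by
  have hpC : (p : ℂ) ≠ 0 := by exact_mod_cast hp.ne_zero
  unfold localTerm
  rw [mul_pow, rootMoebius_sq_mul _ hp]
  push_cast
  rw [show (p : ℂ) ^ (k + 3) = p ^ 2 * p ^ (k + 1) by ring]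
  field_simp

/-- Multiplying `m` by `p` moves the start of the sum by two. -/
lemma hasSum_localTerm_step (m : ℤ) {p : ℕ} (hp : p.Prime) {β : ℕ} {V : ℂ}
    (h : HasSum (fun k => localTerm m p (k + (β + 1))) V) :
    HasSum (fun k => localTerm (p * m) p (k + (β + 3))) ((p : ℂ)⁻¹ * V) := by
  refine (h.mul_left (p : ℂ)⁻¹).congr_fun fun k => ?_
  exact localTerm_sq_mul m hp (k + β)

lemma hasSum_localTerm_prev {m : ℤ} {p β : ℕ} {V : ℂ}
    (h : HasSum (fun k => localTerm m p (k + (β + 1))) V) :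
    HasSum (fun k => localTerm m p (k + β)) (localTerm m p β + V) := by
  have := HasSum.zero_add (f := fun k => localTerm m p (k + β)) (m := V) (by
    refine h.congr_fun fun k => ?_
    congr 1; ring)
  simpa using this

lemma rootCount_zero_prime {p : ℕ} (hp : p.Prime) : rootCount 0 p = 1 := by
  rw [rootCount, Finset.card_eq_one]
  refine ⟨0, ?_⟩
  ext x
  simp only [Finset.mem_filter, Finset.mem_range, Finset.mem_singleton, sub_zero]
  constructor
  · rintro ⟨h1, h2⟩
    have h3 : p ∣ x ^ 2 := by exact_mod_cast h2
    exact Nat.eq_zero_of_dvd_of_lt (hp.dvd_of_dvd_pow h3) h1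
  · rintro rfl
    exact ⟨hp.pos, by simp⟩

lemma localTerm_zero (m : ℤ) (p : ℕ) : localTerm m p 0 = 1 := by
  simp [localTerm, rootMoebius_one]

lemma localTerm_mul_one (m : ℤ) {p : ℕ} (hp : p.Prime) : localTerm (p * m) p 1 = 0 := by
  have h : rootCount ((p * m) ^ 2) p = 1 := by
    rw [rootCount_congr (n' := 0) ⟨p * m ^ 2, by ring⟩, rootCount_zero_prime hp]
  rw [localTerm, rootMoebius_prime_pow_succ _ hp 0, pow_zero, zero_add, pow_one, rootCount_one, h]
  simp

lemma localTerm_mul_two (m : ℤ) {p : ℕ} (hp : p.Prime) :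
    localTerm (p * m) p 2 = (p - 1) * ((p : ℂ) ^ 2)⁻¹ := by
  have h : rootCount ((p * m) ^ 2) p = 1 := by
    rw [rootCount_congr (n' := 0) ⟨p * m ^ 2, by ring⟩, rootCount_zero_prime hp]
  have h2 := rootCount_sq_mul (m ^ 2) hp 0
  rw [zero_add, pow_zero, rootCount_one] at h2
  rw [localTerm, rootMoebius_prime_pow_succ _ hp 1, mul_pow, h2, ← mul_pow, pow_one, h]
  push_cast
  ring

lemma localTerm_two_one (m : ℤ) : localTerm m 2 1 = 0 := by
  rw [localTerm, rootMoebius_prime_pow_succ _ Nat.prime_two 0, pow_zero, zero_add, pow_one,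
    rootCount_one, rootCount_two]
  simp

lemma localTerm_odd_eq_zero {p : ℕ} (hp : p.Prime) (hp2 : p ≠ 2) {m : ℤ} (hm : ¬ (p : ℤ) ∣ m)
    (k : ℕ) : localTerm m p (k + 2) = 0 := by
  rw [localTerm, rootMoebius_prime_pow_succ _ hp (k + 1), rootCount_odd_prime_pow hp hp2 m hm,
    rootCount_odd_prime_pow hp hp2 m hm]
  simp

lemma localTerm_two_eq_zero {m : ℤ} (hm : ¬ (2 : ℤ) ∣ m) (k : ℕ) :
    localTerm m 2 (k + 4) = 0 := by
  have hm' : m % 2 = 1 := by omega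
  rw [localTerm, rootMoebius_prime_pow_succ _ Nat.prime_two (k + 3), rootCount_odd_sq_two_pow m hm',
    rootCount_odd_sq_two_pow m hm' k]
  simp

lemma localTerm_two_three {m : ℤ} (hm : ¬ (2 : ℤ) ∣ m) : localTerm m 2 3 = 4⁻¹ := by
  have hm' : m % 2 = 1 := by omega
  rw [localTerm, rootMoebius_prime_pow_succ _ Nat.prime_two 2, rootCount_odd_sq_two_pow m hm' 0]
  norm_num [rootCount_odd_sq_four m hm']

lemma localTerm_two_two {m : ℤ} (hm : ¬ (2 : ℤ) ∣ m) : localTerm m 2 2 = 4⁻¹ := by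
  have hm' : m % 2 = 1 := by omega
  rw [localTerm, rootMoebius_prime_pow_succ _ Nat.prime_two 1]
  norm_num [rootCount_odd_sq_four m hm', rootCount_two]

lemma hasSum_localTerm_one_of_not_dvd {p : ℕ} (hp : p.Prime) {m : ℤ} (hm : ¬ (p : ℤ) ∣ m) :
    HasSum (fun k => localTerm m p (k + 1)) (p : ℂ)⁻¹ := by
  by_cases hp2 : p = 2
  · subst hp2
    have h4 : HasSum (fun k => localTerm m 2 (k + 4)) 0 :=
      hasSum_zero.congr_fun fun k => localTerm_two_eq_zero hm k
    have h := hasSum_localTerm_prev (hasSum_localTerm_prev (hasSum_localTerm_prev h4))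
    rw [localTerm_two_one, localTerm_two_two hm, localTerm_two_three hm] at h
    norm_num at h ⊢
    exact h
  · have h2 : HasSum (fun k => localTerm m p (k + 2)) 0 :=
      hasSum_zero.congr_fun fun k => localTerm_odd_eq_zero hp hp2 hm k
    have h := hasSum_localTerm_prev h2
    have h1 : localTerm m p 1 = (p : ℂ)⁻¹ := by
      rw [localTerm, rootMoebius_prime_pow_succ _ hp 0, rootCount_odd_prime_pow hp hp2 m hm,
        pow_zero, rootCount_one]
      simp
    rwa [h1, add_zero] at h

lemma hasSum_localTerm_zero_one {p : ℕ} (hp : p.Prime) :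
    HasSum (fun k => localTerm 0 p (k + 1)) (p : ℂ)⁻¹ := by
  have hpC : (p : ℂ) ≠ 0 := by exact_mod_cast hp.ne_zero
  have hpn : ‖(p : ℂ)⁻¹‖ < 1 := by
    rw [norm_inv, norm_natCast]
    exact inv_lt_one_of_one_lt₀ (by exact_mod_cast hp.one_lt)
  have hrec : ∀ k j, localTerm 0 p (2 * j + (k + 1)) = ((p : ℂ)⁻¹) ^ j * localTerm 0 p (k + 1) := by
    intro k j
    induction j with
    | zero => simp
    | succ j ih =>
      have h := localTerm_sq_mul 0 hp (2 * j + k)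
      rw [mul_zero] at h
      rw [show 2 * (j + 1) + (k + 1) = 2 * j + k + 3 by ring, h,
        show 2 * j + k + 1 = 2 * j + (k + 1) by ring, ih, pow_succ']
      ring
  have h1 := localTerm_mul_one 0 hp
  have h2 := localTerm_mul_two 0 hp
  rw [mul_zero] at h1 h2
  have heven : HasSum (fun j => localTerm 0 p (2 * j + 1)) 0 := by
    refine hasSum_zero.congr_fun fun j => ?_
    have := hrec 0 j
    rwa [zero_add, h1, mul_zero] at this
  have hodd : HasSum (fun j => localTerm 0 p (2 * j + 1 + 1)) (p : ℂ)⁻¹ := by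
    have hg := (hasSum_geometric_of_norm_lt_one hpn).mul_right ((p - 1) * ((p : ℂ) ^ 2)⁻¹)
    have hp1 : (p : ℂ) - 1 ≠ 0 := by
      rw [sub_ne_zero]
      exact_mod_cast hp.one_lt.ne'
    have e : (1 - (p : ℂ)⁻¹)⁻¹ * ((p - 1) * ((p : ℂ) ^ 2)⁻¹) = (p : ℂ)⁻¹ := by
      rw [show 1 - (p : ℂ)⁻¹ = (p - 1) / p by field_simp]
      field_simp
    rw [e] at hg
    refine hg.congr_fun fun j => ?_
    have := hrec 1 j
    rw [h2] at this
    exact this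
  have := HasSum.even_add_odd (f := fun k => localTerm 0 p (k + 1)) heven hodd
  rwa [zero_add] at this

/-- The sum `∑_{k ≥ 1} h_{m²}(p^k) p^{-k}` equals `1/p`, independently of `m`. -/
lemma hasSum_localTerm_one {p : ℕ} (hp : p.Prime) (m : ℤ) :
    HasSum (fun k => localTerm m p (k + 1)) (p : ℂ)⁻¹ := by
  by_cases hm0 : m = 0
  · rw [hm0]
    exact hasSum_localTerm_zero_one hp
  induction hN : m.natAbs using Nat.strong_induction_on generalizing m with
  | _ N ih =>
    by_cases hm : (p : ℤ) ∣ m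
    swap
    · exact hasSum_localTerm_one_of_not_dvd hp hm
    obtain ⟨m, rfl⟩ := hm
    have hm0' : m ≠ 0 := right_ne_zero_of_mul hm0
    have hlt : m.natAbs < N := by
      rw [← hN, Int.natAbs_mul, Int.natAbs_natCast]
      have : 0 < m.natAbs := Int.natAbs_pos.2 hm0'
      nlinarith [hp.two_le]
    have h3 := hasSum_localTerm_step (β := 0) m hp (ih _ hlt m hm0' rfl)
    have h := hasSum_localTerm_prev (hasSum_localTerm_prev h3)
    change HasSum _ (localTerm (p * m) p 1 + (localTerm (p * m) p 2 + _)) at h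
    rw [localTerm_mul_one m hp, localTerm_mul_two m hp] at h
    have hpC : (p : ℂ) ≠ 0 := by exact_mod_cast hp.ne_zero
    convert h using 1
    field_simp
    ring

/-- For odd `p` and `β ≥ 1`, the sum `∑_{k ≥ β} h_{m²}(p^k) p^{-k}` is `p^{-⌈β/2⌉}` if
`p^{⌊β/2⌋} ∣ m`, and zero otherwise. The statement has `β + 1` in place of `β`. -/
lemma hasSum_localTerm_odd {p : ℕ} (hp : p.Prime) (hp2 : p ≠ 2) (β : ℕ) : ∀ m : ℤ,
    HasSum (fun k => localTerm m p (k + (β + 1)))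
      (if (p : ℤ) ^ ((β + 1) / 2) ∣ m then ((p : ℂ) ^ ((β + 2) / 2))⁻¹ else 0) := by
  have hpC : (p : ℂ) ≠ 0 := by exact_mod_cast hp.ne_zero
  have hpZ : (p : ℤ) ≠ 0 := by exact_mod_cast hp.ne_zero
  induction β using Nat.strong_induction_on with
  | _ β ih =>
    intro m
    rcases β with _ | β
    · simpa using hasSum_localTerm_one hp m
    by_cases hm : (p : ℤ) ∣ m
    · obtain ⟨m, rfl⟩ := hm
      rcases β with _ | β
      · have h := hasSum_localTerm_prev
          (hasSum_localTerm_step (β := 0) m hp (hasSum_localTerm_one hp m))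
        rw [localTerm_mul_two m hp] at h
        norm_num
        convert h using 1
        field_simp
        ring
      · have h := hasSum_localTerm_step m hp (ih β (by omega) m)
        have e1 : (β + 1 + 1 + 1) / 2 = (β + 1) / 2 + 1 := by omega
        have e2 : (β + 1 + 1 + 2) / 2 = (β + 2) / 2 + 1 := by omega
        simp only [e1, e2, pow_succ', mul_dvd_mul_iff_left hpZ]
        convert h using 1
        split_ifs
        · rw [mul_inv]
        · rw [mul_zero]
    · rw [if_neg]
      · exact hasSum_zero.congr_fun fun k => localTerm_odd_eq_zero hp hp2 hm (k + β)
      · exact fun h => hm (dvd_trans (dvd_pow_self _ (by omega)) h)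

/-- For `β ≥ 2`, the sum `∑_{k ≥ β} h_{m²}(2^k) 2^{-k}` is `2^{-⌈β/2⌉}` if `2^{⌊β/2⌋-1} ∣ m`, and
zero otherwise. The statement has `β + 2` in place of `β`. -/
lemma hasSum_localTerm_two (β : ℕ) : ∀ m : ℤ,
    HasSum (fun k => localTerm m 2 (k + (β + 2)))
      (if (2 : ℤ) ^ (β / 2) ∣ m then ((2 : ℂ) ^ ((β + 3) / 2))⁻¹ else 0) := by
  induction β using Nat.strong_induction_on with
  | _ β ih =>
    intro m
    have h1 := hasSum_localTerm_one Nat.prime_two m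
    rcases β with _ | β
    · have h := (hasSum_nat_add_iff' 1).2 h1
      simp only [Finset.sum_range_one, zero_add, localTerm_two_one, sub_zero] at h
      norm_num at h ⊢
      exact h
    by_cases hm : (2 : ℤ) ∣ m
    · obtain ⟨m, rfl⟩ := hm
      rcases β with _ | β
      · have h := hasSum_localTerm_step (β := 0) m Nat.prime_two
          (hasSum_localTerm_one Nat.prime_two m)
        norm_num at h ⊢
        exact h
      · have h := hasSum_localTerm_step m Nat.prime_two (ih β (by omega) m)
        have e1 : (β + 1 + 1) / 2 = β / 2 + 1 := by omega
        have e2 : (β + 1 + 1 + 3) / 2 = (β + 3) / 2 + 1 := by omega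
        simp only [e1, e2, pow_succ', mul_dvd_mul_iff_left (two_ne_zero (α := ℤ))]
        simp only [Nat.cast_ofNat] at h
        convert h using 1
        split_ifs
        · rw [mul_inv]
        · rw [mul_zero]
    · rcases β with _ | β
      · have h4 : HasSum (fun k => localTerm m 2 (k + 4)) 0 :=
          hasSum_zero.congr_fun fun k => localTerm_two_eq_zero hm k
        have h := hasSum_localTerm_prev h4
        rw [localTerm_two_three hm] at h
        norm_num at h ⊢
        exact h
      · rw [if_neg]
        · exact hasSum_zero.congr_fun fun k => localTerm_two_eq_zero hm (k + β)
        · exact fun h => hm (dvd_trans (dvd_pow_self _ (by omega)) h)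

/-! ### Local factors away from `2 n` -/

lemma rootCount_prime (n : ℤ) {p : ℕ} (hp : p.Prime) (hp2 : p ≠ 2) :
    (rootCount n p : ℤ) = 1 + jacobiSym n p := by
  have : Fact p.Prime := ⟨hp⟩
  have hF : ringChar (ZMod p) ≠ 2 := by rwa [ZMod.ringChar_zmod_n]
  rw [rootCount_eq_zmod, ← jacobiSym.legendreSym.to_jacobiSym, legendreSym, add_comm,
    ← quadraticChar_card_sqrts hF]
  congr 2
  ext x
  simp

lemma rootMoebius_prime (n : ℤ) {p : ℕ} (hp : p.Prime) (hp2 : p ≠ 2) :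
    rootMoebius n p = jacobiSym n p := by
  have h := rootMoebius_prime_pow_succ n hp 0
  rw [zero_add, pow_one, pow_zero, rootCount_one, rootCount_prime n hp hp2] at h
  rw [h]
  push_cast
  ring

/-- Lifting of square roots to higher powers of an odd prime. -/
lemma exists_sq_root_prime_pow {n : ℤ} {p : ℕ} (hp : p.Prime) (hp2 : p ≠ 2) (hn : ¬ (p : ℤ) ∣ n)
    {u : ℤ} (hu : (p : ℤ) ∣ u ^ 2 - n) (k : ℕ) : ∃ v : ℤ, (p : ℤ) ^ (k + 1) ∣ v ^ 2 - n := by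
  have hpZ : Prime (p : ℤ) := Nat.prime_iff_prime_int.1 hp
  induction k with
  | zero => exact ⟨u, by simpa using hu⟩
  | succ k ih =>
    obtain ⟨v, q, hq⟩ := ih
    have hv : ¬ (p : ℤ) ∣ 2 * v := by
      rw [hpZ.dvd_mul]
      rintro (h | h)
      · have : p ∣ 2 := by exact_mod_cast h
        exact hp2 ((Nat.prime_dvd_prime_iff_eq hp Nat.prime_two).1 this)
      · obtain ⟨a, ha⟩ := h
        refine hn ⟨a * v - p ^ k * q, ?_⟩
        linear_combination v * ha - hq
    obtain ⟨a, b, hab⟩ := (Prime.coprime_iff_not_dvd hpZ).2 hv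
    refine ⟨v - p ^ (k + 1) * (q * b), q * a + p ^ k * (q * b) ^ 2, ?_⟩
    linear_combination hq - (p ^ (k + 1) * q) * hab

lemma rootMoebius_odd_prime_pow (n : ℤ) {p : ℕ} (hp : p.Prime) (hp2 : p ≠ 2)
    (hn : ¬ (p : ℤ) ∣ n) (k : ℕ) : rootMoebius n (p ^ (k + 2)) = 0 := by
  have key : ∀ j, rootCount n (p ^ (j + 1)) = rootCount n (p ^ (0 + 1)) := by
    intro j
    by_cases hu : ∃ u : ℤ, (p : ℤ) ∣ u ^ 2 - n
    · obtain ⟨u, hu⟩ := hu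
      have h2 : ∀ j, rootCount n (p ^ (j + 1)) = 2 := by
        intro j
        obtain ⟨v, hv⟩ := exists_sq_root_prime_pow hp hp2 hn hu j
        have hpv : ¬ (p : ℤ) ∣ v := by
          rintro ⟨a, rfl⟩
          obtain ⟨q, hq⟩ := hv
          exact hn ⟨p * a ^ 2 - p ^ j * q, by linear_combination -hq⟩
        rw [← rootCount_odd_prime_pow hp hp2 v hpv j]
        refine rootCount_congr ?_
        rw [← dvd_neg, neg_sub]
        exact_mod_cast hv
      rw [h2, h2]
    · have h2 : ∀ j, rootCount n (p ^ (j + 1)) = 0 := by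
        intro j
        rw [rootCount, Finset.card_eq_zero, Finset.filter_eq_empty_iff]
        intro x _ hx
        refine hu ⟨x, dvd_trans ?_ hx⟩
        exact_mod_cast dvd_pow_self p (Nat.succ_ne_zero j)
      rw [h2, h2]
  rw [rootMoebius_prime_pow_succ _ hp (k + 1), key (k + 1), key k, sub_self]

lemma rootMoebius_zero_prime {p : ℕ} (hp : p.Prime) : rootMoebius 0 p = 0 := by
  have h := rootMoebius_prime_pow_succ 0 hp 0
  rw [zero_add, pow_one, pow_zero, rootCount_one, rootCount_zero_prime hp] at h
  rw [h]
  simp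

lemma rootMoebius_zero_odd {p : ℕ} (hp : p.Prime) (i : ℕ) :
    rootMoebius 0 (p ^ (2 * i + 1)) = 0 := by
  induction i with
  | zero => simpa using rootMoebius_zero_prime hp
  | succ i ih =>
    have h := rootMoebius_sq_mul 0 hp (2 * i)
    rw [mul_zero, ih, mul_zero] at h
    exact h

lemma rootMoebius_zero_even {p : ℕ} (hp : p.Prime) (i : ℕ) :
    rootMoebius 0 (p ^ (2 * i + 2)) = p ^ i * (p - 1) := by
  induction i with
  | zero =>
    have h2 := rootCount_sq_mul 0 hp 0
    rw [zero_add, pow_zero, rootCount_one, mul_zero, mul_one] at h2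
    rw [mul_zero, zero_add, rootMoebius_prime_pow_succ _ hp 1, h2, pow_one,
      rootCount_zero_prime hp]
    simp
  | succ i ih =>
    have h := rootMoebius_sq_mul 0 hp (2 * i + 1)
    rw [mul_zero, ih] at h
    rw [show 2 * (i + 1) + 2 = 2 * i + 1 + 3 by ring, h]
    ring

/-! ### A bound for odd `c` -/

lemma norm_rootMoebius_four (n : ℤ) : ‖(rootMoebius n 4 : ℂ)‖ = 1 := by
  have h := rootMoebius_prime_pow_succ n Nat.prime_two 1
  rw [pow_one, rootCount_two] at h
  norm_num at h
  have h4 : rootCount n 4 = 0 ∨ rootCount n 4 = 2 := by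
    rcases (by omega : n % 4 = 0 ∨ n % 4 = 1 ∨ n % 4 = 2 ∨ n % 4 = 3) with h | h | h | h
    · right; rw [rootCount_congr (n := n) (n' := 0) (by push_cast; omega)]; decide
    · right; rw [rootCount_congr (n := n) (n' := 1) (by push_cast; omega)]; decide
    · left; rw [rootCount_congr (n := n) (n' := 2) (by push_cast; omega)]; decide
    · left; rw [rootCount_congr (n := n) (n' := 3) (by push_cast; omega)]; decide
  rw [h]
  rcases h4 with h4 | h4 <;> rw [h4] <;> norm_num

/-- For odd `c` the bound follows from the one for `4 c`, since `h_n(4) = ±1`. -/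
lemma norm_rootMoebius_le_of_odd (n : ℤ) (c : ℕ) (hc : c.Coprime 2) :
    ‖(rootMoebius n c : ℂ)‖ ≤ 3 * Real.sqrt c := by
  have hc0 : c ≠ 0 := by rintro rfl; norm_num at hc
  have hcop : Nat.Coprime 4 c := by
    rw [show 4 = 2 ^ 2 by norm_num]
    exact Nat.Coprime.pow_left 2 hc.symm
  have h := norm_rootMoebius_le n (4 * c) (by omega) (dvd_mul_right _ _)
  rw [(rootMoebius_isMultiplicative n).2 hcop, Int.cast_mul, norm_mul, norm_rootMoebius_four,
    one_mul] at h
  refine h.trans ?_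
  push_cast
  rw [Real.sqrt_mul (by norm_num), show (4 : ℝ) = 2 ^ 2 by norm_num, Real.sqrt_sq (by norm_num),
    ← mul_assoc]
  have : Real.sqrt 2 * 2 ≤ 3 := by
    have := Real.sqrt_le_left (show (0:ℝ) ≤ 3/2 by norm_num) |>.2 (show (2:ℝ) ≤ (3/2)^2 by norm_num)
    linarith
  gcongr

/-! ### Splitting off the part of `c` supported on given primes -/

/-- The coefficients `h_n(c)` with `M ∣ c`. -/
noncomputable def fullCoef (n : ℤ) (M c : ℕ) : ℂ := if M ∣ c then (rootMoebius n c : ℂ) else 0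

open Classical in
/-- The coefficients `h_n(c)` with `M ∣ c`, for `c` composed of primes dividing `Q`. -/
noncomputable def smoothCoef (n : ℤ) (Q M c : ℕ) : ℂ :=
  if c ∈ Nat.factoredNumbers Q.primeFactors ∧ M ∣ c then (rootMoebius n c : ℂ) else 0

/-- The coefficients `h_n(c)` for `c` prime to `Q`. -/
noncomputable def roughCoef (n : ℤ) (Q c : ℕ) : ℂ :=
  if c.Coprime Q then (rootMoebius n c : ℂ) else 0

lemma sqrt_eq_rpow_sub_one (c : ℕ) : Real.sqrt c = (c : ℝ) ^ ((3 / 2 : ℝ) - 1) := by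
  rw [Real.sqrt_eq_rpow]; norm_num

lemma lseriesSummable_fullCoef (n : ℤ) {M : ℕ} (hM : 4 ∣ M) {w : ℂ} (hw : 3 / 2 < w.re) :
    LSeriesSummable (fullCoef n M) w := by
  refine LSeriesSummable_of_le_const_mul_rpow hw ⟨Real.sqrt 2, fun c hc => ?_⟩
  unfold fullCoef
  split_ifs with h
  · rw [← sqrt_eq_rpow_sub_one]
    exact norm_rootMoebius_le n c hc (hM.trans h)
  · rw [norm_zero]; positivity

lemma lseriesSummable_roughCoef (n : ℤ) {Q : ℕ} (hQ : 2 ∣ Q) {w : ℂ} (hw : 3 / 2 < w.re) :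
    LSeriesSummable (roughCoef n Q) w := by
  refine LSeriesSummable_of_le_const_mul_rpow hw ⟨3, fun c hc => ?_⟩
  unfold roughCoef
  split_ifs with h
  · rw [← sqrt_eq_rpow_sub_one]
    exact norm_rootMoebius_le_of_odd n c (Nat.Coprime.coprime_dvd_right hQ h)
  · rw [norm_zero]; positivity

lemma coprime_of_mem_factoredNumbers {Q a b : ℕ} (ha : a ∈ Nat.factoredNumbers Q.primeFactors)
    (hb : b.Coprime Q) : a.Coprime b := by
  refine Nat.Coprime.symm (Nat.coprime_of_dvd fun p hp hpb hpa => ?_)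
  have hpQ : p ∈ Q.primeFactors := Nat.mem_factoredNumbers'.1 ha p hp hpa
  exact (Nat.Prime.coprime_iff_not_dvd hp).1 (Nat.Coprime.coprime_dvd_left hpb hb)
    (Nat.dvd_of_mem_primeFactors hpQ)

lemma exists_smooth_mul_rough {Q : ℕ} (hQ : Q ≠ 0) (c : ℕ) (hc : c ≠ 0) :
    ∃ a ∈ Nat.factoredNumbers Q.primeFactors, ∃ b, b.Coprime Q ∧ a * b = c := by
  induction c using Nat.strong_induction_on with
  | _ c ih =>
    by_cases h : c.Coprime Q
    · exact ⟨1, Nat.mem_factoredNumbers'.2 fun p hp h1 => absurd (Nat.dvd_one.1 h1) hp.ne_one,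
        c, h, one_mul c⟩
    · obtain ⟨p, hp, hpc, hpQ⟩ := Nat.Prime.not_coprime_iff_dvd.1 h
      obtain ⟨c', rfl⟩ := hpc
      have hc' : c' ≠ 0 := right_ne_zero_of_mul hc
      obtain ⟨a, ha, b, hb, rfl⟩ := ih c' (by
        have := hp.two_le
        have := Nat.pos_of_ne_zero hc'
        nlinarith) hc'
      refine ⟨p * a, Nat.mul_mem_factoredNumbers ?_ ha, b, hb, by ring⟩
      rw [Nat.mem_factoredNumbers']
      intro q hq hqp
      rw [(Nat.prime_dvd_prime_iff_eq hq hp).1 hqp]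
      exact Nat.mem_primeFactors.2 ⟨hp, hpQ, hQ⟩

lemma eq_of_smooth_mul_rough_eq {Q a b a' b' : ℕ} (ha : a ∈ Nat.factoredNumbers Q.primeFactors)
    (hb : b.Coprime Q) (ha' : a' ∈ Nat.factoredNumbers Q.primeFactors) (hb' : b'.Coprime Q)
    (h : a * b = a' * b') : a = a' ∧ b = b' := by
  have h1 : a ∣ a' := (coprime_of_mem_factoredNumbers ha hb').dvd_of_dvd_mul_right
    (h ▸ dvd_mul_right a b)
  have h2 : a' ∣ a := (coprime_of_mem_factoredNumbers ha' hb).dvd_of_dvd_mul_right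
    (h ▸ dvd_mul_right a' b')
  obtain rfl := Nat.dvd_antisymm h1 h2
  exact ⟨rfl, Nat.eq_of_mul_eq_mul_left
    (Nat.pos_of_ne_zero (Nat.ne_zero_of_mem_factoredNumbers ha)) h⟩

/-- The Dirichlet series `∑_{M ∣ c} h_n(c) c^{-w}` is the product of its part supported on the
primes dividing `Q` and its part prime to `Q`. -/
lemma LSeries_fullCoef_eq (n : ℤ) {M Q : ℕ} (hM : 4 ∣ M) (hMQ : M ∣ Q) (hQ : Q ≠ 0) {w : ℂ}
    (hw : 3 / 2 < w.re) :
    LSeries (fullCoef n M) w = LSeries (smoothCoef n Q M) w * LSeries (roughCoef n Q) w := by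
  have hfull := lseriesSummable_fullCoef n hM hw
  have hrough := lseriesSummable_roughCoef n (Q := Q)
    ((Dvd.intro 2 rfl : 2 ∣ 4).trans (hM.trans hMQ)) hw
  have hsmooth : LSeriesSummable (smoothCoef n Q M) w := by
    refine Summable.of_norm_bounded hfull.norm fun c => ?_
    refine LSeries.norm_term_le w ?_
    unfold smoothCoef fullCoef
    split_ifs with h1 h2 h2
    · exact le_rfl
    · exact absurd h1.2 h2
    · rw [norm_zero]; positivity
    · exact le_rfl
  have hinj : Function.Injective (fun x : {a // a ∈ Nat.factoredNumbers Q.primeFactors} ×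
      {b : ℕ // b.Coprime Q} => (x.1 : ℕ) * x.2) := by
    rintro ⟨⟨a, ha⟩, ⟨b, hb⟩⟩ ⟨⟨a', ha'⟩, ⟨b', hb'⟩⟩ h
    obtain ⟨rfl, rfl⟩ := eq_of_smooth_mul_rough_eq ha hb ha' hb' h
    rfl
  have hsupp : Function.support (LSeries.term (fullCoef n M) w) ⊆ Set.range
      (fun x : {a // a ∈ Nat.factoredNumbers Q.primeFactors} ×
      {b : ℕ // b.Coprime Q} => (x.1 : ℕ) * x.2) := by
    intro c hc
    have hc0 : c ≠ 0 := by
      rintro rfl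
      simp at hc
    obtain ⟨a, ha, b, hb, hab⟩ := exists_smooth_mul_rough hQ c hc0
    exact ⟨⟨⟨a, ha⟩, ⟨b, hb⟩⟩, hab⟩
  have hA : Function.support (LSeries.term (smoothCoef n Q M) w) ⊆
      Nat.factoredNumbers Q.primeFactors := by
    intro c hc
    by_contra h
    refine hc ?_
    have : smoothCoef n Q M c = 0 := if_neg fun h' => h h'.1
    rw [LSeries.term_def, this, zero_div, ite_self]
  have hB : Function.support (LSeries.term (roughCoef n Q) w) ⊆ {b : ℕ | b.Coprime Q} := by
    intro c hc
    by_contra h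
    refine hc ?_
    have : roughCoef n Q c = 0 := if_neg h
    rw [LSeries.term_def, this, zero_div, ite_self]
  have e1 : LSeries (smoothCoef n Q M) w = ∑' a : Nat.factoredNumbers Q.primeFactors,
      LSeries.term (smoothCoef n Q M) w a := (tsum_subtype_eq_of_support_subset hA).symm
  have e2 : LSeries (roughCoef n Q) w = ∑' b : {b : ℕ | b.Coprime Q},
      LSeries.term (roughCoef n Q) w b := (tsum_subtype_eq_of_support_subset hB).symm
  rw [e1, e2, tsum_mul_tsum_of_summable_norm (hsmooth.norm.subtype _) (hrough.norm.subtype _),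
    LSeries, ← hinj.tsum_eq hsupp]
  refine tsum_congr ?_
  rintro ⟨⟨a, ha⟩, ⟨b, hb⟩⟩
  have hcop := coprime_of_mem_factoredNumbers ha hb
  have ha0 := Nat.ne_zero_of_mem_factoredNumbers ha
  change LSeries.term _ _ (a * b) = LSeries.term _ _ a * LSeries.term _ _ b
  by_cases hb0 : b = 0
  · subst hb0; simp
  rw [LSeries.term_of_ne_zero (mul_ne_zero ha0 hb0), LSeries.term_of_ne_zero ha0,
    LSeries.term_of_ne_zero hb0, Nat.cast_mul, natCast_mul_natCast_cpow]
  have : fullCoef n M (a * b) = smoothCoef n Q M a * roughCoef n Q b := by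
    have hMb : M ∣ a * b ↔ M ∣ a := by
      have hbM : Nat.Coprime M b := (Nat.Coprime.coprime_dvd_right hMQ hb).symm
      exact ⟨fun h => hbM.dvd_of_dvd_mul_right h, fun h => h.mul_right b⟩
    unfold fullCoef smoothCoef roughCoef
    rw [if_pos (show b.Coprime Q from hb)]
    by_cases h : M ∣ a
    · rw [if_pos (hMb.2 h), if_pos ⟨ha, h⟩, (rootMoebius_isMultiplicative n).2 hcop, Int.cast_mul]
    · rw [if_neg (fun h' => h (hMb.1 h')), if_neg (fun h' => h h'.2), zero_mul]
  rw [this, div_mul_div_comm]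

/-! ### The part prime to `Q` -/

/-- The function `b ↦ (n/b)` on integers prime to `Q`. -/
noncomputable def jacobiCoef (n : ℤ) (Q : ℕ) (b : ℕ) : ℂ :=
  if b.Coprime Q then (jacobiSym n b : ℂ) else 0

lemma norm_jacobiCoef_le (n : ℤ) (Q b : ℕ) : ‖jacobiCoef n Q b‖ ≤ 1 := by
  unfold jacobiCoef
  split_ifs
  · rcases jacobiSym.trichotomy n b with h | h | h <;> simp [h]
  · simp

lemma jacobiCoef_mul (n : ℤ) {Q : ℕ} (hQ : Q ≠ 1) (a b : ℕ) :
    jacobiCoef n Q (a * b) = jacobiCoef n Q a * jacobiCoef n Q b := by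
  unfold jacobiCoef
  by_cases ha : a.Coprime Q
  swap
  · rw [if_neg ha, if_neg (fun h => ha h.coprime_mul_right), zero_mul]
  by_cases hb : b.Coprime Q
  swap
  · rw [if_neg hb, if_neg (fun h => hb h.coprime_mul_left), mul_zero]
  have ha0 : NeZero a := ⟨by rintro rfl; exact hQ (by simpa using ha)⟩
  have hb0 : NeZero b := ⟨by rintro rfl; exact hQ (by simpa using hb)⟩
  rw [if_pos ha, if_pos hb, if_pos (ha.mul_left hb), jacobiSym.mul_right]
  push_cast
  rfl

lemma natCast_pow_cpow (p e : ℕ) (w : ℂ) : ((p ^ e : ℕ) : ℂ) ^ w = ((p : ℂ) ^ w) ^ e := by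
  induction e with
  | zero => simp
  | succ e ih => rw [pow_succ, Nat.cast_mul, natCast_mul_natCast_cpow, ih, pow_succ]

/-- Euler product of `∑ (n/b) b^{-w}`. -/
lemma hasProd_jacobiCoef (n : ℤ) {Q : ℕ} (hQ : Q ≠ 1) {w : ℂ} (hw : 1 < w.re) :
    HasProd (fun p : Nat.Primes => (1 - jacobiCoef n Q p / (p : ℂ) ^ w)⁻¹)
      (LSeries (jacobiCoef n Q) w) := by
  have hw0 : w ≠ 0 := by rintro rfl; norm_num at hw
  let f : ℕ →*₀ ℂ :=
    { toFun := fun b => jacobiCoef n Q b / (b : ℂ) ^ w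
      map_zero' := by simp [zero_cpow hw0]
      map_one' := by simp [jacobiCoef]
      map_mul' := by
        intro a b
        rw [jacobiCoef_mul n hQ, Nat.cast_mul, natCast_mul_natCast_cpow, mul_div_mul_comm] }
  have hf : ∀ b, f b = LSeries.term (jacobiCoef n Q) w b := by
    intro b
    rw [LSeries.term_def]
    split_ifs with h
    · subst h; exact map_zero f
    · rfl
  have hsum : LSeriesSummable (jacobiCoef n Q) w :=
    LSeriesSummable_of_bounded_of_one_lt_re (m := 1) (fun b _ => norm_jacobiCoef_le n Q b) hw
  have h := EulerProduct.eulerProduct_completely_multiplicative_hasProd (f := f) (by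
    simp only [hf]; exact hsum.norm)
  simp only [hf] at h
  refine h.congr_fun fun p => ?_
  rw [LSeries.term_of_ne_zero p.2.ne_zero]

lemma hasProd_roughCoef (n : ℤ) {Q : ℕ} (hQ : 2 ∣ Q) {w : ℂ} (hw : 3 / 2 < w.re) :
    HasProd (fun p : Nat.Primes => ∑' e : ℕ, LSeries.term (roughCoef n Q) w ((p : ℕ) ^ e))
      (LSeries (roughCoef n Q) w) := by
  refine EulerProduct.eulerProduct_hasProd ?_ ?_ (lseriesSummable_roughCoef n hQ hw).norm ?_
  · simp [roughCoef, rootMoebius_one]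
  · intro a b hab
    by_cases ha0 : a = 0
    · subst ha0; simp
    by_cases hb0 : b = 0
    · subst hb0; simp
    rw [LSeries.term_of_ne_zero (mul_ne_zero ha0 hb0), LSeries.term_of_ne_zero ha0,
      LSeries.term_of_ne_zero hb0, Nat.cast_mul, natCast_mul_natCast_cpow, div_mul_div_comm]
    congr 1
    unfold roughCoef
    by_cases ha : a.Coprime Q
    swap
    · rw [if_neg ha, if_neg (fun h => ha h.coprime_mul_right), zero_mul]
    by_cases hb : b.Coprime Q
    swap
    · rw [if_neg hb, if_neg (fun h => hb h.coprime_mul_left), mul_zero]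
    rw [if_pos ha, if_pos hb, if_pos (ha.mul_left hb), (rootMoebius_isMultiplicative n).2 hab,
      Int.cast_mul]
  · simp

lemma term_roughCoef_pow (n : ℤ) (Q : ℕ) (w : ℂ) {p : ℕ} (hp : p.Prime) (e : ℕ) :
    LSeries.term (roughCoef n Q) w (p ^ e) =
      (if (p ^ e).Coprime Q then (rootMoebius n (p ^ e) : ℂ) else 0) * (((p : ℂ) ^ w)⁻¹) ^ e := by
  rw [LSeries.term_of_ne_zero (pow_pos hp.pos e).ne', natCast_pow_cpow, roughCoef, inv_pow,
    div_eq_mul_inv]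

lemma tsum_term_roughCoef_of_dvd (n : ℤ) {Q : ℕ} (w : ℂ) {p : ℕ} (hp : p.Prime) (hpQ : p ∣ Q) :
    ∑' e : ℕ, LSeries.term (roughCoef n Q) w (p ^ e) = 1 := by
  rw [tsum_eq_single 0]
  · simp [roughCoef, rootMoebius_one]
  · intro e he
    rw [term_roughCoef_pow n Q w hp, if_neg, zero_mul]
    intro h
    rw [Nat.coprime_pow_left_iff (Nat.pos_of_ne_zero he)] at h
    exact (Nat.Prime.coprime_iff_not_dvd hp).1 h hpQ

lemma one_apply_of_dvd {Q p : ℕ} (hp : p.Prime) (hpQ : p ∣ Q) :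
    (1 : DirichletCharacter ℂ Q) (p : ZMod Q) = 0 := by
  refine MulChar.map_nonunit _ ?_
  rw [ZMod.isUnit_iff_coprime, Nat.Prime.coprime_iff_not_dvd hp]
  exact fun h => h hpQ

lemma one_apply_of_not_dvd {Q p : ℕ} (hp : p.Prime) (hpQ : ¬ p ∣ Q) :
    (1 : DirichletCharacter ℂ Q) (p : ZMod Q) = 1 := by
  refine MulChar.one_apply ?_
  rwa [ZMod.isUnit_iff_coprime, Nat.Prime.coprime_iff_not_dvd hp]

lemma norm_natCast_cpow_inv_lt_one {p : ℕ} (hp : p.Prime) {w : ℂ} (hw : 0 < w.re) :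
    ‖((p : ℂ) ^ w)⁻¹‖ < 1 := by
  rw [norm_inv, norm_natCast_cpow_of_pos hp.pos]
  exact inv_lt_one_of_one_lt₀ (Real.one_lt_rpow (by exact_mod_cast hp.one_lt) hw)

/-- For `n ≠ 0`, the part of the Dirichlet series prime to `Q` is
`∑ (n/b) b^{-w} / ∑ b^{-2w}`, both sums being over `b` prime to `Q`. -/
lemma LSeries_roughCoef_mul (n : ℤ) {Q : ℕ} (h2 : 2 ∣ Q)
    (hn : ∀ p : ℕ, p.Prime → (p : ℤ) ∣ n → p ∣ Q) {w : ℂ} (hw : 3 / 2 < w.re) :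
    LSeries (roughCoef n Q) w *
        LSeries (fun b => (1 : DirichletCharacter ℂ Q) (b : ZMod Q)) (2 * w) =
      LSeries (jacobiCoef n Q) w := by
  have hQ1 : Q ≠ 1 := by rintro rfl; norm_num at h2
  have h2w : 1 < (2 * w).re := by
    have : (2 * w).re = 2 * w.re := by simp
    linarith
  refine ((hasProd_roughCoef n h2 hw).mul
    (DirichletCharacter.LSeries_eulerProduct_hasProd 1 h2w)).unique
    ((hasProd_jacobiCoef n hQ1 (by linarith : 1 < w.re)).congr_fun fun p => ?_)
  have hp := p.2
  by_cases hpQ : (p : ℕ) ∣ Q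
  · rw [tsum_term_roughCoef_of_dvd n w hp hpQ, one_apply_of_dvd hp hpQ, jacobiCoef,
      if_neg (fun h => (Nat.Prime.coprime_iff_not_dvd hp).1 h hpQ)]
    simp
  · have hcop : (p : ℕ).Coprime Q := (Nat.Prime.coprime_iff_not_dvd hp).2 hpQ
    have hp2 : (p : ℕ) ≠ 2 := by rintro h; exact hpQ (h ▸ h2)
    have hpn : ¬ ((p : ℕ) : ℤ) ∣ n := fun h => hpQ (hn p hp h)
    -- the Euler factors satisfy `(1 + J X) / (1 - X²) = 1 / (1 - J X)`, because `J² = 1`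
    set X := (((p : ℕ) : ℂ) ^ w)⁻¹ with hX
    have hXn : ‖X‖ < 1 := norm_natCast_cpow_inv_lt_one hp (by linarith)
    have e1 : ∑' e : ℕ, LSeries.term (roughCoef n Q) w ((p : ℕ) ^ e) =
        1 + (jacobiSym n p : ℂ) * X := by
      rw [tsum_eq_sum (s := Finset.range 2)]
      · rw [Finset.sum_range_succ, Finset.sum_range_one, term_roughCoef_pow n Q w hp,
          term_roughCoef_pow n Q w hp, pow_zero, pow_one, if_pos (Nat.coprime_one_left Q),
          if_pos hcop, rootMoebius_one, rootMoebius_prime n hp hp2]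
        simp [hX]
      · intro e he
        obtain ⟨k, rfl⟩ := Nat.exists_eq_add_of_le' (not_lt.1 (fun h => he (Finset.mem_range.2 h)))
        rw [term_roughCoef_pow n Q w hp, rootMoebius_odd_prime_pow n hp hp2 hpn]
        simp
    have e2 : ((p : ℕ) : ℂ) ^ (-(2 * w)) = X ^ 2 := by
      rw [cpow_neg, show 2 * w = ((2 : ℕ) : ℂ) * w by norm_num, cpow_nat_mul, hX, inv_pow]
    have hJ : (jacobiSym n p : ℂ) ^ 2 = 1 := by
      have : (jacobiSym n p) ^ 2 = 1 := by
        refine jacobiSym.sq_one ?_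
        have := (Prime.coprime_iff_not_dvd (Nat.prime_iff_prime_int.1 hp)).2 hpn
        exact Int.isCoprime_iff_gcd_eq_one.1 this.symm
      exact_mod_cast this
    rw [e1, e2, one_apply_of_not_dvd hp hpQ, jacobiCoef, if_pos hcop, one_mul, div_eq_mul_inv, ← hX]
    set J := (jacobiSym n p : ℂ)
    have hJn : ‖J * X‖ < 1 := by
      rw [norm_mul]
      have : ‖J‖ ^ 2 = 1 := by rw [← norm_pow, hJ, norm_one]
      have : ‖J‖ = 1 := by
        have := norm_nonneg J
        nlinarith
      rw [this, one_mul]; exact hXn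
    have h1 : 1 - J * X ≠ 0 := by
      intro h
      rw [← sub_eq_zero.1 h, norm_one] at hJn
      exact lt_irrefl _ hJn
    have h3 : 1 - X ^ 2 ≠ 0 := by
      intro h
      have : ‖X ^ 2‖ = 1 := by rw [← sub_eq_zero.1 h, norm_one]
      rw [norm_pow] at this
      have := norm_nonneg X
      nlinarith
    field_simp
    linear_combination -X ^ 2 * hJ

/-- For `n = 0` the part prime to `Q` is `∑ b^{1-2w} / ∑ b^{-2w}`. -/
lemma LSeries_roughCoef_zero_mul {Q : ℕ} (h2 : 2 ∣ Q) {w : ℂ} (hw : 3 / 2 < w.re) :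
    LSeries (roughCoef 0 Q) w *
        LSeries (fun b => (1 : DirichletCharacter ℂ Q) (b : ZMod Q)) (2 * w) =
      LSeries (jacobiCoef 1 Q) (2 * w - 1) := by
  have hQ1 : Q ≠ 1 := by rintro rfl; norm_num at h2
  have h2wre : (2 * w).re = 2 * w.re := by simp
  have h2w : 1 < (2 * w).re := by linarith
  have h2w1 : 1 < (2 * w - 1).re := by rw [sub_re, h2wre, one_re]; linarith
  refine ((hasProd_roughCoef 0 h2 hw).mul
    (DirichletCharacter.LSeries_eulerProduct_hasProd 1 h2w)).unique
    ((hasProd_jacobiCoef 1 hQ1 h2w1).congr_fun fun p => ?_)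
  have hp := p.2
  have hpC : ((p : ℕ) : ℂ) ≠ 0 := by exact_mod_cast hp.ne_zero
  by_cases hpQ : (p : ℕ) ∣ Q
  · rw [tsum_term_roughCoef_of_dvd 0 w hp hpQ, one_apply_of_dvd hp hpQ, jacobiCoef,
      if_neg (fun h => (Nat.Prime.coprime_iff_not_dvd hp).1 h hpQ)]
    simp
  · have hcop : (p : ℕ).Coprime Q := (Nat.Prime.coprime_iff_not_dvd hp).2 hpQ
    -- only even powers of `p` contribute, and the Euler factor is `(1 - X²) / (1 - p X²)`
    set X := (((p : ℕ) : ℂ) ^ w)⁻¹ with hX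
    have e2 : ((p : ℕ) : ℂ) ^ (-(2 * w)) = X ^ 2 := by
      rw [cpow_neg, show 2 * w = ((2 : ℕ) : ℂ) * w by norm_num, cpow_nat_mul, hX, inv_pow]
    have e3 : (((p : ℕ) : ℂ) ^ (2 * w - 1))⁻¹ = p * X ^ 2 := by
      rw [← cpow_neg, neg_sub, sub_eq_add_neg, cpow_add _ _ hpC, cpow_one, e2]
    have hY : ‖(p : ℂ) * X ^ 2‖ < 1 := by
      rw [← e3]; exact norm_natCast_cpow_inv_lt_one hp (by linarith)
    have hXn : ‖X‖ < 1 := norm_natCast_cpow_inv_lt_one hp (by linarith)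
    have hY1 : 1 - (p : ℂ) * X ^ 2 ≠ 0 := by
      intro h
      rw [← sub_eq_zero.1 h, norm_one] at hY
      exact lt_irrefl _ hY
    have h3 : 1 - X ^ 2 ≠ 0 := by
      intro h
      have : ‖X ^ 2‖ = 1 := by rw [← sub_eq_zero.1 h, norm_one]
      rw [norm_pow] at this
      have := norm_nonneg X
      nlinarith
    have ht : ∀ e, LSeries.term (roughCoef 0 Q) w ((p : ℕ) ^ e) =
        (rootMoebius 0 ((p : ℕ) ^ e) : ℂ) * X ^ e := by
      intro e
      rw [term_roughCoef_pow 0 Q w hp, if_pos (hcop.pow_left e)]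
    have e1 : HasSum (fun e : ℕ => LSeries.term (roughCoef 0 Q) w ((p : ℕ) ^ e))
        (1 + (1 - (p : ℂ) * X ^ 2)⁻¹ * (((p : ℂ) - 1) * X ^ 2)) := by
      have hodd : HasSum
          (fun i : ℕ => LSeries.term (roughCoef 0 Q) w ((p : ℕ) ^ (2 * i + 1))) 0 := by
        refine hasSum_zero.congr_fun fun i => ?_
        rw [ht, rootMoebius_zero_odd hp]
        simp
      have heven : HasSum (fun i : ℕ => LSeries.term (roughCoef 0 Q) w ((p : ℕ) ^ (2 * i)))
          (1 + (1 - (p : ℂ) * X ^ 2)⁻¹ * (((p : ℂ) - 1) * X ^ 2)) := by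
        have h0 : LSeries.term (roughCoef 0 Q) w ((p : ℕ) ^ (2 * 0)) = 1 := by
          rw [ht]; simp [rootMoebius_one]
        have h1 := HasSum.zero_add
          (f := fun i : ℕ => LSeries.term (roughCoef 0 Q) w ((p : ℕ) ^ (2 * i)))
          (((hasSum_geometric_of_norm_lt_one hY).mul_right (((p : ℂ) - 1) * X ^ 2)).congr_fun
            fun i => by
              rw [ht, show 2 * (i + 1) = 2 * i + 2 by ring, rootMoebius_zero_even hp]
              push_cast
              ring)
        rwa [h0] at h1
      have := HasSum.even_add_odd
        (f := fun e => LSeries.term (roughCoef 0 Q) w ((p : ℕ) ^ e)) heven hodd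
      rwa [add_zero] at this
    rw [e1.tsum_eq, e2, one_apply_of_not_dvd hp hpQ, jacobiCoef, if_pos hcop, one_mul,
      div_eq_mul_inv, e3, jacobiSym.one_left, Int.cast_one, one_mul]
    field_simp
    ring

/-! ### Dirichlet series with periodic coefficients -/

/-- The mean value of a function of period `q`. -/
noncomputable def periodMean (f : ℕ → ℂ) (q : ℕ) : ℂ := (∑ i ∈ Finset.range q, f i) / q

/-- The deviation of the summatory function of `f` from its main term. -/
noncomputable def sumError (f : ℕ → ℂ) (q : ℕ) (t : ℝ) : ℂ :=
  ∑ k ∈ Finset.Icc 1 ⌊t⌋₊, f k - periodMean f q * t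

lemma norm_periodMean_le {f : ℕ → ℂ} {q : ℕ} (hq : 0 < q) (hf : ∀ b, ‖f b‖ ≤ 1) :
    ‖periodMean f q‖ ≤ 1 := by
  rw [periodMean, norm_div, norm_natCast, div_le_one (by exact_mod_cast hq)]
  simpa using norm_sum_le_of_le (Finset.range q) (fun b _ => hf b)

/-- At the integers the deviation is periodic up to a constant, hence bounded. -/
lemma norm_sumError_le {f : ℕ → ℂ} {q : ℕ} (hq : 0 < q) (hf : ∀ b, ‖f b‖ ≤ 1)
    (hper : ∀ b, f (q + b) = f b) {t : ℝ} (ht : 0 ≤ t) : ‖sumError f q t‖ ≤ 4 * q := by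
  have hqC : (q : ℂ) ≠ 0 := by exact_mod_cast hq.ne'
  have hm := norm_periodMean_le hq hf
  set m := periodMean f q with hmdef
  let g : ℕ → ℂ := fun n => ∑ k ∈ Finset.range n, f k - m * n
  have hg : ∀ n, g (n + q) = g n := by
    intro n
    simp only [g]
    rw [add_comm n q, Finset.sum_range_add]
    simp_rw [hper]
    rw [hmdef, periodMean]
    push_cast
    field_simp
    ring
  have hg2 : ∀ n, ‖g n‖ ≤ 2 * q := by
    intro n
    have h1 : g n = g (n % q) := by
      conv_lhs => rw [← Nat.mod_add_div n q]
      generalize n / q = a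
      induction a with
      | zero => simp
      | succ a ih => rw [← ih, show n % q + q * (a + 1) = n % q + q * a + q by ring, hg]
    rw [h1]
    have h2 : n % q ≤ q := (Nat.mod_lt n hq).le
    have h3 : ‖∑ k ∈ Finset.range (n % q), f k‖ ≤ q := by
      refine (norm_sum_le_of_le _ (fun b _ => hf b)).trans ?_
      simp only [Finset.sum_const, Finset.card_range, nsmul_eq_mul, mul_one]
      exact_mod_cast h2
    have h4 : ‖m * (n % q : ℕ)‖ ≤ q := by
      rw [norm_mul, norm_natCast]
      calc ‖m‖ * ((n % q : ℕ) : ℝ) ≤ 1 * q := by gcongr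
        _ = q := one_mul _
    calc ‖g (n % q)‖ ≤ _ := norm_sub_le _ _
      _ ≤ 2 * q := by linarith
  have h1 : sumError f q t = g (⌊t⌋₊ + 1) - f 0 + m * ((⌊t⌋₊ : ℝ) + 1 - t : ℝ) := by
    simp only [sumError, g]
    rw [Finset.range_eq_Ico, Finset.sum_eq_sum_Ico_succ_bot (by omega)]
    have : Finset.Ico (0 + 1) (⌊t⌋₊ + 1) = Finset.Icc 1 ⌊t⌋₊ := by
      ext k; simp
    rw [this]
    push_cast
    ring
  rw [h1]
  have h2 : ‖((((⌊t⌋₊ : ℝ) + 1 - t : ℝ)) : ℂ)‖ ≤ 1 := by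
    rw [norm_real, Real.norm_eq_abs, abs_le]
    have := Nat.floor_le ht
    have := Nat.lt_floor_add_one t
    constructor <;> linarith
  have h3 : ‖m * (((⌊t⌋₊ : ℝ) + 1 - t : ℝ) : ℂ)‖ ≤ 1 := by
    rw [norm_mul]
    exact mul_le_one₀ hm (norm_nonneg _) h2
  have hq1 : (1 : ℝ) ≤ q := by exact_mod_cast hq
  calc _ ≤ ‖g (⌊t⌋₊ + 1) - f 0‖ + 1 := (norm_add_le _ _).trans (by gcongr)
    _ ≤ ‖g (⌊t⌋₊ + 1)‖ + ‖f 0‖ + 1 := by gcongr; exact norm_sub_le _ _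
    _ ≤ 2 * q + 1 + 1 := by gcongr; exacts [hg2 _, hf 0]
    _ ≤ 4 * q := by linarith

lemma measurable_sumError (f : ℕ → ℂ) (q : ℕ) : Measurable (sumError f q) := by
  have h1 : Measurable fun t : ℝ => ∑ k ∈ Finset.Icc 1 ⌊t⌋₊, f k :=
    (measurable_from_nat (f := fun n => ∑ k ∈ Finset.Icc 1 n, f k)).comp Nat.measurable_floor
  exact h1.sub (by fun_prop)

/-- The integral `∫_1^∞ R(t) t^{-w-1} dt` of the error term `R = sumError f q`. -/
noncomputable def errorIntegral (f : ℕ → ℂ) (q : ℕ) (w : ℂ) : ℂ :=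
  ∫ t in Set.Ioi (1 : ℝ), sumError f q t * (t : ℂ) ^ (-(w + 1))

/-- The continuation of `(w - 1) ∑ f(b) b^{-w}` to `Re w > 0`, for `f` of period `q`. -/
noncomputable def periodicExt (f : ℕ → ℂ) (q : ℕ) (w : ℂ) : ℂ :=
  periodMean f q * w + (w - 1) * w * errorIntegral f q w

lemma norm_errorIntegrand_le {f : ℕ → ℂ} {q : ℕ} (hq : 0 < q) (hf : ∀ b, ‖f b‖ ≤ 1)
    (hper : ∀ b, f (q + b) = f b) (w : ℂ) {t : ℝ} (ht : 1 < t) :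
    ‖sumError f q t * (t : ℂ) ^ (-(w + 1))‖ ≤ 4 * q * t ^ (-(w.re + 1)) := by
  rw [norm_mul, norm_cpow_eq_rpow_re_of_pos (by linarith)]
  have : (-(w + 1)).re = -(w.re + 1) := by simp
  rw [this]
  gcongr
  exact norm_sumError_le hq hf hper (by linarith)

lemma integrableOn_errorIntegrand {f : ℕ → ℂ} {q : ℕ} (hq : 0 < q) (hf : ∀ b, ‖f b‖ ≤ 1)
    (hper : ∀ b, f (q + b) = f b) {w : ℂ} (hw : 0 < w.re) :
    MeasureTheory.IntegrableOn (fun t : ℝ => sumError f q t * (t : ℂ) ^ (-(w + 1)))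
      (Set.Ioi 1) := by
  refine MeasureTheory.Integrable.mono'
    ((integrableOn_Ioi_rpow_of_lt (by linarith : -(w.re + 1) < -1) one_pos).const_mul (4 * q)) ?_ ?_
  · exact ((measurable_sumError f q).mul (by fun_prop)).aestronglyMeasurable
  · refine (MeasureTheory.ae_restrict_iff' measurableSet_Ioi).2
      (Eventually.of_forall fun t ht => ?_)
    exact norm_errorIntegrand_le hq hf hper w ht

lemma norm_errorIntegral_le {f : ℕ → ℂ} {q : ℕ} (hq : 0 < q) (hf : ∀ b, ‖f b‖ ≤ 1)
    (hper : ∀ b, f (q + b) = f b) {w : ℂ} (hw : 0 < w.re) :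
    ‖errorIntegral f q w‖ ≤ 4 * q / w.re := by
  have h := MeasureTheory.norm_integral_le_of_norm_le
    ((integrableOn_Ioi_rpow_of_lt (by linarith : -(w.re + 1) < -1) one_pos).const_mul (4 * (q : ℝ)))
    ((MeasureTheory.ae_restrict_iff' measurableSet_Ioi).2 (Eventually.of_forall fun t ht =>
      norm_errorIntegrand_le hq hf hper w ht))
  refine h.trans (le_of_eq ?_)
  rw [MeasureTheory.integral_const_mul, integral_Ioi_rpow_of_lt (by linarith) one_pos,
    Real.one_rpow, show -(w.re + 1) + 1 = -w.re by ring, neg_div_neg_eq, mul_one_div]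

lemma differentiableAt_errorIntegral {f : ℕ → ℂ} {q : ℕ} (hq : 0 < q) (hf : ∀ b, ‖f b‖ ≤ 1)
    (hper : ∀ b, f (q + b) = f b) {w : ℂ} (hw : 0 < w.re) :
    DifferentiableAt ℂ (errorIntegral f q) w := by
  let F : ℝ → ℂ := (Set.Ioi (1 : ℝ)).indicator (sumError f q)
  have hF1 : ∀ t, 1 < t → F t = sumError f q t := fun t ht =>
    Set.indicator_of_mem (Set.mem_Ioi.2 ht) _
  have hF0 : ∀ t, ¬ 1 < t → F t = 0 := fun t ht => Set.indicator_of_notMem (by simpa using ht) _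
  have hFb : ∀ t, ‖F t‖ ≤ 4 * q := by
    intro t
    by_cases ht : 1 < t
    · rw [hF1 t ht]
      exact norm_sumError_le hq hf hper (by have : (1 : ℝ) < t := ht; linarith)
    · rw [hF0 t ht, norm_zero]; positivity
  have hFm : Measurable F := (measurable_sumError f q).indicator measurableSet_Ioi
  -- the integral is the Mellin transform of a bounded function vanishing on `(0, 1]`
  have heq : errorIntegral f q = fun w => mellin F (-w) := by
    funext w
    rw [errorIntegral, mellin, ← MeasureTheory.integral_indicator measurableSet_Ioi,
      ← MeasureTheory.integral_indicator measurableSet_Ioi]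
    congr 1
    funext t
    by_cases ht : (1 : ℝ) < t
    · rw [Set.indicator_of_mem (Set.mem_Ioi.2 ht),
        Set.indicator_of_mem (Set.mem_Ioi.2 (by linarith : (0 : ℝ) < t)), smul_eq_mul,
        hF1 t ht, mul_comm]
      congr 2
      ring
    · rw [Set.indicator_of_notMem (by simpa using ht)]
      by_cases ht0 : (0 : ℝ) < t
      · rw [Set.indicator_of_mem (Set.mem_Ioi.2 ht0), smul_eq_mul,
          hF0 t ht, mul_zero]
      · rw [Set.indicator_of_notMem (by simpa using ht0)]
  rw [heq]
  have hloc : MeasureTheory.LocallyIntegrableOn F (Set.Ioi 0) := by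
    have : MeasureTheory.LocallyIntegrable F := by
      refine (MeasureTheory.locallyIntegrable_const (4 * (q : ℝ))).mono
        hFm.aestronglyMeasurable (Eventually.of_forall fun t => ?_)
      rw [Real.norm_of_nonneg (by positivity)]
      exact hFb t
    exact this.locallyIntegrableOn _
  have hM : DifferentiableAt ℂ (mellin F) (-w) := by
    refine mellin_differentiableAt_of_isBigO_rpow (a := 0) (b := (-w).re - 1) hloc ?_ ?_ ?_ ?_
    · refine Asymptotics.IsBigO.of_bound (4 * q) (Eventually.of_forall fun t => ?_)
      simpa using hFb t
    · simpa using hw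
    · refine (Asymptotics.isBigO_zero _ _).congr' ?_ EventuallyEq.rfl
      filter_upwards [nhdsWithin_le_nhds (Iio_mem_nhds one_pos)] with t ht
      exact (hF0 t (not_lt.2 (le_of_lt ht))).symm
    · linarith
  exact hM.comp w differentiableAt_id.neg

lemma differentiableAt_periodicExt {f : ℕ → ℂ} {q : ℕ} (hq : 0 < q) (hf : ∀ b, ‖f b‖ ≤ 1)
    (hper : ∀ b, f (q + b) = f b) {w : ℂ} (hw : 0 < w.re) :
    DifferentiableAt ℂ (periodicExt f q) w := by
  have := differentiableAt_errorIntegral hq hf hper hw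
  unfold periodicExt
  fun_prop

lemma norm_periodicExt_le {f : ℕ → ℂ} {q : ℕ} (hq : 0 < q) (hf : ∀ b, ‖f b‖ ≤ 1)
    (hper : ∀ b, f (q + b) = f b) {w : ℂ} (hw : 0 < w.re) :
    ‖periodicExt f q w‖ ≤ (‖w‖ + (‖w‖ + 1) * ‖w‖ * 4 / w.re) * q := by
  have h1 := norm_errorIntegral_le hq hf hper hw
  have h2 := norm_periodMean_le hq hf
  have hq1 : (1 : ℝ) ≤ q := by exact_mod_cast hq
  unfold periodicExt
  have h3 : ‖w - 1‖ ≤ ‖w‖ + 1 := by simpa using norm_sub_le w 1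
  calc _ ≤ ‖periodMean f q * w‖ + ‖(w - 1) * w * errorIntegral f q w‖ := norm_add_le _ _
    _ ≤ 1 * ‖w‖ + (‖w‖ + 1) * ‖w‖ * (4 * q / w.re) := by
        rw [norm_mul, norm_mul, norm_mul]; gcongr
    _ ≤ q * ‖w‖ + (‖w‖ + 1) * ‖w‖ * (4 * q / w.re) := by gcongr
    _ = _ := by ring

lemma periodicExt_one (f : ℕ → ℂ) (q : ℕ) : periodicExt f q 1 = periodMean f q := by
  simp [periodicExt]

/-- Summation by parts. -/
lemma periodicExt_eq {f : ℕ → ℂ} {q : ℕ} (hq : 0 < q) (hf : ∀ b, ‖f b‖ ≤ 1)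
    (hper : ∀ b, f (q + b) = f b) {w : ℂ} (hw : 1 < w.re) :
    periodicExt f q w = (w - 1) * LSeries f w := by
  have hw0 : 0 < w.re := by linarith
  have hw1 : w - 1 ≠ 0 := by
    intro h
    rw [sub_eq_zero.1 h] at hw
    simp at hw
  have hO : (fun n : ℕ => ∑ k ∈ Finset.Icc 1 n, f k) =O[atTop] fun n => (n : ℝ) ^ (1 : ℝ) := by
    refine Asymptotics.IsBigO.of_bound 1 (Eventually.of_forall fun n => ?_)
    refine (norm_sum_le_of_le _ (fun b _ => hf b)).trans ?_
    simp
  have hL := LSeries_eq_mul_integral f zero_le_one hw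
    (LSeriesSummable_of_bounded_of_one_lt_re (m := 1) (fun b _ => hf b) hw) hO
  have hI1 : MeasureTheory.IntegrableOn (fun t : ℝ => periodMean f q * (t : ℂ) ^ (-w))
      (Set.Ioi 1) :=
    (integrableOn_Ioi_cpow_of_lt (by simpa using hw) one_pos).const_mul _
  have hI2 := integrableOn_errorIntegrand hq hf hper hw0
  have hsplit : ∫ t in Set.Ioi (1 : ℝ), (∑ k ∈ Finset.Icc 1 ⌊t⌋₊, f k) * (t : ℂ) ^ (-(w + 1)) =
      (∫ t in Set.Ioi (1 : ℝ), periodMean f q * (t : ℂ) ^ (-w)) + errorIntegral f q w := by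
    rw [errorIntegral, ← MeasureTheory.integral_add hI1 hI2]
    refine MeasureTheory.setIntegral_congr_fun measurableSet_Ioi fun t ht => ?_
    have ht0 : (t : ℂ) ≠ 0 := by
      have : (1 : ℝ) < t := ht
      exact_mod_cast (by linarith : t ≠ 0)
    have : (t : ℂ) ^ (-w) = t * (t : ℂ) ^ (-(w + 1)) := by
      rw [show -w = 1 + -(w + 1) by ring, cpow_add _ _ ht0, cpow_one]
    simp only [sumError]
    rw [this]
    ring
  rw [hL, hsplit, MeasureTheory.integral_const_mul,
    integral_Ioi_cpow_of_lt (by simpa using hw) one_pos, periodicExt]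
  have : -w + 1 = -(w - 1) := by ring
  rw [ofReal_one, one_cpow, this, neg_div_neg_eq]
  field_simp

/-! ### Mean values of Jacobi symbols -/

lemma jacobiCoef_periodic (n : ℤ) {Q : ℕ} (h2 : 2 ∣ Q) (hn : 4 * n.natAbs ∣ Q) (b : ℕ) :
    jacobiCoef n Q (Q + b) = jacobiCoef n Q b := by
  unfold jacobiCoef
  have hiff : (Q + b).Coprime Q ↔ b.Coprime Q := by simp
  by_cases hb : b.Coprime Q
  · rw [if_pos hb, if_pos (hiff.2 hb)]
    have hodd : Odd b := Nat.coprime_two_right.1 (Nat.Coprime.coprime_dvd_right h2 hb)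
    have hodd' : Odd (Q + b) :=
      Nat.coprime_two_right.1 (Nat.Coprime.coprime_dvd_right h2 (hiff.2 hb))
    rw [jacobiSym.mod_right n hodd, jacobiSym.mod_right n hodd']
    obtain ⟨k, hk⟩ := hn
    have e : (Q + b) % (4 * n.natAbs) = b % (4 * n.natAbs) := by
      rw [hk, add_comm, Nat.add_mul_mod_self_left]
    rw [e]
  · rw [if_neg hb, if_neg (fun h => hb (hiff.1 h))]

/-- If the symbol takes the value `-1` at some `b` prime to `Q`, its mean vanishes, since
multiplication by `b` changes its sign. -/
lemma periodMean_jacobiCoef_eq_zero (n : ℤ) {Q : ℕ} (hQ : Q ≠ 0) (h2 : 2 ∣ Q)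
    (hn : 4 * n.natAbs ∣ Q) {b : ℕ} (hb : b.Coprime Q) (hJ : jacobiSym n b = -1) :
    periodMean (jacobiCoef n Q) Q = 0 := by
  have : NeZero Q := ⟨hQ⟩
  have hQ1 : Q ≠ 1 := by rintro rfl; norm_num at h2
  have hper := jacobiCoef_periodic n h2 hn
  have hmod : ∀ a, jacobiCoef n Q (a % Q) = jacobiCoef n Q a := by
    intro a
    conv_rhs => rw [← Nat.mod_add_div a Q]
    generalize a / Q = k
    induction k with
    | zero => simp
    | succ k ih => rw [show a % Q + Q * (k + 1) = Q + (a % Q + Q * k) by ring, hper, ih]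
  have hS : ∑ i ∈ Finset.range Q, jacobiCoef n Q i = ∑ x : ZMod Q, jacobiCoef n Q x.val := by
    rw [sum_zmod_eq_sum_range]
    refine Finset.sum_congr rfl fun i hi => ?_
    rw [ZMod.val_natCast_of_lt (Finset.mem_range.1 hi)]
  have hb1 : jacobiCoef n Q b = -1 := by
    rw [jacobiCoef, if_pos hb, hJ]; norm_num
  let u := ZMod.unitOfCoprime b hb
  have hS2 : ∑ x : ZMod Q, jacobiCoef n Q x.val = -∑ x : ZMod Q, jacobiCoef n Q x.val := by
    conv_lhs => rw [← Equiv.sum_comp (Units.mulLeft u)]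
    rw [← Finset.sum_neg_distrib]
    refine Finset.sum_congr rfl fun x _ => ?_
    have : ((Units.mulLeft u) x).val = (b * x.val) % Q := by
      rw [Units.mulLeft_apply, ZMod.coe_unitOfCoprime, ZMod.val_mul, ZMod.val_natCast,
        Nat.mod_mul_mod]
    rw [this, hmod, jacobiCoef_mul n hQ1, hb1, neg_one_mul]
  rw [periodMean, hS]
  have : ∑ x : ZMod Q, jacobiCoef n Q x.val = 0 := by
    linear_combination hS2 / 2
  rw [this, zero_div]

/-- For squares the mean is the density of the integers prime to `Q`. -/
lemma periodMean_jacobiCoef_sq (m : ℤ) {Q : ℕ} (hQ : Q ≠ 0)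
    (hm : ∀ p : ℕ, p.Prime → (p : ℤ) ∣ m → p ∣ Q) :
    periodMean (jacobiCoef (m ^ 2) Q) Q = ∏ p ∈ Q.primeFactors, (1 - (p : ℂ)⁻¹) := by
  have h1 : ∑ i ∈ Finset.range Q, jacobiCoef (m ^ 2) Q i = (Q.totient : ℂ) := by
    rw [Nat.totient, Finset.card_filter]
    push_cast
    refine Finset.sum_congr rfl fun i _ => ?_
    unfold jacobiCoef
    by_cases h : i.Coprime Q
    · rw [if_pos h, if_pos h.symm]
      have hg : Int.gcd m i = 1 := by
        rw [Int.gcd_eq_natAbs, Int.natAbs_natCast]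
        refine Nat.coprime_of_dvd fun p hp hpm hpi => ?_
        have := hm p hp (Int.natCast_dvd.2 hpm)
        exact (Nat.Prime.coprime_iff_not_dvd hp).1 (Nat.Coprime.coprime_dvd_left hpi h) this
      rw [jacobiSym.sq_one' hg]
      norm_num
    · rw [if_neg h, if_neg (fun h' => h h'.symm)]
  have h2 := Nat.totient_eq_mul_prod_factors Q
  have h3 : (Q.totient : ℂ) = Q * ∏ p ∈ Q.primeFactors, (1 - (p : ℂ)⁻¹) := by
    have := congrArg (fun x : ℚ => (x : ℂ)) h2
    push_cast at this
    exact this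
  have hQC : (Q : ℂ) ≠ 0 := by exact_mod_cast hQ
  rw [periodMean, h1, h3]
  field_simp

lemma exists_crt {a b x y : ℕ} (h : a.Coprime b) :
    ∃ c, c % a = x % a ∧ c % b = y % b :=
  ⟨Nat.chineseRemainder h x y, (Nat.chineseRemainder h x y).2.1, (Nat.chineseRemainder h x y).2.2⟩

lemma coprime_of_mod_eq_one {b P : ℕ} (h : b % P = 1 % P) : b.Coprime P := by
  have : b ≡ 1 [MOD P] := h
  rw [Nat.Coprime, Nat.ModEq.gcd_eq this]
  simp

/-- A squarefree integer other than `1` is a non-residue for suitable moduli. -/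
lemma exists_jacobiSym_eq_neg_one_of_squarefree {s : ℤ} (hs : Squarefree s) (h1 : s ≠ 1) {Q : ℕ}
    (hQ : Q ≠ 0) : ∃ b : ℕ, b.Coprime Q ∧ jacobiSym s b = -1 := by
  have hs0 : s ≠ 0 := hs.ne_zero
  by_cases hodd : ∃ ℓ : ℕ, ℓ.Prime ∧ ℓ ≠ 2 ∧ (ℓ : ℤ) ∣ s
  · obtain ⟨ℓ, hℓ, hℓ2, s', rfl⟩ := hodd
    have : Fact ℓ.Prime := ⟨hℓ⟩
    have hs'0 : s' ≠ 0 := right_ne_zero_of_mul hs0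
    have hℓs' : ¬ (ℓ : ℤ) ∣ s' := by
      rintro ⟨a, rfl⟩
      have h := hs (ℓ : ℤ) ⟨a, by ring⟩
      rw [Int.isUnit_iff_natAbs_eq, Int.natAbs_natCast] at h
      exact hℓ.ne_one h
    have hF : ringChar (ZMod ℓ) ≠ 2 := by rwa [ZMod.ringChar_zmod_n]
    obtain ⟨g, hg⟩ := quadraticChar_exists_neg_one' hF
    -- `b` is chosen as a non-residue modulo the odd prime `ℓ ∣ s`, and `b ≡ 1` modulo `8`, the
    -- cofactor `s'`, and the part of `Q` prime to `ℓ`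
    set Q' := ordCompl[ℓ] Q with hQ'
    have hQ'0 : Q' ≠ 0 := (Nat.ordCompl_pos ℓ hQ).ne'
    have hcop : (8 * s'.natAbs * Q').Coprime ℓ := by
      refine Nat.Coprime.mul_left (Nat.Coprime.mul_left ?_ ?_) ?_
      · rw [show 8 = 2 ^ 3 by norm_num]
        exact Nat.Coprime.pow_left 3 ((Nat.coprime_primes Nat.prime_two hℓ).2 (Ne.symm hℓ2))
      · rw [Nat.coprime_comm, Nat.Prime.coprime_iff_not_dvd hℓ]
        exact fun h => hℓs' (Int.natCast_dvd.2 h)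
      · exact (Nat.coprime_ordCompl hℓ hQ).symm
    obtain ⟨b, hb1, hb2⟩ := exists_crt (x := 1) (y := (g : ZMod ℓ).val) hcop
    have hbP := coprime_of_mod_eq_one hb1
    have hbg : (b : ZMod ℓ) = g := by
      rw [← ZMod.natCast_zmod_val (g : ZMod ℓ)]
      exact (ZMod.natCast_eq_natCast_iff _ _ _).2 hb2
    have hJ : jacobiSym b ℓ = -1 := by
      rw [← jacobiSym.legendreSym.to_jacobiSym, legendreSym, Int.cast_natCast, hbg, hg]
    have hbℓ : b.Coprime ℓ := by
      by_contra hc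
      have hdvd : ℓ ∣ b := by
        by_contra h
        exact hc ((Nat.Prime.coprime_iff_not_dvd hℓ).2 h).symm
      have : (b : ZMod ℓ) = 0 := (ZMod.natCast_eq_zero_iff _ _).2 hdvd
      rw [hbg] at this
      exact g.ne_zero this
    have hb8 : b % 8 = 1 := by
      have := congrArg (· % 8) hb1
      rw [mul_assoc, Nat.mod_mul_right_mod, Nat.mod_mul_right_mod] at this
      simpa using this
    have hbodd : Odd b := Nat.odd_iff.2 (by omega)
    refine ⟨b, ?_, ?_⟩
    · rw [← Nat.ordProj_mul_ordCompl_eq_self Q ℓ]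
      exact Nat.Coprime.mul_right (hbℓ.pow_right _)
        (Nat.Coprime.coprime_dvd_right (dvd_mul_left _ _) hbP)
    · rw [jacobiSym.mul_left]
      have e1 : jacobiSym s' b = 1 := by
        rw [jacobiSym.mod_right s' hbodd]
        have h4 : b % (4 * s'.natAbs) = 1 % (4 * s'.natAbs) := by
          have := congrArg (· % (4 * s'.natAbs)) hb1
          rw [show 8 * s'.natAbs * Q' = 4 * s'.natAbs * (2 * Q') by ring, Nat.mod_mul_right_mod,
            Nat.mod_mul_right_mod] at this
          exact this
        have : 1 < 4 * s'.natAbs := by have := Int.natAbs_pos.2 hs'0; omega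
        rw [h4, Nat.mod_eq_of_lt this, jacobiSym.one_right]
      have e2 : jacobiSym ℓ b = -1 := by
        rw [jacobiSym.quadratic_reciprocity_one_mod_four' (hℓ.odd_of_ne_two hℓ2) (by omega), hJ]
      rw [e1, e2, mul_one]
  · have hsq : s = -1 ∨ s = 2 ∨ s = -2 := by
      have h2 : s.natAbs ∣ 2 := by
        have hsf : Squarefree s.natAbs := Int.squarefree_natAbs.2 hs
        rw [← Nat.prod_primeFactors_of_squarefree hsf]
        have hsub : s.natAbs.primeFactors ⊆ {2} := by
          intro p hp
          rw [Finset.mem_singleton]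
          by_contra hp2
          exact hodd ⟨p, Nat.prime_of_mem_primeFactors hp, hp2,
            Int.natCast_dvd.2 (Nat.dvd_of_mem_primeFactors hp)⟩
        have := Finset.prod_dvd_prod_of_subset _ _ (fun p => p) hsub
        simpa using this
      have := Nat.le_of_dvd two_pos h2
      omega
    -- for `s = -1, ±2` the symbol depends on `b` modulo `8` only
    set Q' := ordCompl[2] Q with hQ'
    have hcop : (8 : ℕ).Coprime Q' := by
      rw [show 8 = 2 ^ 3 by norm_num]
      exact Nat.Coprime.pow_left 3 (Nat.coprime_ordCompl Nat.prime_two hQ)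
    have key : ∀ r, r % 2 = 1 → ∃ b : ℕ, b % 8 = r % 8 ∧ b.Coprime Q := by
      intro r hr
      obtain ⟨b, hb1, hb2⟩ := exists_crt (x := r) (y := 1) hcop
      refine ⟨b, hb1, ?_⟩
      rw [← Nat.ordProj_mul_ordCompl_eq_self Q 2]
      refine Nat.Coprime.mul_right (Nat.Coprime.pow_right _ ?_) (coprime_of_mod_eq_one hb2)
      exact Nat.coprime_two_right.2 (Nat.odd_iff.2 (by omega))
    rcases hsq with rfl | rfl | rfl
    · obtain ⟨b, hb, hbQ⟩ := key 7 (by norm_num)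
      refine ⟨b, hbQ, ?_⟩
      rw [jacobiSym.at_neg_one (Nat.odd_iff.2 (by omega)), ZMod.χ₄_nat_three_mod_four (by omega)]
    · obtain ⟨b, hb, hbQ⟩ := key 5 (by norm_num)
      refine ⟨b, hbQ, ?_⟩
      rw [jacobiSym.at_two (Nat.odd_iff.2 (by omega)), ZMod.χ₈_nat_eq_if_mod_eight,
        if_neg (by omega), if_neg (by omega)]
    · obtain ⟨b, hb, hbQ⟩ := key 5 (by norm_num)
      refine ⟨b, hbQ, ?_⟩
      rw [show (-2 : ℤ) = -1 * 2 by norm_num, jacobiSym.mul_left,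
        jacobiSym.at_neg_one (Nat.odd_iff.2 (by omega)), ZMod.χ₄_nat_one_mod_four (by omega),
        jacobiSym.at_two (Nat.odd_iff.2 (by omega)), ZMod.χ₈_nat_eq_if_mod_eight,
        if_neg (by omega), if_neg (by omega), one_mul]

/-- An integer that is not a square is a non-residue for suitable moduli. -/
lemma exists_jacobiSym_eq_neg_one {n : ℤ} (hn0 : n ≠ 0) (hn : ∀ m : ℤ, n ≠ m ^ 2) {Q : ℕ}
    (hQ : Q ≠ 0) : ∃ b : ℕ, b.Coprime Q ∧ jacobiSym n b = -1 := by
  -- `n = s k²` with `s ≠ 1` squarefree, and `b` is taken prime to `k` as well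
  obtain ⟨a, k, hak, ha⟩ := Nat.sq_mul_squarefree n.natAbs
  have hk0 : k ≠ 0 := by rintro rfl; simp at hak; omega
  set s : ℤ := n.sign * a with hs
  have hns : n = s * (k : ℤ) ^ 2 := by
    have h := Int.sign_mul_natAbs n
    rw [← hak] at h
    calc n = n.sign * ((k ^ 2 * a : ℕ) : ℤ) := h.symm
      _ = s * (k : ℤ) ^ 2 := by rw [hs]; push_cast; ring
  have hsf : Squarefree s := by
    rw [← Int.squarefree_natAbs, hs, Int.natAbs_mul, Int.natAbs_sign_of_ne_zero hn0, one_mul,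
      Int.natAbs_natCast]
    exact ha
  have hs1 : s ≠ 1 := by
    intro h
    exact hn k (by rw [hns, h, one_mul])
  obtain ⟨b, hb, hJ⟩ := exists_jacobiSym_eq_neg_one_of_squarefree hsf hs1 (mul_ne_zero hQ hk0)
  refine ⟨b, hb.coprime_mul_right_right, ?_⟩
  have hkb : Int.gcd (k : ℤ) b = 1 := by
    rw [Int.gcd_natCast_natCast]
    exact hb.coprime_mul_left_right.symm
  rw [hns, jacobiSym.mul_left, jacobiSym.sq_one' hkb, mul_one, hJ]

/-! ### Sums over the integers composed of finitely many primes -/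

/-- Finite Euler products: a sum over the integers composed of primes of `S` of a product of local
terms factors as a product of sums over prime powers. -/
lemma hasSum_factoredNumbers {R : Type*} [RCLike R] (S : Finset ℕ)
    (hS : ∀ p ∈ S, p.Prime) (g : ℕ → ℕ → R) (hg : ∀ p ∈ S, Summable fun k => ‖g p k‖) :
    (Summable fun c : Nat.factoredNumbers S => ‖∏ p ∈ S, g p ((c : ℕ).factorization p)‖) ∧
    HasSum (fun c : Nat.factoredNumbers S => ∏ p ∈ S, g p ((c : ℕ).factorization p))
      (∏ p ∈ S, ∑' k, g p k) := by
  induction S using Finset.induction_on with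
  | empty =>
    rw [Nat.factoredNumbers_empty]
    exact ⟨(hasSum_unique _).summable, by simp [hasSum_unique]⟩
  | insert p S hpS ih =>
    have hp : p.Prime := hS p (Finset.mem_insert_self _ _)
    obtain ⟨ih1, ih2⟩ := ih (fun q hq => hS q (Finset.mem_insert_of_mem hq))
      (fun q hq => hg q (Finset.mem_insert_of_mem hq))
    have hgp := hg p (Finset.mem_insert_self _ _)
    have key : ∀ x : ℕ × Nat.factoredNumbers S,
        ∏ q ∈ insert p S, g q ((Nat.equivProdNatFactoredNumbers hp hpS x : ℕ).factorization q) =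
        g p x.1 * ∏ q ∈ S, g q ((x.2 : ℕ).factorization q) := by
      rintro ⟨k, m, hm⟩
      have hm0 := Nat.ne_zero_of_mem_factoredNumbers hm
      have hpm : ¬ p ∣ m := fun h => hpS (Nat.mem_factoredNumbers'.1 hm p hp h)
      rw [Finset.prod_insert hpS, Nat.equivProdNatFactoredNumbers_apply,
        Nat.factorization_mul (pow_ne_zero _ hp.ne_zero) hm0]
      congr 1
      · rw [Finsupp.add_apply, Nat.factorization_pow_self hp,
          Nat.factorization_eq_zero_of_not_dvd hpm, add_zero]
      · refine Finset.prod_congr rfl fun q hq => ?_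
        rw [Finsupp.add_apply, Nat.Prime.factorization_pow hp, Finsupp.single_eq_of_ne
          (by rintro rfl; exact hpS hq), zero_add]
    have hsum := summable_mul_of_summable_norm hgp ih1
    have hnorm := summable_norm_iff.2 hsum
    constructor
    · rw [← (Nat.equivProdNatFactoredNumbers hp hpS).summable_iff]
      refine (Summable.mul_norm hgp ih1).congr fun x => ?_
      simp only [Function.comp]
      rw [key]
    · rw [← (Nat.equivProdNatFactoredNumbers hp hpS).hasSum_iff, Finset.prod_insert hpS,
        ← ih2.tsum_eq, tsum_mul_tsum_of_summable_norm hgp ih1]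
      refine hsum.hasSum.congr_fun fun x => ?_
      exact key x

lemma two_pow_card_primeFactors_le {Q : ℕ} (hQ : Q ≠ 0) : 2 ^ Q.primeFactors.card ≤ Q := by
  calc 2 ^ Q.primeFactors.card ≤ ∏ p ∈ Q.primeFactors, p :=
        Finset.pow_card_le_prod _ _ _ fun p hp => (Nat.prime_of_mem_primeFactors hp).two_le
    _ ≤ Q := Nat.le_of_dvd (Nat.pos_of_ne_zero hQ) (Nat.prod_primeFactors_dvd Q)

/-- `∑ c^{-δ}` over the integers composed of primes dividing `Q` is at most a power of `Q`. -/
lemma exists_tsum_factoredNumbers_rpow_le {δ : ℝ} (hδ : 0 < δ) : ∃ k : ℕ, ∀ Q : ℕ, Q ≠ 0 →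
    (Summable fun c : Nat.factoredNumbers Q.primeFactors => ((c : ℕ) : ℝ) ^ (-δ)) ∧
    ∑' c : Nat.factoredNumbers Q.primeFactors, ((c : ℕ) : ℝ) ^ (-δ) ≤ (Q : ℝ) ^ k := by
  have h2 : (2 : ℝ) ^ (-δ) < 1 := Real.rpow_lt_one_of_one_lt_of_neg (by norm_num) (by linarith)
  -- every Euler factor is at most `(1 - 2^{-δ})⁻¹ ≤ 2^k`, and at most `log₂ Q` primes divide `Q`
  obtain ⟨k, hk⟩ := pow_unbounded_of_one_lt (1 - (2 : ℝ) ^ (-δ))⁻¹ (one_lt_two)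
  refine ⟨k, fun Q hQ => ?_⟩
  have hlt : ∀ p ∈ Q.primeFactors, (p : ℝ) ^ (-δ) ≤ 2 ^ (-δ) := fun p hp =>
    Real.rpow_le_rpow_of_nonpos (by norm_num)
      (by exact_mod_cast (Nat.prime_of_mem_primeFactors hp).two_le) (by linarith)
  have h0 : ∀ p : ℕ, 0 ≤ (p : ℝ) ^ (-δ) := fun p => Real.rpow_nonneg (Nat.cast_nonneg p) _
  obtain ⟨h1, h3⟩ := hasSum_factoredNumbers (R := ℝ) Q.primeFactors
    (fun p hp => Nat.prime_of_mem_primeFactors hp) (fun p k => ((p : ℝ) ^ (-δ)) ^ k)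
    (fun p hp => by
      refine (summable_geometric_of_lt_one (h0 p) ((hlt p hp).trans_lt h2)).norm)
  have hterm : ∀ c : Nat.factoredNumbers Q.primeFactors,
      ∏ p ∈ Q.primeFactors, ((p : ℝ) ^ (-δ)) ^ ((c : ℕ).factorization p) =
        ((c : ℕ) : ℝ) ^ (-δ) := by
    rintro ⟨c, hc⟩
    have hc0 := Nat.ne_zero_of_mem_factoredNumbers hc
    have : c = ∏ p ∈ Q.primeFactors, p ^ c.factorization p := by
      conv_lhs => rw [← Nat.prod_factorization_pow_eq_self hc0]
      refine Finsupp.prod_of_support_subset _ ?_ _ (by simp)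
      rw [Nat.support_factorization]
      exact Nat.primeFactors_subset_of_mem_factoredNumbers hc
    change _ = (c : ℝ) ^ (-δ)
    conv_rhs => rw [this]
    push_cast
    rw [← Real.finsetProd_rpow _ _ (fun p _ => by positivity)]
    refine Finset.prod_congr rfl fun p _ => ?_
    rw [← Real.rpow_natCast, ← Real.rpow_natCast, ← Real.rpow_mul (Nat.cast_nonneg _),
      ← Real.rpow_mul (Nat.cast_nonneg _), mul_comm]
  simp only [hterm] at h3
  refine ⟨h3.summable, h3.tsum_eq.trans_le ?_⟩
  calc ∏ p ∈ Q.primeFactors, ∑' k, ((p : ℝ) ^ (-δ)) ^ k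
      ≤ ∏ p ∈ Q.primeFactors, (2 : ℝ) ^ k := by
        refine Finset.prod_le_prod (fun p _ => tsum_nonneg fun k => pow_nonneg (h0 p) k)
          fun p hp => ?_
        rw [tsum_geometric_of_lt_one (h0 p) ((hlt p hp).trans_lt h2)]
        refine le_trans ?_ hk.le
        have := hlt p hp
        exact inv_anti₀ (by linarith) (by linarith)
    _ = ((2 ^ Q.primeFactors.card : ℕ) : ℝ) ^ k := by
        rw [Finset.prod_const, ← pow_mul, mul_comm]; push_cast; rw [pow_mul]
    _ ≤ (Q : ℝ) ^ k := by
        gcongr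
        exact_mod_cast two_pow_card_primeFactors_le hQ

lemma norm_term_smoothCoef_le (n : ℤ) {M : ℕ} (hM : 4 ∣ M) (Q : ℕ) {δ : ℝ} {w : ℂ}
    (hw : 1 / 2 + δ ≤ w.re) (c : ℕ) :
    ‖LSeries.term (smoothCoef n Q M) w c‖ ≤ Real.sqrt 2 *
      (Nat.factoredNumbers Q.primeFactors).indicator (fun c : ℕ => (c : ℝ) ^ (-δ)) c := by
  classical
  rcases eq_or_ne c 0 with rfl | hc
  · rw [LSeries.term_zero, norm_zero]
    exact mul_nonneg (Real.sqrt_nonneg _) (Set.indicator_nonneg (fun c _ => by positivity) _)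
  rw [LSeries.norm_term_eq, if_neg hc]
  by_cases h : c ∈ Nat.factoredNumbers Q.primeFactors
  · rw [Set.indicator_of_mem h, div_le_iff₀ (by positivity), mul_assoc]
    by_cases h' : M ∣ c
    · rw [smoothCoef, if_pos ⟨h, h'⟩]
      refine (norm_rootMoebius_le n c hc (hM.trans h')).trans ?_
      gcongr
      have hc1 : (1 : ℝ) ≤ c := by exact_mod_cast Nat.one_le_iff_ne_zero.2 hc
      rw [Real.sqrt_eq_rpow, ← Real.rpow_add (by linarith)]
      exact Real.rpow_le_rpow_of_exponent_le hc1 (by linarith)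
    · rw [smoothCoef, if_neg (fun hh => h' hh.2), norm_zero]; positivity
  · rw [smoothCoef, if_neg (fun hh => h hh.1), norm_zero, zero_div,
      Set.indicator_of_notMem h, mul_zero]

lemma lseriesSummable_smoothCoef (n : ℤ) {M : ℕ} (hM : 4 ∣ M) {Q : ℕ} (hQ : Q ≠ 0) {w : ℂ}
    (hw : 1 / 2 < w.re) : LSeriesSummable (smoothCoef n Q M) w := by
  obtain ⟨k, hk⟩ := exists_tsum_factoredNumbers_rpow_le (δ := w.re - 1 / 2) (by linarith)
  have h := (summable_subtype_iff_indicator (s := Nat.factoredNumbers Q.primeFactors)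
    (f := fun c : ℕ => (c : ℝ) ^ (-(w.re - 1 / 2)))).1 (hk Q hQ).1
  refine Summable.of_norm_bounded (h.mul_left (Real.sqrt 2))
    fun c => ?_
  exact norm_term_smoothCoef_le n hM Q (by linarith) c

/-- The smooth part grows at most polynomially in `Q`, uniformly in half-planes
`Re w ≥ 1/2 + δ`. -/
lemma exists_norm_LSeries_smoothCoef_le {M : ℕ} (hM : 4 ∣ M) {δ : ℝ} (hδ : 0 < δ) :
    ∃ k : ℕ, ∀ (n : ℤ) (Q : ℕ), Q ≠ 0 → ∀ w : ℂ, 1 / 2 + δ ≤ w.re →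
      ‖LSeries (smoothCoef n Q M) w‖ ≤ Real.sqrt 2 * (Q : ℝ) ^ k := by
  obtain ⟨k, hk⟩ := exists_tsum_factoredNumbers_rpow_le hδ
  refine ⟨k, fun n Q hQ w hw => ?_⟩
  obtain ⟨h1, h2⟩ := hk Q hQ
  have h := ((summable_subtype_iff_indicator (s := Nat.factoredNumbers Q.primeFactors)
    (f := fun c : ℕ => (c : ℝ) ^ (-δ))).1 h1).mul_left (Real.sqrt 2)
  calc ‖LSeries (smoothCoef n Q M) w‖ ≤ ∑' c, Real.sqrt 2 *
      (Nat.factoredNumbers Q.primeFactors).indicator (fun c : ℕ => (c : ℝ) ^ (-δ)) c :=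
        tsum_of_norm_bounded h.hasSum fun c => norm_term_smoothCoef_le n hM Q hw c
    _ = Real.sqrt 2 * ∑' c : Nat.factoredNumbers Q.primeFactors, ((c : ℕ) : ℝ) ^ (-δ) := by
        rw [tsum_mul_left, tsum_subtype (Nat.factoredNumbers Q.primeFactors)
          (fun c : ℕ => (c : ℝ) ^ (-δ))]
    _ ≤ _ := by gcongr

lemma differentiableAt_LSeries_smoothCoef (n : ℤ) {M : ℕ} (hM : 4 ∣ M) {Q : ℕ} (hQ : Q ≠ 0) {w : ℂ}
    (hw : 1 / 2 < w.re) : DifferentiableAt ℂ (LSeries (smoothCoef n Q M)) w := by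
  have : LSeries.abscissaOfAbsConv (smoothCoef n Q M) ≤ ((1 / 2 : ℝ) : EReal) :=
    LSeries.abscissaOfAbsConv_le_of_forall_lt_LSeriesSummable fun y hy =>
      lseriesSummable_smoothCoef n hM hQ (by simpa using hy)
  exact (LSeries_hasDerivAt (this.trans_lt (by exact_mod_cast hw))).differentiableAt

/-- The value at `w = 1` of the smooth part, for a square `n = m²`, as a product of local sums. -/
lemma LSeries_smoothCoef_one (m : ℤ) {M Q : ℕ} (hM : M ≠ 0) (hMQ : M ∣ Q) (hQ : Q ≠ 0)
    {S : ℕ → ℂ}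
    (hS : ∀ p ∈ Q.primeFactors,
      HasSum (fun k => localTerm m p (k + M.factorization p)) (S p)) :
    LSeries (smoothCoef (m ^ 2) Q M) 1 = ∏ p ∈ Q.primeFactors, S p := by
  classical
  -- the condition `M ∣ c` is local: it cuts off the local terms at the exponents of `M`
  let g : ℕ → ℕ → ℂ := fun p k => if M.factorization p ≤ k then localTerm m p k else 0
  have hg : ∀ p ∈ Q.primeFactors, HasSum (g p) (S p) := by
    intro p hp
    rw [← hasSum_nat_add_iff' (M.factorization p)]
    rw [Finset.sum_eq_zero, sub_zero]
    · refine (hS p hp).congr_fun fun k => ?_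
      simp [g]
    · intro i hi
      simp [g, Finset.mem_range.1 hi]
  have hgn : ∀ p ∈ Q.primeFactors, Summable fun k => ‖g p k‖ := by
    intro p hp
    exact (hg p hp).summable.norm
  obtain ⟨-, h⟩ := hasSum_factoredNumbers Q.primeFactors
    (fun p hp => Nat.prime_of_mem_primeFactors hp) g hgn
  rw [Finset.prod_congr rfl fun p hp => (hg p hp).tsum_eq] at h
  have h2 := (hasSum_subtype_iff_indicator (f := fun c : ℕ =>
    ∏ p ∈ Q.primeFactors, g p (c.factorization p))).1 h
  rw [LSeries, ← h2.tsum_eq]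
  congr 1
  funext c
  rcases eq_or_ne c 0 with rfl | hc
  · rw [LSeries.term_zero, Set.indicator_of_notMem]
    exact fun h => Nat.ne_zero_of_mem_factoredNumbers h rfl
  rw [LSeries.term_of_ne_zero hc, cpow_one]
  by_cases hcm : c ∈ Nat.factoredNumbers Q.primeFactors
  swap
  · rw [Set.indicator_of_notMem hcm, smoothCoef, if_neg (fun h => hcm h.1), zero_div]
  rw [Set.indicator_of_mem hcm]
  have hsub : c.primeFactors ⊆ Q.primeFactors := Nat.primeFactors_subset_of_mem_factoredNumbers hcm
  by_cases hd : M ∣ c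
  · have hle := (Nat.factorization_le_iff_dvd hM hc).2 hd
    have hc' : c = ∏ p ∈ Q.primeFactors, p ^ c.factorization p := by
      conv_lhs => rw [← Nat.prod_factorization_pow_eq_self hc]
      exact Finsupp.prod_of_support_subset _ (by rwa [Nat.support_factorization]) _ (by simp)
    have hh : rootMoebius (m ^ 2) c = ∏ p ∈ Q.primeFactors,
        rootMoebius (m ^ 2) (p ^ c.factorization p) := by
      rw [(rootMoebius_isMultiplicative (m ^ 2)).multiplicative_factorization _ hc]
      exact Finsupp.prod_of_support_subset _ (by rwa [Nat.support_factorization]) _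
        (by simp [rootMoebius_one])
    rw [smoothCoef, if_pos ⟨hcm, hd⟩, hh]
    have hcC : (c : ℂ) = ∏ p ∈ Q.primeFactors, (p : ℂ) ^ c.factorization p := by
      exact_mod_cast congrArg (Nat.cast (R := ℂ)) hc'
    rw [hcC]
    push_cast
    rw [← Finset.prod_div_distrib]
    refine Finset.prod_congr rfl fun p hp => ?_
    simp only [g]
    rw [if_pos (hle p), localTerm, div_eq_mul_inv]
  · have : ∃ p ∈ Q.primeFactors, c.factorization p < M.factorization p := by
      by_contra! hcon
      refine hd ((Nat.factorization_le_iff_dvd hM hc).1 fun p => ?_)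
      by_cases hp : p ∈ Q.primeFactors
      · exact hcon p hp
      · rw [Finsupp.notMem_support_iff.1 (fun h => hp (Nat.primeFactors_mono hMQ hQ
          (by rwa [Nat.support_factorization] at h)))]
        exact Nat.zero_le _
    obtain ⟨p, hp, hlt⟩ := this
    rw [smoothCoef, if_neg (fun h => hd h.2), zero_div, Finset.prod_eq_zero hp]
    simp [g, hlt]

/-! ### Continuation of the Dirichlet series of the Fourier coefficients -/

/-- The Möbius function restricted to the integers prime to `Q`. -/
noncomputable def moebiusCoef (Q a : ℕ) : ℂ :=
  (1 : DirichletCharacter ℂ Q) (a : ZMod Q) * (ArithmeticFunction.moebius a : ℂ)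

/-- The Dirichlet series `∑_{(a, Q) = 1} μ(a) a^{-u}`, the inverse of the zeta function with the
primes dividing `Q` removed. -/
noncomputable def zetaInv (Q : ℕ) (u : ℂ) : ℂ :=
  LSeries (moebiusCoef Q) u

lemma norm_moebiusCoef_le (Q a : ℕ) :
    ‖moebiusCoef Q a‖ ≤ 1 := by
  rw [moebiusCoef, norm_mul]
  refine mul_le_one₀ (DirichletCharacter.norm_le_one _ _) (norm_nonneg _) ?_
  rw [norm_intCast]
  exact_mod_cast ArithmeticFunction.abs_moebius_le_one

lemma lseriesSummable_moebiusCoef (Q : ℕ) {u : ℂ} (hu : 1 < u.re) :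
    LSeriesSummable (moebiusCoef Q) u :=
  LSeriesSummable_of_bounded_of_one_lt_re (m := 1) (fun a _ => norm_moebiusCoef_le Q a) hu

lemma differentiableAt_zetaInv (Q : ℕ) {u : ℂ} (hu : 1 < u.re) :
    DifferentiableAt ℂ (zetaInv Q) u := by
  have : LSeries.abscissaOfAbsConv (moebiusCoef Q) ≤ ((1 : ℝ) : EReal) :=
    LSeries.abscissaOfAbsConv_le_of_forall_lt_LSeriesSummable fun y hy =>
      lseriesSummable_moebiusCoef Q (by simpa using hy)
  exact (LSeries_hasDerivAt (this.trans_lt (by exact_mod_cast hu))).differentiableAt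

lemma exists_norm_zetaInv_le {δ : ℝ} (hδ : 0 < δ) : ∃ C : ℝ, 0 ≤ C ∧ ∀ (Q : ℕ) (u : ℂ),
    1 + δ ≤ u.re → ‖zetaInv Q u‖ ≤ C := by
  have hs : Summable fun a : ℕ => 1 / (a : ℝ) ^ (1 + δ) :=
    Real.summable_one_div_nat_rpow.2 (by linarith)
  refine ⟨∑' a : ℕ, 1 / (a : ℝ) ^ (1 + δ), tsum_nonneg fun a => by positivity, fun Q u hu => ?_⟩
  refine tsum_of_norm_bounded hs.hasSum fun a => ?_
  rcases eq_or_ne a 0 with rfl | ha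
  · rw [LSeries.term_zero, norm_zero]; positivity
  rw [LSeries.norm_term_eq, if_neg ha]
  have ha1 : (1 : ℝ) ≤ a := by exact_mod_cast Nat.one_le_iff_ne_zero.2 ha
  gcongr
  exact norm_moebiusCoef_le Q a

lemma LSeries_one_mul_zetaInv (Q : ℕ) {u : ℂ} (hu : 1 < u.re) :
    LSeries (fun a => (1 : DirichletCharacter ℂ Q) (a : ZMod Q)) u * zetaInv Q u = 1 :=
  DirichletCharacter.LSeries.mul_mu_eq_one _ hu

lemma zetaCoprime_eq_LSeries {Q : ℕ} {u : ℂ} (hu : 1 < u.re) :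
    zetaCoprime Q u = LSeries (fun a => (1 : DirichletCharacter ℂ Q) (a : ZMod Q)) u := by
  have h := DirichletCharacter.LSeries_eulerProduct_hasProd (1 : DirichletCharacter ℂ Q) hu
  let f : {p : ℕ // p.Prime ∧ ¬ p ∣ Q} → Nat.Primes := fun p => ⟨p.1, p.2.1⟩
  have hf : Function.Injective f := fun a b hab => Subtype.ext (congrArg (fun q => q.1) hab)
  have h1 := (hf.hasProd_iff ?_).2 h
  · refine (hasProd_zetaCoprime hu).unique (h1.congr_fun fun p => ?_)
    have hp : ((p.1 : ℕ) : ZMod Q) = ((f p : ℕ) : ZMod Q) := rfl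
    have hu' : IsUnit ((f p : ℕ) : ZMod Q) :=
      (ZMod.isUnit_iff_coprime _ _).2 ((Nat.Prime.coprime_iff_not_dvd p.2.1).2 p.2.2)
    simp only [Function.comp]
    rw [MulChar.one_apply hu', one_mul]
  · intro p hp
    have hd : (p : ℕ) ∣ Q := by
      by_contra hd
      exact hp ⟨⟨p.1, p.2, hd⟩, rfl⟩
    have hu' : ¬ IsUnit ((p.1 : ℕ) : ZMod Q) := by
      rw [ZMod.isUnit_iff_coprime, Nat.Prime.coprime_iff_not_dvd p.2]
      exact fun h => h hd
    have h0 : (1 : DirichletCharacter ℂ Q) ((p : ℕ) : ZMod Q) = 0 := MulChar.map_nonunit _ hu'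
    simp [h0]

lemma zetaCoprime_two_eq (Q : ℕ) (hQ : Q ≠ 0) :
    zetaCoprime Q 2 = (∏ p ∈ Q.primeFactors, (1 - ((p : ℂ) ^ 2)⁻¹)) * riemannZeta 2 := by
  have : NeZero Q := ⟨hQ⟩
  rw [zetaCoprime_eq_LSeries (by norm_num),
    ← DirichletCharacter.LFunction_eq_LSeries _ (by norm_num)]
  refine (DirichletCharacter.LFunctionTrivChar_eq_mul_riemannZeta (by norm_num)).trans ?_
  simp_rw [cpow_neg]
  norm_cast

lemma zetaCoprime_mul_zetaInv (Q : ℕ) {u : ℂ} (hu : 1 < u.re) :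
    zetaCoprime Q u * zetaInv Q u = 1 := by
  rw [zetaCoprime_eq_LSeries hu, LSeries_one_mul_zetaInv Q hu]

/-- The continuation of `(w - 1) ∑_{M ∣ c} h_n(c) c^{-w}` to `Re w > 1/2`. It is the product of the
part of the series supported on the primes of `n M`, of an inverse zeta function at `2 w`, and of
the continuation of a Dirichlet series with periodic coefficients: the Jacobi symbols `(n/b)` if
`n ≠ 0`, at `w`, and the trivial character if `n = 0`, at `2 w - 1`. In the latter case the factor
`2⁻¹` converts `(2 w - 1) - 1` into `w - 1`. -/
noncomputable def coefExt (n : ℤ) (M : ℕ) (w : ℂ) : ℂ :=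
  if n = 0 then
    LSeries (smoothCoef 0 M M) w * zetaInv M (2 * w) *
      (2⁻¹ * periodicExt (jacobiCoef 1 M) M (2 * w - 1))
  else
    LSeries (smoothCoef n (n.natAbs * M) M) w * zetaInv (n.natAbs * M) (2 * w) *
      periodicExt (jacobiCoef n (n.natAbs * M)) (n.natAbs * M) w

lemma jacobiCoef_one_periodic {M : ℕ} (hM : 4 ∣ M) (b : ℕ) :
    jacobiCoef 1 M (M + b) = jacobiCoef 1 M b :=
  jacobiCoef_periodic 1 ((Dvd.intro 2 rfl : 2 ∣ 4).trans hM) (by simpa using hM) b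

lemma jacobiCoef_natAbs_mul_periodic (n : ℤ) {M : ℕ} (hM : 4 ∣ M) (b : ℕ) :
    jacobiCoef n (n.natAbs * M) (n.natAbs * M + b) = jacobiCoef n (n.natAbs * M) b :=
  jacobiCoef_periodic n (((Dvd.intro 2 rfl : 2 ∣ 4).trans hM).trans (dvd_mul_left _ _))
    (by rw [mul_comm]; exact Nat.mul_dvd_mul_left _ hM) b

lemma coefExt_eq (n : ℤ) {M : ℕ} (hM : 4 ∣ M) (hM0 : M ≠ 0) {w : ℂ} (hw : 3 / 2 < w.re) :
    coefExt n M w = (w - 1) * LSeries (fullCoef n M) w := by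
  have h2M : 2 ∣ M := (Dvd.intro 2 rfl : 2 ∣ 4).trans hM
  have h2w : (2 * w).re = 2 * w.re := by simp
  have h2w1 : 1 < (2 * w).re := by rw [h2w]; linarith
  unfold coefExt
  split_ifs with hn
  · subst hn
    have hZ := LSeries_one_mul_zetaInv M h2w1
    rw [LSeries_fullCoef_eq 0 hM dvd_rfl hM0 hw,
      periodicExt_eq (Nat.pos_of_ne_zero hM0) (norm_jacobiCoef_le _ _) (jacobiCoef_one_periodic hM)
        (by rw [sub_re, h2w, one_re]; linarith), ← LSeries_roughCoef_zero_mul h2M hw]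
    linear_combination (LSeries (smoothCoef 0 M M) w * (w - 1) * LSeries (roughCoef 0 M) w) * hZ
  · have hn' : n.natAbs ≠ 0 := Int.natAbs_ne_zero.2 hn
    have hQ : n.natAbs * M ≠ 0 := mul_ne_zero hn' hM0
    have hZ := LSeries_one_mul_zetaInv (n.natAbs * M) h2w1
    rw [LSeries_fullCoef_eq n hM (dvd_mul_left M n.natAbs) hQ hw,
      periodicExt_eq (Nat.pos_of_ne_zero hQ) (norm_jacobiCoef_le _ _)
        (jacobiCoef_natAbs_mul_periodic n hM) (by linarith),
      ← LSeries_roughCoef_mul n (h2M.trans (dvd_mul_left _ _))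
        (fun p _ hp => (Int.natCast_dvd.1 hp).trans (dvd_mul_right _ _)) hw]
    linear_combination (LSeries (smoothCoef n (n.natAbs * M) M) w * (w - 1) *
      LSeries (roughCoef n (n.natAbs * M)) w) * hZ

lemma differentiableAt_coefExt (n : ℤ) {M : ℕ} (hM : 4 ∣ M) (hM0 : M ≠ 0) {w : ℂ}
    (hw : 1 / 2 < w.re) : DifferentiableAt ℂ (coefExt n M) w := by
  have h2w : (2 * w).re = 2 * w.re := by simp
  have hZ : ∀ Q : ℕ, DifferentiableAt ℂ (fun w => zetaInv Q (2 * w)) w := fun Q =>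
    (differentiableAt_zetaInv Q (u := 2 * w) (by rw [h2w]; linarith)).comp w (by fun_prop)
  unfold coefExt
  split_ifs with hn
  · refine ((differentiableAt_LSeries_smoothCoef 0 hM hM0 hw).mul (hZ M)).mul
      (DifferentiableAt.const_mul ?_ _)
    have hd : DifferentiableAt ℂ (fun w : ℂ => 2 * w - 1) w := by fun_prop
    refine DifferentiableAt.comp (g := periodicExt (jacobiCoef 1 M) M) w
      (differentiableAt_periodicExt (Nat.pos_of_ne_zero hM0)
      (norm_jacobiCoef_le _ _) (jacobiCoef_one_periodic hM) ?_) hd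
    rw [sub_re, h2w, one_re]; linarith
  · have hQ : n.natAbs * M ≠ 0 := mul_ne_zero (Int.natAbs_ne_zero.2 hn) hM0
    exact ((differentiableAt_LSeries_smoothCoef n hM hQ hw).mul (hZ _)).mul
      (differentiableAt_periodicExt (Nat.pos_of_ne_zero hQ) (norm_jacobiCoef_le _ _)
        (jacobiCoef_natAbs_mul_periodic n hM) (by linarith))

/-- The continuations grow at most polynomially in `n`, locally uniformly in `w`. -/
lemma exists_norm_coefExt_le {M : ℕ} (hM : 4 ∣ M) (hM0 : M ≠ 0) {δ : ℝ} (hδ : 0 < δ) (R : ℝ) :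
    ∃ (C : ℝ) (k : ℕ), 0 ≤ C ∧ ∀ (n : ℤ) (w : ℂ), 1 / 2 + δ ≤ w.re → ‖w‖ ≤ R →
      ‖coefExt n M w‖ ≤ C * (1 + |(n : ℝ)|) ^ k := by
  obtain ⟨k, hk⟩ := exists_norm_LSeries_smoothCoef_le hM hδ
  obtain ⟨Z, hZ0, hZ⟩ := exists_norm_zetaInv_le (δ := 2 * δ) (by linarith)
  -- a common bound for the periodic part, at `w` and at `2 w - 1`
  set R' : ℝ := 2 * |R| + 1 with hR'
  have hR'0 : 0 ≤ R' := by positivity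
  set P : ℝ := R' + (R' + 1) * R' * 4 / (2 * min δ (1 / 2)) with hP
  have hmin : 0 < min δ (1 / 2) := lt_min hδ (by norm_num)
  have hP0 : 0 ≤ P := by positivity
  have hper : ∀ {f : ℕ → ℂ} {q : ℕ}, 0 < q → (∀ b, ‖f b‖ ≤ 1) → (∀ b, f (q + b) = f b) →
      ∀ w : ℂ, 2 * min δ (1 / 2) ≤ w.re ∨ 1 / 2 + δ ≤ w.re → ‖w‖ ≤ R' →
      ‖periodicExt f q w‖ ≤ P * q := by
    intro f q hq hf hp w hw hwR
    have hw' : min δ (1 / 2) * 1 ≤ w.re := by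
      rcases hw with hw | hw
      · linarith
      · linarith [min_le_left δ (1 / 2)]
    have hw2 : 2 * min δ (1 / 2) ≤ w.re := by
      rcases hw with hw | hw
      · exact hw
      · linarith [min_le_left δ (1 / 2), min_le_right δ (1 / 2)]
    refine (norm_periodicExt_le hq hf hp (by linarith)).trans ?_
    rw [hP]
    gcongr
  refine ⟨Real.sqrt 2 * (M : ℝ) ^ k * Z * (P * M), k + 1, by positivity, fun n w hw hwR => ?_⟩
  have h2w : (2 * w).re = 2 * w.re := by simp
  have hZw : ∀ Q : ℕ, ‖zetaInv Q (2 * w)‖ ≤ Z := fun Q => hZ Q _ (by rw [h2w]; linarith)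
  have hwR' : ‖w‖ ≤ R' := by
    have := le_abs_self R
    have := abs_nonneg R
    linarith
  have hn1 : (1 : ℝ) ≤ 1 + |(n : ℝ)| := by linarith [abs_nonneg (n : ℝ)]
  unfold coefExt
  split_ifs with hn
  · have h1 := hper (Nat.pos_of_ne_zero hM0) (norm_jacobiCoef_le 1 M) (jacobiCoef_one_periodic hM)
      (2 * w - 1) (Or.inl (by rw [sub_re, h2w, one_re]; linarith [min_le_left δ (1 / 2)])) (by
        refine (norm_sub_le _ _).trans ?_
        rw [norm_mul, norm_one, RCLike.norm_ofNat]
        linarith [le_abs_self R])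
    have h2 := hk 0 M hM0 w hw
    have h3 : ‖(2⁻¹ : ℂ) * periodicExt (jacobiCoef 1 M) M (2 * w - 1)‖ ≤ P * M := by
      rw [norm_mul, norm_inv, RCLike.norm_ofNat]
      linarith [norm_nonneg (periodicExt (jacobiCoef 1 M) M (2 * w - 1))]
    calc _ ≤ Real.sqrt 2 * (M : ℝ) ^ k * Z * (P * M) := by
          rw [norm_mul, norm_mul]
          gcongr
          exact hZw M
      _ ≤ _ := le_mul_of_one_le_right (by positivity) (one_le_pow₀ hn1)
  · have hQ : n.natAbs * M ≠ 0 := mul_ne_zero (Int.natAbs_ne_zero.2 hn) hM0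
    have h1 := hper (Nat.pos_of_ne_zero hQ) (norm_jacobiCoef_le n _)
      (jacobiCoef_natAbs_mul_periodic n hM) w (Or.inr hw) hwR'
    have h2 := hk n _ hQ w hw
    have hcast : ((n.natAbs * M : ℕ) : ℝ) = |(n : ℝ)| * M := by
      push_cast; rw [Nat.cast_natAbs]; push_cast; rfl
    rw [hcast] at h1 h2
    calc _ ≤ Real.sqrt 2 * (|(n : ℝ)| * M) ^ k * Z * (P * (|(n : ℝ)| * M)) := by
          rw [norm_mul, norm_mul]
          gcongr
          exact hZw _
      _ = Real.sqrt 2 * (M : ℝ) ^ k * Z * (P * M) * |(n : ℝ)| ^ (k + 1) := by ring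
      _ ≤ _ := by gcongr; linarith

/-! ### The value at `w = 1` -/

/-- The local factor at `p ∣ M` of the value at `w = 1`, for a square `n = m²`: with `β` the
exponent of `p` in `M`, it is `p^{-⌈β/2⌉}` if `p^{⌊β/2⌋} ∣ m` (for `p = 2`, if `2^{⌊β/2⌋-1} ∣ m`), and zero
otherwise. -/
noncomputable def localValue (M : ℕ) (m : ℤ) (p : ℕ) : ℂ :=
  if (p : ℤ) ^ (M.factorization p / 2 - if p = 2 then 1 else 0) ∣ m then
    ((p : ℂ) ^ ((M.factorization p + 1) / 2))⁻¹ else 0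

lemma hasSum_localTerm_of_dvd {M : ℕ} (hM : 4 ∣ M) (hM0 : M ≠ 0) (m : ℤ) {p : ℕ}
    (hp : p ∈ M.primeFactors) :
    HasSum (fun k => localTerm m p (k + M.factorization p)) (localValue M m p) := by
  have hpp := Nat.prime_of_mem_primeFactors hp
  unfold localValue
  by_cases hp2 : p = 2
  · subst hp2
    have h2 : 2 ≤ M.factorization 2 :=
      (Nat.prime_two.pow_dvd_iff_le_factorization hM0).1 (by simpa using hM)
    obtain ⟨β, hβ⟩ := Nat.exists_eq_add_of_le' h2
    have := hasSum_localTerm_two β m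
    rw [hβ]
    have e1 : (β + 2) / 2 - 1 = β / 2 := by omega
    have e2 : (β + 2 + 1) / 2 = (β + 3) / 2 := by omega
    simpa [e1, e2] using this
  · have h1 : 1 ≤ M.factorization p :=
      (hpp.dvd_iff_one_le_factorization hM0).1 (Nat.dvd_of_mem_primeFactors hp)
    obtain ⟨β, hβ⟩ := Nat.exists_eq_add_of_le' h1
    have := hasSum_localTerm_odd hpp hp2 β m
    rw [hβ]
    rw [if_neg hp2, Nat.sub_zero]
    exact this

lemma hasSum_localTerm_of_not_dvd {M : ℕ} (m : ℤ) {p : ℕ} (hp : p.Prime) (hpM : ¬ p ∣ M) :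
    HasSum (fun k => localTerm m p (k + M.factorization p)) (1 + (p : ℂ)⁻¹) := by
  rw [Nat.factorization_eq_zero_of_not_dvd hpM, ← localTerm_zero m p]
  exact hasSum_localTerm_prev (hasSum_localTerm_one hp m)

/-- The value at `w = 1` of the smooth part, times the mean of the trivial character and the inverse
zeta function; the primes of `Q` not dividing `M` cancel. -/
lemma LSeries_smoothCoef_one_mul (m : ℤ) {M Q : ℕ} (hM : 4 ∣ M) (hMQ : M ∣ Q) (hQ : Q ≠ 0) :
    LSeries (smoothCoef (m ^ 2) Q M) 1 * zetaInv Q 2 * ∏ p ∈ Q.primeFactors, (1 - (p : ℂ)⁻¹) =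
      (∏ p ∈ M.primeFactors, localValue M m p * (1 - (p : ℂ)⁻¹)) * (zetaCoprime M 2)⁻¹ := by
  have hM0 : M ≠ 0 := by rintro rfl; exact hQ (Nat.eq_zero_of_zero_dvd hMQ)
  have hsub := Nat.primeFactors_mono hMQ hQ
  have hS := LSeries_smoothCoef_one m (S := fun p => if p ∈ M.primeFactors then localValue M m p
    else 1 + (p : ℂ)⁻¹) hM0 hMQ hQ (fun p hp => by
      split_ifs with h
      · exact hasSum_localTerm_of_dvd hM hM0 m h
      · exact hasSum_localTerm_of_not_dvd m (Nat.prime_of_mem_primeFactors hp) fun hd =>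
          h (Nat.mem_primeFactors.2 ⟨Nat.prime_of_mem_primeFactors hp, hd, hM0⟩))
  have hZ : zetaInv Q 2 = (zetaCoprime Q 2)⁻¹ :=
    eq_inv_of_mul_eq_one_right (zetaCoprime_mul_zetaInv Q (by norm_num))
  rw [hS, hZ, zetaCoprime_two_eq Q hQ, zetaCoprime_two_eq M hM0, mul_inv, mul_inv]
  rw [← Finset.prod_sdiff hsub, ← Finset.prod_sdiff hsub, ← Finset.prod_sdiff hsub,
    Finset.prod_mul_distrib]
  have e1 : ∏ p ∈ M.primeFactors, (if p ∈ M.primeFactors then localValue M m p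
      else 1 + (p : ℂ)⁻¹) = ∏ p ∈ M.primeFactors, localValue M m p :=
    Finset.prod_congr rfl fun p hp => if_pos hp
  have e2 : ∏ p ∈ Q.primeFactors \ M.primeFactors, (if p ∈ M.primeFactors then localValue M m p
      else 1 + (p : ℂ)⁻¹) = ∏ p ∈ Q.primeFactors \ M.primeFactors, (1 + (p : ℂ)⁻¹) :=
    Finset.prod_congr rfl fun p hp => if_neg (Finset.mem_sdiff.1 hp).2
  have e3 : (∏ p ∈ Q.primeFactors \ M.primeFactors, (1 + (p : ℂ)⁻¹)) *
      ∏ p ∈ Q.primeFactors \ M.primeFactors, (1 - (p : ℂ)⁻¹) =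
      ∏ p ∈ Q.primeFactors \ M.primeFactors, (1 - ((p : ℂ) ^ 2)⁻¹) := by
    rw [← Finset.prod_mul_distrib]
    refine Finset.prod_congr rfl fun p _ => ?_
    rw [← inv_pow]; ring
  have hne : ∏ p ∈ Q.primeFactors \ M.primeFactors, (1 - ((p : ℂ) ^ 2)⁻¹) ≠ 0 := by
    refine Finset.prod_ne_zero_iff.2 fun p hp => ?_
    have hp' := (Nat.prime_of_mem_primeFactors (Finset.mem_sdiff.1 hp).1).one_lt
    rw [sub_ne_zero]
    intro h
    have h1 : (p : ℂ) ^ 2 = 1 := by rw [← inv_inv ((p : ℂ) ^ 2), ← h, inv_one]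
    have h2 : p ^ 2 = 1 := by exact_mod_cast h1
    nlinarith
  rw [e1, e2, mul_inv]
  rw [← e3] at hne ⊢
  generalize ∏ p ∈ Q.primeFactors \ M.primeFactors, (1 + (p : ℂ)⁻¹) = a at hne ⊢
  generalize ∏ p ∈ Q.primeFactors \ M.primeFactors, (1 - (p : ℂ)⁻¹) = b at hne ⊢
  generalize (∏ p ∈ M.primeFactors, (1 - ((p : ℂ) ^ 2)⁻¹))⁻¹ = c
  generalize ∏ p ∈ M.primeFactors, localValue M m p = d
  generalize ∏ p ∈ M.primeFactors, (1 - (p : ℂ)⁻¹) = e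
  linear_combination (d * c * (riemannZeta 2)⁻¹ * e) * mul_inv_cancel₀ hne

lemma coefExt_one_of_sq {m : ℤ} (hm : m ≠ 0) {M : ℕ} (hM : 4 ∣ M) (hM0 : M ≠ 0) :
    coefExt (m ^ 2) M 1 =
      (∏ p ∈ M.primeFactors, localValue M m p * (1 - (p : ℂ)⁻¹)) * (zetaCoprime M 2)⁻¹ := by
  have hn : m ^ 2 ≠ 0 := pow_ne_zero 2 hm
  have hQ : (m ^ 2).natAbs * M ≠ 0 := mul_ne_zero (Int.natAbs_ne_zero.2 hn) hM0
  rw [coefExt, if_neg hn, periodicExt_one, mul_one,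
    periodMean_jacobiCoef_sq m hQ fun p _ hp => by
      refine dvd_mul_of_dvd_left (Int.natCast_dvd.1 (hp.trans ?_)) M
      exact dvd_pow_self m (by norm_num)]
  exact LSeries_smoothCoef_one_mul m hM (dvd_mul_left _ _) hQ

/-- Compared with the nonzero squares, the value at `n = 0` is halved, because the pole comes from
a zeta function at `2 w - 1`. -/
lemma coefExt_zero_one {M : ℕ} (hM : 4 ∣ M) (hM0 : M ≠ 0) :
    coefExt 0 M 1 =
      2⁻¹ * ((∏ p ∈ M.primeFactors, localValue M 0 p * (1 - (p : ℂ)⁻¹)) * (zetaCoprime M 2)⁻¹) := by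
  rw [coefExt, if_pos rfl, mul_one, show (2 : ℂ) - 1 = 1 by norm_num, periodicExt_one]
  have h := periodMean_jacobiCoef_sq 1 hM0 fun p hp h1 => by
    have : p ∣ 1 := by exact_mod_cast h1
    exact absurd (Nat.dvd_one.1 this) hp.ne_one
  rw [one_pow] at h
  rw [h, ← LSeries_smoothCoef_one_mul 0 hM dvd_rfl hM0, show (0 : ℤ) ^ 2 = 0 by norm_num]
  ring

/-- For `n` not a square the Dirichlet series has no pole at `w = 1`. -/
lemma coefExt_one_of_not_sq {n : ℤ} (hn : ∀ m : ℤ, n ≠ m ^ 2) {M : ℕ} (hM : 4 ∣ M) (hM0 : M ≠ 0) :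
    coefExt n M 1 = 0 := by
  have hn0 : n ≠ 0 := by rintro rfl; exact hn 0 (by norm_num)
  have hQ : n.natAbs * M ≠ 0 := mul_ne_zero (Int.natAbs_ne_zero.2 hn0) hM0
  obtain ⟨b, hb, hJ⟩ := exists_jacobiSym_eq_neg_one hn0 hn hQ
  rw [coefExt, if_neg hn0, periodicExt_one, periodMean_jacobiCoef_eq_zero n hQ
    (((Dvd.intro 2 rfl : 2 ∣ 4).trans hM).trans (dvd_mul_left _ _))
    (by rw [mul_comm]; exact Nat.mul_dvd_mul_left _ hM) hb hJ, mul_zero]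

/-! ### The archimedean factor and its Fourier transform -/

/-- The function `x ↦ z^{-a} \bar z^{-b}` on the horizontal line `z = x + i y`. -/
noncomputable def barPow (a b : ℂ) (y x : ℝ) : ℂ :=
  ((x : ℂ) + y * I) ^ (-a) * ((x : ℂ) - y * I) ^ (-b)

lemma add_mul_I_ne_zero {y : ℝ} (hy : 0 < y) (x : ℝ) : (x : ℂ) + y * I ≠ 0 := by
  intro h
  have := congrArg Complex.im h
  simp at this
  exact hy.ne' this

lemma sub_mul_I_eq_conj (x y : ℝ) : (x : ℂ) - y * I = (starRingEnd ℂ) ((x : ℂ) + y * I) := by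
  simp [sub_eq_add_neg]

lemma arg_add_mul_I_ne_pi {y : ℝ} (hy : 0 < y) (x : ℝ) : arg ((x : ℂ) + y * I) ≠ Real.pi := by
  intro h
  have := (arg_eq_pi_iff.1 h).2
  simp at this
  exact hy.ne' this

/-- Since `a` and `b` have the same imaginary part, the contributions of the argument cancel. -/
lemma norm_barPow {a b : ℂ} (hab : a.im = b.im) {y : ℝ} (hy : 0 < y) (x : ℝ) :
    ‖barPow a b y x‖ = ‖(x : ℂ) + y * I‖ ^ (-(a + b).re) := by
  have h0 := add_mul_I_ne_zero hy x
  have h0' : (starRingEnd ℂ) ((x : ℂ) + y * I) ≠ 0 := (map_ne_zero _).2 h0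
  have hn : 0 < ‖(x : ℂ) + y * I‖ := norm_pos_iff.2 h0
  rw [barPow, norm_mul, sub_mul_I_eq_conj, norm_cpow_of_ne_zero h0, norm_cpow_of_ne_zero h0',
    RCLike.norm_conj, arg_conj, if_neg (arg_add_mul_I_ne_pi hy x), neg_im, neg_im, hab,
    div_mul_div_comm, ← Real.rpow_add hn, ← Real.exp_add,
    show arg (↑x + ↑y * I) * -b.im + -arg (↑x + ↑y * I) * -b.im = 0 by ring, Real.exp_zero,
    div_one]
  congr 1
  simp
  ring

lemma norm_add_mul_I {y : ℝ} (hy : 0 < y) (x : ℝ) :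
    ‖(x : ℂ) + y * I‖ = y * (1 + ‖x / y‖ ^ 2) ^ (1 / 2 : ℝ) := by
  rw [Complex.norm_add_mul_I, ← Real.sqrt_eq_rpow, Real.norm_eq_abs, sq_abs,
    show x ^ 2 + y ^ 2 = y ^ 2 * (1 + (x / y) ^ 2) by field_simp; ring,
    Real.sqrt_mul (by positivity), Real.sqrt_sq hy.le]

/-- The integrable function dominating `barPow`. -/
noncomputable def bracket (δ y x : ℝ) : ℝ := (1 + ‖x / y‖ ^ 2) ^ (-(1 + δ) / 2)

lemma integrable_bracket {δ y : ℝ} (hδ : 0 < δ) (hy : 0 < y) :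
    MeasureTheory.Integrable (bracket δ y) := by
  have h := integrable_rpow_neg_one_add_norm_sq (E := ℝ) (μ := MeasureTheory.volume)
    (r := 1 + δ) (by simpa using hδ)
  exact h.comp_div hy.ne'

lemma norm_barPow_le {a b : ℂ} (hab : a.im = b.im) {y : ℝ} (hy : 0 < y) {δ R : ℝ} (hδ : 0 < δ)
    (h1 : 1 + δ ≤ (a + b).re) (h2 : (a + b).re ≤ R) (x : ℝ) :
    ‖barPow a b y x‖ ≤ (max 1 y⁻¹) ^ R * bracket δ y x := by
  have hb : (1 : ℝ) ≤ 1 + ‖x / y‖ ^ 2 := by linarith [sq_nonneg ‖x / y‖]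
  rw [norm_barPow hab hy, norm_add_mul_I hy, Real.mul_rpow hy.le (by positivity),
    ← Real.rpow_mul (by linarith), bracket]
  refine mul_le_mul ?_ (Real.rpow_le_rpow_of_exponent_le hb (by linarith)) (by positivity)
    (by positivity)
  rw [Real.rpow_neg hy.le, ← Real.inv_rpow hy.le]
  calc y⁻¹ ^ (a + b).re ≤ (max 1 y⁻¹) ^ (a + b).re :=
        Real.rpow_le_rpow (by positivity) (le_max_right _ _) (by linarith)
    _ ≤ _ := Real.rpow_le_rpow_of_exponent_le (le_max_left _ _) h2

lemma hasDerivAt_barPow (a b : ℂ) {y : ℝ} (hy : 0 < y) (x : ℝ) :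
    HasDerivAt (barPow a b y) (-a * barPow (a + 1) b y x + -b * barPow a (b + 1) y x) x := by
  have h1 : HasDerivAt (fun x : ℝ => ((x : ℂ) + y * I) ^ (-a))
      (-a * ((x : ℂ) + y * I) ^ (-a - 1) * 1) x :=
    (((hasDerivAt_id (x : ℂ)).add_const ((y : ℂ) * I)).cpow_const
      (by right; simpa using hy.ne')).comp_ofReal
  have h2 : HasDerivAt (fun x : ℝ => ((x : ℂ) - y * I) ^ (-b))
      (-b * ((x : ℂ) - y * I) ^ (-b - 1) * 1) x :=
    (((hasDerivAt_id (x : ℂ)).sub_const ((y : ℂ) * I)).cpow_const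
      (by right; simpa using hy.ne')).comp_ofReal
  refine (h1.mul h2).congr_deriv ?_
  simp only [barPow]
  rw [show -(a + 1) = -a - 1 by ring, show -(b + 1) = -b - 1 by ring]
  ring

lemma continuous_barPow (a b : ℂ) {y : ℝ} (hy : 0 < y) : Continuous (barPow a b y) :=
  continuous_iff_continuousAt.2 fun x => (hasDerivAt_barPow a b hy x).continuousAt

lemma integrable_barPow {a b : ℂ} (hab : a.im = b.im) {y : ℝ} (hy : 0 < y)
    (h1 : 1 < (a + b).re) : MeasureTheory.Integrable (barPow a b y) := by
  refine ((integrable_bracket (δ := (a + b).re - 1) (by linarith) hy).const_mul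
    ((max 1 y⁻¹) ^ (a + b).re)).mono' (continuous_barPow a b hy).aestronglyMeasurable
    (Eventually.of_forall fun x => ?_)
  exact norm_barPow_le hab hy (by linarith) (by linarith) le_rfl x

open FourierTransform in
/-- Integrating by parts, the Fourier transform of `barPow` decays faster than any power, uniformly
in the exponents. -/
lemma exists_pow_mul_norm_fourier_barPow_le {y : ℝ} (hy : 0 < y) {δ : ℝ} (hδ : 0 < δ) (N : ℕ) :
    ∀ R : ℝ, ∃ C : ℝ, 0 ≤ C ∧ ∀ a b : ℂ, a.im = b.im → 1 + δ ≤ (a + b).re → ‖a‖ ≤ R → ‖b‖ ≤ R →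
      ∀ ξ : ℝ, |ξ| ^ N * ‖𝓕 (barPow a b y) ξ‖ ≤ C := by
  induction N with
  | zero =>
    intro R
    refine ⟨(max 1 y⁻¹) ^ (2 * R) * ∫ x, bracket δ y x, ?_, fun a b hab h1 ha hb ξ => ?_⟩
    · exact mul_nonneg (by positivity)
        (MeasureTheory.integral_nonneg fun x => by unfold bracket; positivity)
    · rw [pow_zero, one_mul, ← MeasureTheory.integral_const_mul]
      refine (VectorFourier.norm_fourierIntegral_le_integral_norm _ _ _ _ _).trans ?_
      refine MeasureTheory.integral_mono_of_nonneg (Eventually.of_forall fun x => norm_nonneg _)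
        ((integrable_bracket hδ hy).const_mul _) (Eventually.of_forall fun x => ?_)
      refine norm_barPow_le hab hy hδ h1 ?_ x
      rw [add_re]
      linarith [(re_le_norm a).trans ha, (re_le_norm b).trans hb]
  | succ N ih =>
    intro R
    obtain ⟨C, hC0, hC⟩ := ih (|R| + 1)
    refine ⟨|R| * C + |R| * C, by positivity, fun a b hab h1 ha hb ξ => ?_⟩
    have hR := le_abs_self R
    have hi1 : MeasureTheory.Integrable (barPow (a + 1) b y) :=
      integrable_barPow (by simpa using hab) hy (by simp at h1 ⊢; linarith)
    have hi2 : MeasureTheory.Integrable (barPow a (b + 1) y) :=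
      integrable_barPow (by simpa using hab) hy (by simp at h1 ⊢; linarith)
    have hder : deriv (barPow a b y) = (-a) • barPow (a + 1) b y + (-b) • barPow a (b + 1) y := by
      funext x
      simpa using (hasDerivAt_barPow a b hy x).deriv
    have hF := congrFun (Real.fourier_deriv (integrable_barPow hab hy (by linarith))
      (fun x => (hasDerivAt_barPow a b hy x).differentiableAt)
      (by rw [hder]; exact (hi1.smul _).add (hi2.smul _))) ξ
    have hadd : 𝓕 ((-a) • barPow (a + 1) b y + (-b) • barPow a (b + 1) y) ξ =
        -a * 𝓕 (barPow (a + 1) b y) ξ + -b * 𝓕 (barPow a (b + 1) y) ξ := by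
      have hi : ∀ {g : ℝ → ℂ}, MeasureTheory.Integrable g → MeasureTheory.Integrable
          fun x : ℝ => Real.fourierChar (-(x * ξ)) • g x := fun hg => by
        simpa [mul_comm] using
          (Real.fourierIntegral_convergent_iff (μ := MeasureTheory.volume) ξ).2 hg
      simp only [Real.fourier_real_eq, Pi.add_apply, smul_add]
      rw [MeasureTheory.integral_add (hi (hi1.smul (-a))) (hi (hi2.smul (-b)))]
      simp only [Pi.smul_apply, smul_comm (Real.fourierChar _) _ (_ : ℂ)]
      rw [MeasureTheory.integral_smul, MeasureTheory.integral_smul, smul_eq_mul, smul_eq_mul]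
    rw [hder, hadd] at hF
    have hb1 := hC (a + 1) b (by simpa using hab) (by simp at h1 ⊢; linarith)
      ((norm_add_le _ _).trans (by rw [norm_one]; linarith)) (by linarith) ξ
    have hb2 := hC a (b + 1) (by simpa using hab) (by simp at h1 ⊢; linarith) (by linarith)
      ((norm_add_le _ _).trans (by rw [norm_one]; linarith)) ξ
    have hpi : (1 : ℝ) ≤ 2 * Real.pi := by linarith [Real.pi_gt_three]
    calc |ξ| ^ (N + 1) * ‖𝓕 (barPow a b y) ξ‖
        ≤ |ξ| ^ N * ((2 * Real.pi) * (|ξ| * ‖𝓕 (barPow a b y) ξ‖)) := by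
          rw [pow_succ, mul_assoc]
          refine mul_le_mul_of_nonneg_left ?_ (by positivity)
          exact le_mul_of_one_le_left (by positivity) hpi
      _ = |ξ| ^ N * ‖(2 * Real.pi * I * ξ) • 𝓕 (barPow a b y) ξ‖ := by
          rw [norm_smul]
          simp [abs_of_pos Real.pi_pos, mul_assoc]
      _ = |ξ| ^ N * ‖-a * 𝓕 (barPow (a + 1) b y) ξ + -b * 𝓕 (barPow a (b + 1) y) ξ‖ := by
          rw [← hF]
      _ ≤ |ξ| ^ N * (|R| * ‖𝓕 (barPow (a + 1) b y) ξ‖ + |R| * ‖𝓕 (barPow a (b + 1) y) ξ‖) := by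
          gcongr
          refine (norm_add_le _ _).trans ?_
          rw [norm_mul, norm_mul, norm_neg, norm_neg]
          gcongr
          · linarith
          · linarith
      _ = |R| * (|ξ| ^ N * ‖𝓕 (barPow (a + 1) b y) ξ‖) +
            |R| * (|ξ| ^ N * ‖𝓕 (barPow a (b + 1) y) ξ‖) := by ring
      _ ≤ _ := by gcongr

open FourierTransform in
lemma exists_norm_fourier_barPow_le {y : ℝ} (hy : 0 < y) {δ : ℝ} (hδ : 0 < δ) (N : ℕ) (R : ℝ) :
    ∃ C : ℝ, 0 ≤ C ∧ ∀ a b : ℂ, a.im = b.im → 1 + δ ≤ (a + b).re → ‖a‖ ≤ R → ‖b‖ ≤ R →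
      ∀ ξ : ℝ, ‖𝓕 (barPow a b y) ξ‖ ≤ C / (1 + |ξ|) ^ N := by
  obtain ⟨C₀, h0, hC₀⟩ := exists_pow_mul_norm_fourier_barPow_le hy hδ 0 R
  obtain ⟨C₁, h1, hC₁⟩ := exists_pow_mul_norm_fourier_barPow_le hy hδ N R
  refine ⟨2 ^ N * (C₀ + C₁), by positivity, fun a b hab hre ha hb ξ => ?_⟩
  have e0 := hC₀ a b hab hre ha hb ξ
  have e1 := hC₁ a b hab hre ha hb ξ
  rw [pow_zero, one_mul] at e0
  rw [le_div_iff₀ (by positivity)]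
  have hle : (1 + |ξ|) ^ N ≤ 2 ^ N * (1 + |ξ| ^ N) := by
    rcases le_total |ξ| 1 with h | h
    · calc (1 + |ξ|) ^ N ≤ 2 ^ N := by gcongr; linarith
        _ ≤ _ := le_mul_of_one_le_right (by positivity) (by linarith [pow_nonneg (abs_nonneg ξ) N])
    · calc (1 + |ξ|) ^ N ≤ (2 * |ξ|) ^ N := by gcongr; linarith
        _ = 2 ^ N * |ξ| ^ N := mul_pow _ _ _
        _ ≤ _ := by gcongr; linarith
  calc _ ≤ ‖𝓕 (barPow a b y) ξ‖ * (2 ^ N * (1 + |ξ| ^ N)) := by gcongr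
    _ = 2 ^ N * (‖𝓕 (barPow a b y) ξ‖ + |ξ| ^ N * ‖𝓕 (barPow a b y) ξ‖) := by ring
    _ ≤ _ := by gcongr

/-- The function `x ↦ e^{-(i/2) arg z} |z|^{-2s} = z^{-(s+1/4)} \bar z^{-(s-1/4)}` on the line
`z = x + i y`. -/
noncomputable def kernel (s : ℂ) (y : ℝ) : ℝ → ℂ := barPow (s + 1 / 4) (s - 1 / 4) y

lemma kernel_eq (s : ℂ) {y : ℝ} (hy : 0 < y) (x : ℝ) :
    kernel s y x = exp (-(I / 2 * (arg ((x : ℂ) + y * I) : ℂ))) *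
      (‖(x : ℂ) + y * I‖ : ℂ) ^ (-(2 * s)) := by
  have h0 := add_mul_I_ne_zero hy x
  have h0' : (starRingEnd ℂ) ((x : ℂ) + y * I) ≠ 0 := (map_ne_zero _).2 h0
  have hn : (‖(x : ℂ) + y * I‖ : ℂ) ≠ 0 := by exact_mod_cast norm_ne_zero_iff.2 h0
  rw [kernel, barPow, sub_mul_I_eq_conj, cpow_def_of_ne_zero h0, cpow_def_of_ne_zero h0',
    cpow_def_of_ne_zero hn, ← exp_add, ← exp_add, log_conj _ (arg_add_mul_I_ne_pi hy x),
    ← ofReal_log (norm_nonneg _)]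
  congr 1
  have hlog : Complex.log ((x : ℂ) + y * I) =
    (Real.log ‖(x : ℂ) + y * I‖ : ℂ) + (arg ((x : ℂ) + y * I) : ℂ) * I := rfl
  rw [hlog, map_add, map_mul, conj_I, conj_ofReal, conj_ofReal]
  ring

lemma kernel_add_re (s : ℂ) : ((s + 1 / 4) + (s - 1 / 4)).re = 2 * s.re := by
  rw [show (s + 1 / 4) + (s - 1 / 4) = 2 * s by ring]; simp

lemma kernel_im_eq (s : ℂ) : (s + 1 / 4).im = (s - 1 / 4).im := by
  rw [show s + 1 / 4 = s + ((1 / 4 : ℝ) : ℂ) by push_cast; ring,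
    show s - 1 / 4 = s - ((1 / 4 : ℝ) : ℂ) by push_cast; ring, add_im, sub_im, ofReal_im]
  ring

lemma norm_kernel (s : ℂ) {y : ℝ} (hy : 0 < y) (x : ℝ) :
    ‖kernel s y x‖ = ‖(x : ℂ) + y * I‖ ^ (-(2 * s.re)) := by
  rw [kernel, norm_barPow (kernel_im_eq s) hy, kernel_add_re]

lemma continuous_kernel (s : ℂ) {y : ℝ} (hy : 0 < y) : Continuous (kernel s y) :=
  continuous_barPow _ _ hy

lemma integrable_kernel {s : ℂ} {y : ℝ} (hy : 0 < y) (hs : 1 / 2 < s.re) :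
    MeasureTheory.Integrable (kernel s y) :=
  integrable_barPow (kernel_im_eq s) hy (by rw [kernel_add_re]; linarith)

open FourierTransform in
lemma exists_norm_fourier_kernel_le {y : ℝ} (hy : 0 < y) {δ : ℝ} (hδ : 0 < δ) (N : ℕ) (R : ℝ) :
    ∃ C : ℝ, 0 ≤ C ∧ ∀ s : ℂ, 1 / 2 + δ ≤ s.re → ‖s‖ ≤ R →
      ∀ ξ : ℝ, ‖𝓕 (kernel s y) ξ‖ ≤ C / (1 + |ξ|) ^ N := by
  obtain ⟨C, h0, hC⟩ := exists_norm_fourier_barPow_le hy (δ := 2 * δ) (by linarith) N (R + 1)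
  have h4 : ‖(1 / 4 : ℂ)‖ ≤ 1 := by norm_num
  refine ⟨C, h0, fun s hs hR ξ => hC _ _ (kernel_im_eq s) (by rw [kernel_add_re]; linarith)
    ((norm_add_le _ _).trans (by linarith)) ((norm_sub_le _ _).trans (by linarith)) ξ⟩

lemma differentiable_kernel {y : ℝ} (hy : 0 < y) (x : ℝ) :
    Differentiable ℂ fun s => kernel s y x := by
  intro s
  have h0 := add_mul_I_ne_zero hy x
  have h0' : (x : ℂ) - y * I ≠ 0 := by rw [sub_mul_I_eq_conj]; exact (map_ne_zero _).2 h0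
  unfold kernel barPow
  refine DifferentiableAt.mul ?_ ?_
  · exact DifferentiableAt.const_cpow (by fun_prop) (Or.inl h0)
  · exact DifferentiableAt.const_cpow (by fun_prop) (Or.inl h0')

lemma hasDerivAt_kernel {y : ℝ} (hy : 0 < y) (x : ℝ) (s : ℂ) :
    HasDerivAt (fun s => kernel s y x)
      (kernel s y x * (-(2 * (Real.log ‖(x : ℂ) + y * I‖ : ℂ)))) s := by
  have hn : (‖(x : ℂ) + y * I‖ : ℂ) ≠ 0 := by
    exact_mod_cast norm_ne_zero_iff.2 (add_mul_I_ne_zero hy x)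
  have h : HasDerivAt (fun s : ℂ => -(2 * s)) (-(2 * 1)) s :=
    ((hasDerivAt_id s).const_mul 2).neg
  have h1 := (h.const_cpow (c := (‖(x : ℂ) + y * I‖ : ℂ)) (Or.inl hn)).const_mul
    (exp (-(I / 2 * (arg ((x : ℂ) + y * I) : ℂ))))
  simp_rw [kernel_eq _ hy]
  refine h1.congr_deriv ?_
  rw [ofReal_log (norm_nonneg _)]
  ring

open FourierTransform in
lemma differentiableAt_fourier_kernel {y : ℝ} (hy : 0 < y) (ξ : ℝ) {s : ℂ} (hs : 1 / 2 < s.re) :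
    DifferentiableAt ℂ (fun s => 𝓕 (kernel s y) ξ) s := by
  set δ : ℝ := (s.re - 1 / 2) / 3 with hδ
  have hδ0 : 0 < δ := by rw [hδ]; linarith
  set R : ℝ := 2 * (s.re + 2 * δ) with hR
  -- the integrand is bounded uniformly near `s`, and so is its derivative, by Cauchy's estimate
  have hb : ∀ s' ∈ Metric.closedBall s (2 * δ), ∀ x,
      ‖kernel s' y x‖ ≤ (max 1 y⁻¹) ^ R * bracket δ y x := by
    intro s' hs' x
    have hre : |s'.re - s.re| ≤ 2 * δ := by
      rw [← sub_re]
      exact (abs_re_le_norm _).trans (by simpa [dist_eq_norm] using hs')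
    obtain ⟨h1, h2⟩ := abs_le.1 hre
    refine norm_barPow_le (kernel_im_eq s') hy hδ0 ?_ ?_ x
    · rw [kernel_add_re]; linarith
    · rw [kernel_add_re]; linarith
  have hbd : ∀ s' ∈ Metric.ball s δ, ∀ x,
      ‖deriv (fun s => kernel s y x) s'‖ ≤ (max 1 y⁻¹) ^ R * bracket δ y x / δ := by
    intro s' hs' x
    refine norm_deriv_le_of_forall_mem_sphere_norm_le hδ0
      (differentiable_kernel hy x).diffContOnCl fun z hz => hb z ?_ x
    have h1 : dist z s' = δ := hz
    have h2 : dist s' s < δ := hs'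
    have := dist_triangle z s' s
    exact Metric.mem_closedBall.2 (by linarith)
  have hF : ∀ s' x, ‖Real.fourierChar (-(x * ξ)) • kernel s' y x‖ = ‖kernel s' y x‖ := fun s' x =>
    Circle.norm_smul _ _
  have hmeas : ∀ s', MeasureTheory.AEStronglyMeasurable
      (fun x => Real.fourierChar (-(x * ξ)) • kernel s' y x) MeasureTheory.volume := fun s' =>
    (by
      have := continuous_kernel s' hy
      have h2 : Continuous fun x : ℝ => (Real.fourierChar (-(x * ξ)) : ℂ) := by fun_prop
      exact (h2.mul this).aestronglyMeasurable)
  have key := hasDerivAt_integral_of_dominated_loc_of_deriv_le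
    (μ := MeasureTheory.volume) (F := fun s' x => Real.fourierChar (-(x * ξ)) • kernel s' y x)
    (F' := fun s' x => Real.fourierChar (-(x * ξ)) • deriv (fun s => kernel s y x) s')
    (bound := fun x => (max 1 y⁻¹) ^ R * bracket δ y x / δ) (x₀ := s)
    (Metric.ball_mem_nhds s hδ0) (Eventually.of_forall hmeas)
    ((integrable_kernel hy hs).mono (hmeas s) (Eventually.of_forall fun x => (hF s x).le))
    ?_ (Eventually.of_forall fun x s' hs' => (Circle.norm_smul _ _).trans_le (hbd s' hs' x))
    (((integrable_bracket hδ0 hy).const_mul _).div_const _)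
    (Eventually.of_forall fun x s' hs' =>
      ((differentiable_kernel hy x s').hasDerivAt.const_smul (Real.fourierChar (-(x * ξ)))))
  · have heq : (fun s => 𝓕 (kernel s y) ξ) =
        fun s' => ∫ x, Real.fourierChar (-(x * ξ)) • kernel s' y x := by
      funext s'
      rw [Real.fourier_real_eq]
    rw [heq]
    exact key.2.differentiableAt
  · have h1 : (fun x => deriv (fun s => kernel s y x) s) =
        fun x => kernel s y x * (-(2 * (Real.log ‖(x : ℂ) + y * I‖ : ℂ))) :=
      funext fun x => (hasDerivAt_kernel hy x s).deriv
    have h2 : Continuous fun x => deriv (fun s => kernel s y x) s := by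
      rw [h1]
      refine (continuous_kernel s hy).mul (continuous_const.mul ?_).neg
      refine continuous_ofReal.comp (Continuous.log (by fun_prop) fun x => ?_)
      exact norm_ne_zero_iff.2 (add_mul_I_ne_zero hy x)
    have h3 : Continuous fun x : ℝ => (Real.fourierChar (-(x * ξ)) : ℂ) := by fun_prop
    exact (h3.mul h2).aestronglyMeasurable

lemma summable_inv_one_add_abs_sq : Summable fun n : ℤ => ((1 + |(n : ℝ)|) ^ 2)⁻¹ := by
  have h : Summable fun n : ℕ => ((1 + (n : ℝ)) ^ 2)⁻¹ := by
    have := (summable_nat_add_iff 1).2 (Real.summable_nat_pow_inv.2 (by norm_num : 1 < 2))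
    refine this.congr fun n => ?_
    push_cast
    rw [add_comm]
  refine Summable.of_nat_of_neg ?_ ?_ <;> simpa using h

open FourierTransform in
/-- Poisson summation for the kernel. -/
lemma tsum_kernel_eq {s : ℂ} {y : ℝ} (hy : 0 < y) (hs : 1 / 2 < s.re) (x : ℝ) :
    ∑' k : ℤ, kernel s y (x + k) =
      ∑' n : ℤ, 𝓕 (kernel s y) n * exp (2 * Real.pi * I * n * x) := by
  obtain ⟨C, h0, hC⟩ := exists_norm_fourier_kernel_le hy (δ := s.re - 1 / 2) (by linarith) 2 ‖s‖
  have hsum : Summable fun n : ℤ => 𝓕 (kernel s y) n := by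
    refine Summable.of_norm_bounded (summable_inv_one_add_abs_sq.mul_left C) fun n => ?_
    rw [← div_eq_mul_inv]
    exact hC s (by linarith) le_rfl n
  have h := Real.tsum_eq_tsum_fourier_of_rpow_decay_of_summable (continuous_kernel s hy)
    (b := 2 * s.re) (by linarith) ?_ hsum x
  · rw [h]
    refine tsum_congr fun n => ?_
    rw [fourier_coe_apply]
    congr 2
    simp
  · refine Asymptotics.IsBigO.of_bound 1 ?_
    have : ∀ᶠ x : ℝ in cocompact ℝ, 1 ≤ |x| := by
      simpa using (tendsto_norm_cocompact_atTop (E := ℝ)).eventually (eventually_ge_atTop 1)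
    filter_upwards [this] with x hx
    rw [norm_kernel s hy, one_mul, Real.norm_of_nonneg (by positivity),
      Real.rpow_neg (norm_nonneg _), Real.rpow_neg (abs_nonneg _)]
    refine inv_anti₀ (Real.rpow_pos_of_pos (by linarith) _) (Real.rpow_le_rpow (abs_nonneg _) ?_
      (by linarith))
    have := abs_re_le_norm ((x : ℂ) + y * I)
    simpa using this

/-! ### The Fourier transform of the kernel at `s = 3/4` -/

/-- Closing the contour in the lower half-plane. -/
lemma integral_eq_zero_of_differentiableOn_lower {G : ℂ → ℂ} {y : ℝ} (hy : 0 < y)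
    (hd : DifferentiableOn ℂ G {w | w.im < y}) (hi : MeasureTheory.Integrable fun x : ℝ => G x)
    {C R₀ : ℝ} (hb : ∀ w : ℂ, w.im ≤ 0 → R₀ ≤ ‖w‖ → ‖G w‖ ≤ C * ‖w‖ ^ (-(3 / 2) : ℝ)) :
    ∫ x : ℝ, G x = 0 := by
  have hC : ∀ w : ℂ, w.im ≤ 0 → R₀ ≤ ‖w‖ → ‖G w‖ ≤ |C| * ‖w‖ ^ (-(3 / 2) : ℝ) := fun w h1 h2 =>
    (hb w h1 h2).trans (by gcongr; exact le_abs_self C)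
  have h1 : Tendsto (fun R : ℝ => ∫ x in (-R)..R, G x) atTop (𝓝 (∫ x : ℝ, G x)) :=
    MeasureTheory.intervalIntegral_tendsto_integral hi tendsto_neg_atTop_atBot tendsto_id
  refine tendsto_nhds_unique h1 ?_
  have hlim : Tendsto (fun R : ℝ => 4 * |C| * R ^ (-(1 / 2) : ℝ)) atTop (𝓝 0) := by
    simpa using (tendsto_rpow_neg_atTop (by norm_num : (0 : ℝ) < 1 / 2)).const_mul (4 * |C|)
  refine squeeze_zero_norm' ?_ hlim
  filter_upwards [eventually_ge_atTop R₀, eventually_gt_atTop 0] with R hR hR0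
  have hrect := integral_boundary_rect_eq_zero_of_differentiableOn G (⟨-R, -R⟩ : ℂ) (⟨R, 0⟩ : ℂ)
    (hd.mono fun w hw => by
      have := (mem_reProdIm.1 hw).2
      simp only [Set.uIcc_of_le (by linarith : -R ≤ (0 : ℝ))] at this
      exact lt_of_le_of_lt this.2 hy)
  simp only [ofReal_zero, zero_mul, add_zero] at hrect
  have hbound : ∀ w : ℂ, w.im ≤ 0 → R ≤ ‖w‖ → ‖G w‖ ≤ |C| * R ^ (-(3 / 2) : ℝ) := fun w h1 h2 =>
    (hC w h1 (hR.trans h2)).trans (by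
      gcongr ?_ * ?_
      exact Real.rpow_le_rpow_of_nonpos hR0 h2 (by norm_num))
  have hbot : ‖∫ x in (-R)..R, G (x + (-R : ℝ) * I)‖ ≤ |C| * R ^ (-(3 / 2) : ℝ) * |R - -R| := by
    refine intervalIntegral.norm_integral_le_of_norm_le_const fun x _ =>
      hbound _ (by simp [hR0.le]) ?_
    have := abs_im_le_norm ((x : ℂ) + (-R : ℝ) * I)
    simpa [abs_of_pos hR0] using this
  have hright : ‖∫ t in (-R)..(0 : ℝ), G ((R : ℝ) + t * I)‖ ≤
      |C| * R ^ (-(3 / 2) : ℝ) * |0 - -R| := by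
    refine intervalIntegral.norm_integral_le_of_norm_le_const fun t ht => hbound _ ?_ ?_
    · rw [Set.uIoc_of_le (by linarith)] at ht
      simpa using ht.2
    · have := abs_re_le_norm (((R : ℝ) : ℂ) + t * I)
      simpa [abs_of_pos hR0] using this
  have hleft : ‖∫ t in (-R)..(0 : ℝ), G ((-R : ℝ) + t * I)‖ ≤
      |C| * R ^ (-(3 / 2) : ℝ) * |0 - -R| := by
    refine intervalIntegral.norm_integral_le_of_norm_le_const fun t ht => hbound _ ?_ ?_
    · rw [Set.uIoc_of_le (by linarith)] at ht
      simpa using ht.2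
    · have := abs_re_le_norm (((-R : ℝ) : ℂ) + t * I)
      simpa [abs_of_pos hR0] using this
  have heq : ∫ x in (-R)..R, G x = (∫ x in (-R)..R, G (x + (-R : ℝ) * I)) +
      I • (∫ t in (-R)..(0 : ℝ), G ((R : ℝ) + t * I)) -
      I • ∫ t in (-R)..(0 : ℝ), G ((-R : ℝ) + t * I) := by
    linear_combination (exp := 1) -hrect
  rw [heq]
  refine (norm_sub_le _ _).trans ((add_le_add (norm_add_le _ _) le_rfl).trans ?_)
  rw [norm_smul, norm_smul, norm_I, one_mul, one_mul]
  have e : R ^ (-(1 / 2) : ℝ) = R ^ (-(3 / 2) : ℝ) * R := by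
    rw [← Real.rpow_add_one hR0.ne']; norm_num
  have e1 : |R - -R| = 2 * R := by rw [abs_of_pos] <;> linarith
  have e2 : |0 - -R| = R := by rw [abs_of_pos] <;> linarith
  rw [e1] at hbot
  rw [e2] at hright hleft
  rw [e]
  linarith

lemma integral_inv_sq_add_sq {y : ℝ} (hy : 0 < y) : ∫ x : ℝ, (x ^ 2 + y ^ 2)⁻¹ = Real.pi / y := by
  have h := MeasureTheory.Measure.integral_comp_div (fun x : ℝ => (1 + x ^ 2)⁻¹) y
  rw [integral_univ_inv_one_add_sq, abs_of_pos hy, smul_eq_mul] at h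
  have : ∀ x : ℝ, (x ^ 2 + y ^ 2)⁻¹ = (y ^ 2)⁻¹ * (1 + (x / y) ^ 2)⁻¹ := fun x => by
    rw [← mul_inv]; congr 1; field_simp; ring
  simp_rw [this]
  rw [MeasureTheory.integral_const_mul, h]
  field_simp

lemma neg_two_mul_I_cpow {y : ℝ} (hy : 0 < y) :
    (-(2 * y * I) : ℂ) ^ (-(1 / 2) : ℂ) = (1 + I) / (2 * Real.sqrt y) := by
  have h1 : (-(2 * y * I) : ℂ) = ((2 * y : ℝ) : ℂ) * -I := by push_cast; ring
  have h2 : (-I : ℂ) ^ (-(1 / 2) : ℂ) = (1 + I) / Real.sqrt 2 := by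
    rw [cpow_def_of_ne_zero (by simp), log_neg_I,
      show -(Real.pi / 2 : ℂ) * I * -(1 / 2) = ((Real.pi / 4 : ℝ) : ℂ) * I by push_cast; ring,
      exp_mul_I, ← ofReal_cos, ← ofReal_sin, Real.cos_pi_div_four, Real.sin_pi_div_four]
    have h3 : (Real.sqrt 2 : ℂ) * Real.sqrt 2 = 2 := by
      rw [← ofReal_mul, Real.mul_self_sqrt (by norm_num)]; norm_num
    have h4 : (Real.sqrt 2 : ℂ) ≠ 0 := by
      exact_mod_cast (Real.sqrt_pos.2 (by norm_num : (0 : ℝ) < 2)).ne'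
    rw [eq_div_iff h4]
    push_cast
    linear_combination ((1 + I) / 2) * h3
  have h5 : ((2 * y : ℝ) : ℂ) ^ (-(1 / 2) : ℂ) = ((Real.sqrt 2 * Real.sqrt y : ℝ) : ℂ)⁻¹ := by
    rw [cpow_neg, ← Real.sqrt_mul (by norm_num), Real.sqrt_eq_rpow, ofReal_cpow (by positivity)]
    norm_num
  have h6 : (Real.sqrt 2 : ℂ) ^ 2 = 2 := by
    rw [← ofReal_pow, Real.sq_sqrt (by norm_num)]; norm_num
  have h7 : (Real.sqrt 2 : ℂ) ≠ 0 := by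
    exact_mod_cast (Real.sqrt_pos.2 (by norm_num : (0 : ℝ) < 2)).ne'
  have h8 : (Real.sqrt y : ℂ) ≠ 0 := by exact_mod_cast (Real.sqrt_pos.2 hy).ne'
  rw [h1, ofReal_mul_cpow (by positivity) (neg_ne_zero.2 I_ne_zero), h5, h2]
  push_cast
  field_simp
  linear_combination -(1 + I) * h6

open FourierTransform in
/-- At `s = 3/4` the kernel is `(x + i y)⁻¹ (x - i y)^{-1/2}`, so that for `ξ ≥ 0` the integrand
continues to the lower half-plane with a single simple pole, at `-i y`. The integral is evaluated by
subtracting the multiple of `(x² + y²)⁻¹` with the same residue there. -/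
lemma fourier_kernel_three_quarters {y : ℝ} (hy : 0 < y) {ξ : ℝ} (hξ : 0 ≤ ξ) :
    𝓕 (kernel (3 / 4) y) ξ =
      Real.pi * (1 - I) / Real.sqrt y * exp (-(2 * Real.pi * ξ * y)) := by
  set U : Set ℂ := {w | w.im < y} with hU
  have hUo : IsOpen U := isOpen_lt continuous_im continuous_const
  set c : ℂ := -(y * I) with hc
  have hcU : c ∈ U := by simp [hU, hc]; linarith
  -- the integrand is `q w / (w - c)`
  let q : ℂ → ℂ := fun w => exp (-(2 * Real.pi * I * ξ * w)) * (w - y * I) ^ (-(1 / 2) : ℂ)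
  -- `k c = 1`, and `k x / (x - c)` is a multiple of `(x² + y²)⁻¹`
  let k : ℂ → ℂ := fun w => -(2 * y * I) * (w - y * I)⁻¹
  have hsub : ∀ w ∈ U, (w - y * I).im < 0 := fun w hw => by
    have : w.im < y := hw
    simp; linarith
  have hsub0 : ∀ w ∈ U, w - y * I ≠ 0 := fun w hw h => by
    have := hsub w hw
    rw [h] at this
    simp at this
  have hkc : k c = 1 := by
    have : -(2 * y * I : ℂ) ≠ 0 := neg_ne_zero.2
      (mul_ne_zero (mul_ne_zero two_ne_zero (by exact_mod_cast hy.ne')) I_ne_zero)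
    simp only [k, hc]
    rw [show -((y : ℂ) * I) - y * I = -(2 * y * I) by ring, mul_inv_cancel₀ this]
  let p : ℂ → ℂ := fun w => q w - q c * k w
  have hpc : p c = 0 := by simp [p, hkc]
  have hpd : DifferentiableOn ℂ p U := by
    intro w hw
    refine DifferentiableAt.differentiableWithinAt ?_
    have h1 : DifferentiableAt ℂ (fun w : ℂ => (w - y * I) ^ (-(1 / 2) : ℂ)) w :=
      DifferentiableAt.cpow_const (by fun_prop) (Or.inr (hsub w hw).ne)
    have h2 : DifferentiableAt ℂ (fun w : ℂ => (w - y * I)⁻¹) w :=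
      DifferentiableAt.inv (by fun_prop) (hsub0 w hw)
    have h3 : DifferentiableAt ℂ (fun w : ℂ => exp (-(2 * Real.pi * I * ξ * w))) w := by fun_prop
    exact (h3.mul h1).sub ((h2.const_mul _).const_mul _)
  let G := dslope p c
  have hGd : DifferentiableOn ℂ G U := (differentiableOn_dslope (hUo.mem_nhds hcU)).2 hpd
  have hG : ∀ w, w ≠ c → G w = p w / (w - c) := fun w hw => by
    simp only [G]
    rw [dslope_of_ne _ hw, slope_def_field, hpc, sub_zero]
  have hxc : ∀ x : ℝ, (x : ℂ) ≠ c := fun x h => by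
    have := congrArg Complex.im h
    simp [hc] at this
    exact hy.ne' this
  have hker : ∀ x : ℝ, Real.fourierChar (-(x * ξ)) • kernel (3 / 4) y x = q x / (x - c) := by
    intro x
    rw [Circle.smul_def, Real.fourierChar_apply, kernel, barPow, smul_eq_mul]
    have e1 : (-(3 / 4 + 1 / 4) : ℂ) = -1 := by norm_num
    have e2 : (-(3 / 4 - 1 / 4) : ℂ) = -(1 / 2) := by norm_num
    rw [e1, e2, cpow_neg_one]
    simp only [q, hc]
    rw [sub_neg_eq_add, div_eq_mul_inv, show ((2 * Real.pi * -(x * ξ) : ℝ) : ℂ) * I =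
      -(2 * Real.pi * I * ξ * x) by push_cast; ring]
    ring
  have hkx : ∀ x : ℝ, k x / (x - c) = -(2 * y * I) * (((x ^ 2 + y ^ 2)⁻¹ : ℝ) : ℂ) := by
    intro x
    simp only [k, hc]
    rw [sub_neg_eq_add, div_eq_mul_inv, mul_assoc, ← mul_inv,
      show ((x : ℂ) - y * I) * (x + y * I) = ((x ^ 2 + y ^ 2 : ℝ) : ℂ) by
        push_cast; linear_combination (-(y : ℂ) ^ 2) * I_sq]
    push_cast
    rfl
  have hiq : MeasureTheory.Integrable fun x : ℝ => q x / (x - c) := by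
    have := (Real.fourierIntegral_convergent_iff (μ := MeasureTheory.volume) ξ).2
      (integrable_kernel (s := 3 / 4) hy (by norm_num))
    refine this.congr (Eventually.of_forall fun x => ?_)
    refine Eq.trans ?_ (hker x)
    simp [mul_comm]
  have hi2 : MeasureTheory.Integrable fun x : ℝ => (((x ^ 2 + y ^ 2)⁻¹ : ℝ) : ℂ) := by
    have hir : MeasureTheory.Integrable fun x : ℝ => (x ^ 2 + y ^ 2)⁻¹ := by
      by_contra h
      have h1 := integral_inv_sq_add_sq hy
      rw [MeasureTheory.integral_undef h] at h1
      have : 0 < Real.pi / y := by positivity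
      linarith
    exact hir.ofReal
  have hGx : ∀ x : ℝ, G x = q x / (x - c) - q c * (-(2 * y * I) * (((x ^ 2 + y ^ 2)⁻¹ : ℝ) : ℂ)) :=
    fun x => by rw [hG _ (hxc x), ← hkx x, ← mul_div_assoc, ← sub_div]
  have hi3 := (hi2.const_mul (-(2 * y * I))).const_mul (q c)
  have hzero : ∫ x : ℝ, G x = 0 := by
    refine integral_eq_zero_of_differentiableOn_lower hy hGd ?_
      (C := 2 * (2 + ‖q c‖ * (2 * y * 2))) (R₀ := max 1 (2 * y)) ?_
    · simp_rw [hGx]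
      exact hiq.sub hi3
    · intro w him hR
      have hR1 := (le_max_left _ _).trans hR
      have hR2 := (le_max_right _ _).trans hR
      have hw0 : 0 < ‖w‖ := by linarith
      have hyI : ‖(y : ℂ) * I‖ = y := by simp [abs_of_pos hy]
      have h1 : ‖w‖ / 2 ≤ ‖w - y * I‖ := by
        have := norm_sub_norm_le w (y * I)
        rw [hyI] at this
        linarith
      have h2 : ‖w‖ / 2 ≤ ‖w - c‖ := by
        have := norm_sub_norm_le w c
        rw [hc, norm_neg, hyI] at this
        linarith
      have hwU : w ∈ U := lt_of_le_of_lt him hy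
      rw [hG w (fun h => by
        have : ‖w - c‖ = 0 := by rw [h, sub_self, norm_zero]
        linarith), norm_div]
      have hq : ‖q w‖ ≤ 2 * ‖w‖ ^ (-(1 / 2) : ℝ) := by
        simp only [q]
        rw [norm_mul, norm_exp, norm_cpow_of_ne_zero (hsub0 w hwU)]
        have e1 : (-(2 * Real.pi * I * ξ * w) : ℂ).re ≤ 0 := by
          have : (-(2 * Real.pi * I * ξ * w) : ℂ).re = 2 * Real.pi * ξ * w.im := by
            simp
          rw [this]
          exact mul_nonpos_of_nonneg_of_nonpos (by positivity) him
        have e2 : (-(1 / 2) : ℂ).re = -(1 / 2) := by norm_num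
        have e3 : (-(1 / 2) : ℂ).im = 0 := by norm_num
        rw [e2, e3, mul_zero, Real.exp_zero, div_one]
        calc _ ≤ 1 * (‖w‖ / 2) ^ (-(1 / 2) : ℝ) := by
              refine mul_le_mul (Real.exp_le_one_iff.2 e1) ?_ (by positivity) (by norm_num)
              exact Real.rpow_le_rpow_of_nonpos (by linarith) h1 (by norm_num)
          _ = 2 ^ (1 / 2 : ℝ) * ‖w‖ ^ (-(1 / 2) : ℝ) := by
              rw [one_mul, Real.div_rpow hw0.le (by norm_num),
                Real.rpow_neg (by norm_num : (0 : ℝ) ≤ 2), div_inv_eq_mul, mul_comm]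
          _ ≤ 2 * ‖w‖ ^ (-(1 / 2) : ℝ) := by
              gcongr
              calc (2 : ℝ) ^ (1 / 2 : ℝ) ≤ 2 ^ (1 : ℝ) :=
                    Real.rpow_le_rpow_of_exponent_le (by norm_num) (by norm_num)
                _ = 2 := Real.rpow_one 2
      have hk : ‖k w‖ ≤ 2 * y * 2 * ‖w‖ ^ (-(1 / 2) : ℝ) := by
        simp only [k]
        have hinv : ‖w - y * I‖⁻¹ ≤ 2 * ‖w‖ ^ (-(1 / 2) : ℝ) := by
          calc ‖w - y * I‖⁻¹ ≤ (‖w‖ / 2)⁻¹ := inv_anti₀ (by linarith) h1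
            _ = 2 * ‖w‖ ^ (-1 : ℝ) := by rw [Real.rpow_neg_one, inv_div, div_eq_mul_inv]
            _ ≤ _ := by
              have := Real.rpow_le_rpow_of_exponent_le hR1
                (by norm_num : (-1 : ℝ) ≤ -(1 / 2))
              linarith
        rw [norm_mul, norm_neg, mul_assoc 2, norm_mul, hyI, RCLike.norm_ofNat, norm_inv,
          mul_assoc (2 * y)]
        exact mul_le_mul_of_nonneg_left hinv (by positivity)
      have hp : ‖p w‖ ≤ (2 + ‖q c‖ * (2 * y * 2)) * ‖w‖ ^ (-(1 / 2) : ℝ) := by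
        calc ‖p w‖ ≤ ‖q w‖ + ‖q c * k w‖ := norm_sub_le _ _
          _ ≤ 2 * ‖w‖ ^ (-(1 / 2) : ℝ) + ‖q c‖ * (2 * y * 2 * ‖w‖ ^ (-(1 / 2) : ℝ)) := by
            rw [norm_mul (q c)]
            exact add_le_add hq (mul_le_mul_of_nonneg_left hk (norm_nonneg _))
          _ = _ := by ring
      have e : ‖w‖ ^ (-(3 / 2) : ℝ) = ‖w‖ ^ (-(1 / 2) : ℝ) * ‖w‖⁻¹ := by
        rw [← Real.rpow_neg_one, ← Real.rpow_add hw0]; norm_num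
      rw [e]
      calc ‖p w‖ / ‖w - c‖ ≤ (2 + ‖q c‖ * (2 * y * 2)) * ‖w‖ ^ (-(1 / 2) : ℝ) / (‖w‖ / 2) :=
            div_le_div₀ (by positivity) hp (by positivity) h2
        _ = _ := by field_simp
  simp_rw [hGx] at hzero
  rw [MeasureTheory.integral_sub hiq hi3, MeasureTheory.integral_const_mul,
    MeasureTheory.integral_const_mul, integral_complex_ofReal, integral_inv_sq_add_sq hy,
    sub_eq_zero] at hzero
  rw [Real.fourier_real_eq]
  simp_rw [hker]
  rw [hzero]
  simp only [q, hc]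
  rw [show (-((y : ℂ) * I) - y * I) = -(2 * y * I) by ring, neg_two_mul_I_cpow hy,
    show -(2 * Real.pi * I * ξ * -((y : ℂ) * I)) = -(2 * Real.pi * ξ * y) by
      linear_combination (2 * Real.pi * ξ * y) * I_sq]
  have hy' : (y : ℂ) ≠ 0 := by exact_mod_cast hy.ne'
  have hsy : (Real.sqrt y : ℂ) ≠ 0 := by exact_mod_cast (Real.sqrt_pos.2 hy).ne'
  push_cast
  field_simp
  linear_combination -I_sq

/-! ### Cosets and lower rows -/

/-- The summand of the Eisenstein series as a function of the lower row `(c, d)`. -/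
noncomputable def rowTerm (z : ℍ) (s : ℂ) (c d : ℤ) : ℂ :=
  (rowMult c d z)⁻¹ * ((z.im / normSq ((c : ℂ) * (z : ℂ) + (d : ℂ)) : ℝ) : ℂ) ^ s

lemma summand_eq_rowTerm (z : ℍ) (s : ℂ) (γ : SL(2, ℤ)) :
    summand z s γ = rowTerm z s (γ 1 0) (γ 1 1) := by
  unfold summand rowTerm
  rw [ModularGroup.im_smul_eq_div_normSq, ModularGroup.denom_apply]
  rfl

lemma rowTerm_neg {c d : ℤ} (hd : d % 2 = 1) (h0 : c = 0 → d = 1 ∨ d = -1) (z : ℍ) (s : ℂ) :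
    rowTerm z s (-c) (-d) = rowTerm z s c d := by
  unfold rowTerm
  rw [rowMult_neg hd h0]
  congr 4
  rw [show (((-c : ℤ) : ℂ) * (z : ℂ) + ((-d : ℤ) : ℂ)) = -((c : ℂ) * z + d) by push_cast; ring,
    normSq_neg]

/-- The lower row of a matrix, with its sign chosen such that `c ≥ 0`, and `d = 1` if `c = 0`. -/
def normRow (γ : SL(2, ℤ)) : ℕ × ℤ :=
  ((γ 1 0).natAbs, if γ 1 0 = 0 then 1 else (γ 1 0).sign * γ 1 1)

/-- The normalized lower rows `(c, d)` of the matrices in `Γ₀(M)`. -/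
def rowSet (M : ℕ) : Set (ℕ × ℤ) :=
  {p | M ∣ p.1 ∧ IsCoprime (p.1 : ℤ) p.2 ∧ (p.1 = 0 → p.2 = 1)}

lemma det_row (γ : SL(2, ℤ)) : γ 0 0 * γ 1 1 - γ 0 1 * γ 1 0 = 1 := by
  have := Matrix.det_fin_two γ.1
  rw [Matrix.SpecialLinearGroup.det_coe] at this
  exact this.symm

lemma dvd_lower_left {M : ℕ} (γ : Gamma0 M) : (M : ℤ) ∣ (γ : SL(2, ℤ)) 1 0 := by
  have h := γ.2
  rwa [Gamma0_mem, ZMod.intCast_zmod_eq_zero_iff_dvd] at h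

lemma lower_right_of_eq_zero {γ : SL(2, ℤ)} (h : γ 1 0 = 0) : γ 1 1 = 1 ∨ γ 1 1 = -1 := by
  have := det_row γ
  rw [h, mul_zero, sub_zero, mul_comm] at this
  exact Int.eq_one_or_neg_one_of_mul_eq_one this

lemma lower_right_odd {M : ℕ} (hM : 2 ∣ M) (γ : Gamma0 M) : (γ : SL(2, ℤ)) 1 1 % 2 = 1 := by
  obtain ⟨k, hk⟩ := (Int.natCast_dvd_natCast.2 hM).trans (dvd_lower_left γ)
  have hdet := det_row (γ : SL(2, ℤ))
  rcases Int.emod_two_eq_zero_or_one ((γ : SL(2, ℤ)) 1 1) with h | h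
  · obtain ⟨l, hl⟩ := Int.dvd_of_emod_eq_zero h
    rw [hk, hl] at hdet
    have : (2 : ℤ) ∣ 1 := ⟨(γ : SL(2, ℤ)) 0 0 * l - (γ : SL(2, ℤ)) 0 1 * k, by
      push_cast at hdet
      linear_combination -hdet⟩
    norm_num at this
  · exact h

lemma summand_eq_rowTerm_normRow {M : ℕ} (hM : 2 ∣ M) (z : ℍ) (s : ℂ) (γ : Gamma0 M) :
    summand z s (γ : SL(2, ℤ)) =
      rowTerm z s ((normRow (γ : SL(2, ℤ))).1 : ℤ) (normRow (γ : SL(2, ℤ))).2 := by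
  have hodd := lower_right_odd hM γ
  rw [summand_eq_rowTerm]
  simp only [normRow]
  rcases lt_trichotomy ((γ : SL(2, ℤ)) 1 0) 0 with h | h | h
  · rw [if_neg h.ne, Int.sign_eq_neg_one_of_neg h, Int.ofNat_natAbs_of_nonpos h.le, neg_one_mul,
      rowTerm_neg hodd (fun h0 => absurd h0 h.ne)]
  · rw [if_pos h, h, Int.natAbs_zero, Nat.cast_zero]
    rcases lower_right_of_eq_zero h with h1 | h1
    · rw [h1]
    · rw [h1, ← rowTerm_neg (c := 0) (d := 1) (by norm_num) (fun _ => Or.inl rfl) z s, neg_zero]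
  · rw [if_neg h.ne', Int.sign_eq_one_of_pos h, Int.natAbs_of_nonneg h.le, one_mul]

lemma normRow_mul {M : ℕ} (δ γ : Gamma0 M) (hδ : δ ∈ stabInfty M) :
    normRow ((δ * γ : Gamma0 M) : SL(2, ℤ)) = normRow (γ : SL(2, ℤ)) := by
  have hδ0 : (δ : SL(2, ℤ)) 1 0 = 0 := hδ
  have hrow0 : ((δ * γ : Gamma0 M) : SL(2, ℤ)) 1 0 =
      (δ : SL(2, ℤ)) 1 1 * (γ : SL(2, ℤ)) 1 0 := by
    simp [Matrix.mul_apply, Fin.sum_univ_two, hδ0]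
  have hrow1 : ((δ * γ : Gamma0 M) : SL(2, ℤ)) 1 1 =
      (δ : SL(2, ℤ)) 1 1 * (γ : SL(2, ℤ)) 1 1 := by
    simp [Matrix.mul_apply, Fin.sum_univ_two, hδ0]
  unfold normRow
  rw [hrow0, hrow1]
  rcases lower_right_of_eq_zero hδ0 with h | h
  · rw [h, one_mul, one_mul]
  · simp only [h, neg_one_mul, Int.natAbs_neg, neg_eq_zero, Int.sign_neg, neg_mul_neg]

lemma normRow_mem {M : ℕ} (γ : Gamma0 M) : normRow (γ : SL(2, ℤ)) ∈ rowSet M := by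
  have hdet := det_row (γ : SL(2, ℤ))
  refine ⟨Int.natCast_dvd.1 (dvd_lower_left γ), ?_, fun h => if_pos (Int.natAbs_eq_zero.1 h)⟩
  have hcop : IsCoprime ((γ : SL(2, ℤ)) 1 0) ((γ : SL(2, ℤ)) 1 1) :=
    ⟨-(γ : SL(2, ℤ)) 0 1, (γ : SL(2, ℤ)) 0 0, by linear_combination hdet⟩
  simp only [normRow]
  split_ifs with h
  · exact isCoprime_one_right
  · rcases lt_or_gt_of_ne h with h | h
    · rw [Int.sign_eq_neg_one_of_neg h, Int.ofNat_natAbs_of_nonpos h.le, neg_one_mul]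
      exact hcop.neg_neg
    · rwa [Int.sign_eq_one_of_pos h, Int.natAbs_of_nonneg h.le, one_mul]

lemma rel_of_normRow_eq {M : ℕ} {γ γ' : Gamma0 M}
    (h : normRow (γ : SL(2, ℤ)) = normRow (γ' : SL(2, ℤ))) : γ' * γ⁻¹ ∈ stabInfty M := by
  have hentry : ((γ' * γ⁻¹ : Gamma0 M) : SL(2, ℤ)) 1 0 =
      (γ' : SL(2, ℤ)) 1 0 * (γ : SL(2, ℤ)) 1 1 - (γ' : SL(2, ℤ)) 1 1 * (γ : SL(2, ℤ)) 1 0 := by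
    simp [Matrix.mul_apply, Fin.sum_univ_two, Matrix.SpecialLinearGroup.coe_inv,
      Matrix.adjugate_fin_two, sub_eq_add_neg]
  change ((γ' * γ⁻¹ : Gamma0 M) : SL(2, ℤ)) 1 0 = 0
  rw [hentry]
  have h1 : ((γ : SL(2, ℤ)) 1 0).natAbs = ((γ' : SL(2, ℤ)) 1 0).natAbs := congrArg Prod.fst h
  have h2 := congrArg Prod.snd h
  simp only [normRow] at h2
  generalize (γ : SL(2, ℤ)) 1 0 = c at *
  generalize (γ' : SL(2, ℤ)) 1 0 = c' at *
  generalize (γ : SL(2, ℤ)) 1 1 = d at *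
  generalize (γ' : SL(2, ℤ)) 1 1 = d' at *
  rcases Int.natAbs_eq_natAbs_iff.1 h1 with rfl | rfl
  · split_ifs at h2 with hc
    · rw [hc]; ring
    · rw [mul_left_cancel₀ (fun hs => hc (Int.sign_eq_zero_iff_zero.1 hs)) h2]; ring
  · simp only [neg_eq_zero] at h2
    split_ifs at h2 with hc
    · rw [hc]; ring
    · rw [Int.sign_neg, neg_mul] at h2
      have := mul_left_cancel₀ (b := -d) (c := d')
        (fun hs => hc (Int.sign_eq_zero_iff_zero.1 hs)) (by linear_combination h2)
      rw [← this]; ring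

lemma exists_normRow_eq {M : ℕ} {p : ℕ × ℤ} (hp : p ∈ rowSet M) :
    ∃ γ : Gamma0 M, normRow (γ : SL(2, ℤ)) = p := by
  obtain ⟨c, d⟩ := p
  obtain ⟨h1, ⟨u, v, huv⟩, h3⟩ := hp
  simp only at h1 huv h3
  let g : SL(2, ℤ) := ⟨!![v, -u; (c : ℤ), d], by rw [Matrix.det_fin_two_of]; linear_combination huv⟩
  have g10 : g 1 0 = c := rfl
  have g11 : g 1 1 = d := rfl
  refine ⟨⟨g, ?_⟩, ?_⟩
  · rw [Gamma0_mem, ZMod.intCast_zmod_eq_zero_iff_dvd, g10]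
    exact_mod_cast h1
  · simp only [normRow, g10, g11]
    rcases Nat.eq_zero_or_pos c with hc | hc
    · rw [if_pos (by exact_mod_cast hc), h3 hc, Int.natAbs_natCast]
    · rw [if_neg (by exact_mod_cast hc.ne'), Int.natAbs_natCast,
        Int.sign_eq_one_of_pos (by exact_mod_cast hc), one_mul]

/-- Cosets of `Γ_∞` in `Γ₀(M)` correspond to normalized lower rows. -/
noncomputable def cosetEquiv (M : ℕ) : CosetSpace M ≃ rowSet M :=
  Equiv.ofBijective (fun q => ⟨normRow ((q.out : Gamma0 M) : SL(2, ℤ)), normRow_mem _⟩) <| by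
    constructor
    · intro q q' h
      have h' := rel_of_normRow_eq (congrArg Subtype.val h)
      rw [← Quotient.out_eq q, ← Quotient.out_eq q']
      exact Quotient.sound (QuotientGroup.rightRel_apply.2 h')
    · rintro ⟨p, hp⟩
      obtain ⟨γ, hγ⟩ := exists_normRow_eq hp
      refine ⟨Quotient.mk (QuotientGroup.rightRel (stabInfty M)) γ, Subtype.ext ?_⟩
      have h : (Quotient.out (Quotient.mk (QuotientGroup.rightRel (stabInfty M)) γ)) * γ⁻¹ ∈
          stabInfty M :=
        QuotientGroup.rightRel_apply.1
          ((QuotientGroup.rightRel (stabInfty M)).symm' (Quotient.exact (Quotient.out_eq _)))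
      have h2 := normRow_mul _ γ h
      rw [inv_mul_cancel_right] at h2
      exact h2.trans hγ

lemma cosetSummand_eq {M : ℕ} (hM : 2 ∣ M) (z : ℍ) (s : ℂ) (q : CosetSpace M) :
    cosetSummand M z s q = rowTerm z s ((cosetEquiv M q).1.1 : ℤ) (cosetEquiv M q).1.2 :=
  summand_eq_rowTerm_normRow hM z s _

open Classical in
/-- The summand as a function on all pairs `(c, d)`, zero outside the lower rows. -/
noncomputable def pairTerm (M : ℕ) (z : ℍ) (s : ℂ) (p : ℕ × ℤ) : ℂ :=
  if p ∈ rowSet M then rowTerm z s (p.1 : ℤ) p.2 else 0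

lemma eisenstein_eq_tsum {M : ℕ} (hM : 2 ∣ M) (z : ℍ) (s : ℂ) :
    eisenstein M z s = ∑' p, pairTerm M z s p := by
  classical
  unfold eisenstein
  simp_rw [cosetSummand_eq hM]
  rw [(cosetEquiv M).tsum_eq (fun p : rowSet M => rowTerm z s (p.1.1 : ℤ) p.1.2),
    tsum_subtype (rowSet M) (fun p : ℕ × ℤ => rowTerm z s (p.1 : ℤ) p.2)]
  rfl

lemma summable_cosetSummand_iff {M : ℕ} (hM : 2 ∣ M) (z : ℍ) (s : ℂ) :
    Summable (cosetSummand M z s) ↔ Summable (pairTerm M z s) := by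
  classical
  have h1 : cosetSummand M z s =
      (fun p : rowSet M => rowTerm z s (p.1.1 : ℤ) p.1.2) ∘ cosetEquiv M :=
    funext fun q => cosetSummand_eq hM z s q
  rw [h1, (cosetEquiv M).summable_iff]
  exact summable_subtype_iff_indicator (s := rowSet M)
    (f := fun p : ℕ × ℤ => rowTerm z s (p.1 : ℤ) p.2)

lemma jacobiSym_ne_zero_of_isCoprime {c d : ℤ} (h : IsCoprime c d) : jacobiSym c d.natAbs ≠ 0 := by
  rcases eq_or_ne d 0 with rfl | hd
  · simp
  · have : NeZero d.natAbs := ⟨Int.natAbs_ne_zero.2 hd⟩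
    rw [Int.isCoprime_iff_gcd_eq_one] at h
    rw [Ne, jacobiSym.eq_zero_iff_not_coprime, not_not]
    simpa [Int.gcd, Int.natAbs_abs] using h

lemma kronecker_sq {c d : ℤ} (h : IsCoprime c d) : (kronecker c d : ℂ) * kronecker c d = 1 := by
  have h1 : kronecker c d * kronecker c d = 1 := by
    unfold kronecker
    have h0 := jacobiSym_ne_zero_of_isCoprime h
    rcases jacobiSym.trichotomy c d.natAbs with hj | hj | hj
    · exact absurd hj h0
    · rw [hj]; split_ifs <;> norm_num
    · rw [hj]; split_ifs <;> norm_num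
  exact_mod_cast h1

lemma norm_rowTerm {z : ℍ} {s : ℂ} {c d : ℤ} (h : IsCoprime c d) :
    ‖rowTerm z s c d‖ = (z.im / normSq ((c : ℂ) * (z : ℂ) + (d : ℂ))) ^ s.re := by
  have hne : (c : ℂ) * (z : ℂ) + (d : ℂ) ≠ 0 := by
    intro h0
    have him := congrArg Complex.im h0
    have hc : c = 0 := by simpa [z.im_pos.ne'] using him
    subst hc
    have hd : d = 0 := by simpa using h0
    subst hd
    exact not_isCoprime_zero_zero h
  have hpos : 0 < z.im / normSq ((c : ℂ) * (z : ℂ) + (d : ℂ)) := div_pos z.im_pos (normSq_pos.2 hne)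
  have hk : ‖(kronecker c d : ℂ)‖ = 1 := by
    have := congrArg norm (kronecker_sq h)
    rw [norm_mul, norm_one] at this
    nlinarith [norm_nonneg (kronecker c d : ℂ)]
  rw [rowTerm, norm_mul, norm_cpow_eq_rpow_re_of_pos hpos, norm_inv, rowMult, norm_mul, norm_mul,
    norm_inv, norm_eps, hk, show I / 2 * (arg ((c : ℂ) * (z : ℂ) + (d : ℂ)) : ℂ) =
      ((arg ((c : ℂ) * (z : ℂ) + (d : ℂ)) / 2 : ℝ) : ℂ) * I by push_cast; ring,
    norm_exp_ofReal_mul_I]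
  simp

/-- Absolute convergence, by comparison with `∑ ‖(c, d)‖^{-2 Re s}`. -/
lemma summable_pairTerm (M : ℕ) (z : ℍ) {s : ℂ} (hs : 1 < s.re) : Summable (pairTerm M z s) := by
  have h := EisensteinSeries.summable_one_div_norm_rpow (k := 2 * s.re) (by linarith)
  let f : ℕ × ℤ → (Fin 2 → ℤ) := fun p => ![(p.1 : ℤ), p.2]
  have hf : Function.Injective f := by
    rintro ⟨a, b⟩ ⟨a', b'⟩ hab
    have h0 := congrFun hab 0
    have h1 := congrFun hab 1
    simp [f] at h0 h1
    rw [h0, h1]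
  have h2 := (h.comp_injective hf).mul_left (z.im ^ s.re * EisensteinSeries.r z ^ (-(2 * s.re)))
  refine Summable.of_norm_bounded h2 fun p => ?_
  unfold pairTerm
  split_ifs with hp
  · rw [norm_rowTerm hp.2.1, Real.div_rpow z.im_pos.le (normSq_nonneg _), div_eq_mul_inv,
      mul_assoc]
    refine mul_le_mul_of_nonneg_left ?_ (Real.rpow_nonneg z.im_pos.le _)
    · have hb := EisensteinSeries.summand_bound z (k := 2 * s.re) (by linarith) (f p)
      refine Eq.trans_le ?_ hb
      rw [normSq_eq_norm_sq, ← Real.rpow_natCast, ← Real.rpow_mul (norm_nonneg _),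
        ← Real.rpow_neg (norm_nonneg _)]
      simp [f]
  · rw [norm_zero]
    have h1 := z.im_pos
    have h2 := EisensteinSeries.r_pos z
    exact mul_nonneg (by positivity) (Real.rpow_nonneg (norm_nonneg _) _)

/-! ### The Fourier expansion for `Re s > 1` -/

lemma ofReal_cpow_eq_exp {a : ℝ} (ha : 0 < a) (s : ℂ) :
    (a : ℂ) ^ s = exp ((Real.log a : ℂ) * s) := by
  rw [cpow_def_of_ne_zero (by exact_mod_cast ha.ne'), ofReal_log ha.le]

/-- A summand with `c > 0` in terms of the kernel. -/
lemma rowTerm_eq (z : ℍ) (s : ℂ) {c : ℕ} (hc : 0 < c) {d : ℤ} (h : IsCoprime (c : ℤ) d) :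
    rowTerm z s c d = (z.im : ℂ) ^ s * (c : ℂ) ^ (-(2 * s)) * (eps d * (kronecker c d : ℂ)) *
      kernel s z.im (z.re + d / c) := by
  have hy := z.im_pos
  have hcR : (0 : ℝ) < c := by exact_mod_cast hc
  have hcC : (c : ℂ) ≠ 0 := by exact_mod_cast hc.ne'
  set W : ℂ := ((z.re + d / c : ℝ) : ℂ) + z.im * I with hW
  have hW0 : W ≠ 0 := add_mul_I_ne_zero hy _
  have hn : 0 < ‖W‖ := norm_pos_iff.2 hW0
  have hcd : ((c : ℤ) : ℂ) * (z : ℂ) + d = ((c : ℝ) : ℂ) * W := by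
    have hz : (z : ℂ) = z.re + z.im * I := (re_add_im (z : ℂ)).symm
    rw [hW, hz]
    push_cast
    field_simp
    ring
  have hk : ((kronecker c d : ℂ))⁻¹ = kronecker c d :=
    inv_eq_of_mul_eq_one_left (kronecker_sq h)
  have hpow : ((z.im / normSq (((c : ℝ) : ℂ) * W) : ℝ) : ℂ) ^ s =
      (z.im : ℂ) ^ s * (c : ℂ) ^ (-(2 * s)) * (‖W‖ : ℂ) ^ (-(2 * s)) := by
    have e1 : normSq (((c : ℝ) : ℂ) * W) = c ^ 2 * ‖W‖ ^ 2 := by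
      rw [map_mul, normSq_ofReal, normSq_eq_norm_sq]; ring
    rw [e1, ofReal_cpow_eq_exp (by positivity), ofReal_cpow_eq_exp hy, ofReal_cpow_eq_exp hn,
      ← ofReal_natCast, ofReal_cpow_eq_exp hcR, ← exp_add, ← exp_add, Real.log_div hy.ne'
      (by positivity), Real.log_mul (by positivity) (by positivity), Real.log_pow, Real.log_pow]
    congr 1
    push_cast
    ring
  rw [rowTerm, rowMult, hcd, arg_real_mul _ hcR, hpow, kernel_eq s hy, exp_neg, mul_inv, mul_inv,
    inv_inv, hk]
  ring

lemma quadGauss_add_mul (c : ℕ) [NeZero c] (d k : ℤ) :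
    quadGauss (d + c * k) c = quadGauss d c := by
  simp [quadGauss]

lemma exp_add_div (n : ℤ) (c : ℕ) [NeZero c] (i : ℕ) (x : ℝ) :
    exp (2 * Real.pi * I * n * ((x + i / c : ℝ) : ℂ)) =
      exp (2 * Real.pi * I * n * x) * ZMod.stdAddChar ((n : ZMod c) * ((i : ℤ) : ZMod c)) := by
  rw [← Int.cast_mul, ZMod.stdAddChar_coe, ← exp_add]
  congr 1
  push_cast
  ring

lemma norm_exp_two_pi (n : ℤ) (x : ℝ) : ‖exp (2 * Real.pi * I * n * x)‖ = 1 := by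
  rw [show 2 * Real.pi * I * n * x = ((2 * Real.pi * n * x : ℝ) : ℂ) * I by push_cast; ring,
    norm_exp_ofReal_mul_I]

open FourierTransform in
lemma summable_norm_fourier_kernel {s : ℂ} {y : ℝ} (hy : 0 < y) (hs : 1 / 2 < s.re) :
    Summable fun n : ℤ => ‖𝓕 (kernel s y) n‖ := by
  obtain ⟨C, h0, hC⟩ := exists_norm_fourier_kernel_le hy (δ := s.re - 1 / 2) (by linarith) 2 ‖s‖
  refine Summable.of_nonneg_of_le (fun n => norm_nonneg _) (fun n => ?_)
    (summable_inv_one_add_abs_sq.mul_left C)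
  rw [← div_eq_mul_inv]
  exact hC s (by linarith) le_rfl n

open FourierTransform in
open Classical in
/-- Poisson summation over `d` for fixed `c`: the sums over residue classes assemble to Gauss
sums. -/
lemma tsum_rowTerm_eq (z : ℍ) {s : ℂ} (hs : 1 < s.re) {c : ℕ} (hc : 0 < c) (h4 : 4 ∣ c)
    (hsum : Summable fun d : ℤ => if IsCoprime (c : ℤ) d then rowTerm z s c d else 0) :
    ∑' d : ℤ, (if IsCoprime (c : ℤ) d then rowTerm z s c d else 0) =
      (z.im : ℂ) ^ s * (c : ℂ) ^ (-(2 * s)) * ((1 + I) / 2 * Real.sqrt c) *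
        ∑' n : ℤ, 𝓕 (kernel s z.im) n * exp (2 * Real.pi * I * n * z.re) *
          (rootMoebius n c : ℂ) := by
  have hy := z.im_pos
  have : NeZero c := ⟨hc.ne'⟩
  have hcR : (0 : ℝ) < c := by exact_mod_cast hc
  have hcC : (c : ℂ) ≠ 0 := by exact_mod_cast hc.ne'
  set A : ℂ := (z.im : ℂ) ^ s * (c : ℂ) ^ (-(2 * s)) * ((1 + I) / 2 * (Real.sqrt c : ℂ)⁻¹) with hA
  have hF := summable_norm_fourier_kernel hy (s := s) (by linarith)
  have hterm : ∀ (i : ℕ) (k : ℤ),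
      (if IsCoprime (c : ℤ) ((i : ℤ) + c * k) then rowTerm z s c ((i : ℤ) + c * k) else 0) =
        if i.Coprime c then A * quadGauss (-(i : ℤ)) c *
          kernel s z.im ((z.re + i / c : ℝ) + k) else 0 := by
    intro i k
    have hiff : IsCoprime (c : ℤ) ((i : ℤ) + c * k) ↔ i.Coprime c := by
      rw [IsCoprime.add_mul_left_right_iff, Nat.isCoprime_iff_coprime, Nat.coprime_comm]
    by_cases h : i.Coprime c
    · have h' := hiff.2 h
      rw [if_pos h, if_pos h', rowTerm_eq z s hc h', eps_mul_kronecker c h4 _ h',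
        show -((i : ℤ) + c * k) = -(i : ℤ) + c * (-k) by ring, quadGauss_add_mul, hA]
      have hx : z.re + (((i : ℤ) + c * k : ℤ) : ℝ) / c = (z.re + i / c) + k := by
        push_cast
        field_simp
        ring
      rw [hx]
      ring
    · rw [if_neg h, if_neg (fun h' => h (hiff.1 h'))]
  rw [tsum_int_eq_sum_residues c hsum, sum_zmod_eq_sum_range]
  have hres : ∀ i ∈ Finset.range c,
      (∑' k : ℤ, if IsCoprime (c : ℤ) ((((i : ZMod c).val : ℕ) : ℤ) + c * k) then
        rowTerm z s c ((((i : ZMod c).val : ℕ) : ℤ) + c * k) else 0) =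
      if i.Coprime c then ∑' n : ℤ, A * (𝓕 (kernel s z.im) n * exp (2 * Real.pi * I * n * z.re)) *
        shiftedGauss n c (i : ZMod c) else 0 := by
    intro i hi
    rw [ZMod.val_cast_of_lt (Finset.mem_range.1 hi)]
    simp_rw [hterm]
    split_ifs with h
    · rw [tsum_mul_left, tsum_kernel_eq hy (by linarith), ← tsum_mul_left]
      refine tsum_congr fun n => ?_
      have := shiftedGauss_eq n c (i : ℤ)
      rw [Int.cast_natCast] at this
      rw [exp_add_div, this, Int.cast_natCast]
      ring
    · exact tsum_zero
  rw [Finset.sum_congr rfl hres, ← Finset.sum_filter, ← Summable.tsum_finsetSum]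
  · rw [← tsum_mul_left]
    refine tsum_congr fun n => ?_
    rw [← Finset.mul_sum]
    change A * _ * unitGaussSum n c = _
    rw [unitGaussSum_eq, hA]
    have hsq : (Real.sqrt c : ℂ) * Real.sqrt c = c := by
      rw [← ofReal_mul, Real.mul_self_sqrt hcR.le, ofReal_natCast]
    have hsq0 : (Real.sqrt c : ℂ) ≠ 0 := by exact_mod_cast (Real.sqrt_pos.2 hcR).ne'
    have : (Real.sqrt c : ℂ)⁻¹ * c = Real.sqrt c := by rw [← hsq]; field_simp
    linear_combination ((z.im : ℂ) ^ s * (c : ℂ) ^ (-(2 * s)) * ((1 + I) / 2) *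
      (𝓕 (kernel s z.im) n * exp (2 * Real.pi * I * n * z.re)) * (rootMoebius n c : ℂ)) * this
  · intro i _
    refine Summable.of_norm ?_
    have hS : ∀ n : ℤ, ‖shiftedGauss n c (i : ZMod c)‖ ≤ c := by
      intro n
      refine (norm_sum_le _ _).trans ?_
      refine (Finset.sum_le_sum fun x _ => (AddChar.norm_apply _ _).le).trans ?_
      simp [ZMod.card]
    refine Summable.of_nonneg_of_le (fun n => norm_nonneg _) (fun n => ?_)
      ((hF.mul_left ‖A‖).mul_right (c : ℝ))
    rw [norm_mul, norm_mul, norm_mul (𝓕 (kernel s z.im) (n : ℝ)), norm_exp_two_pi,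
      mul_one]
    gcongr
    exact hS n

open FourierTransform in
open Classical in
/-- The Fourier expansion of the Eisenstein series. -/
lemma eisenstein_eq_fourier {M : ℕ} (hM : 4 ∣ M) (z : ℍ) {s : ℂ} (hs : 1 < s.re) :
    eisenstein M z s = (z.im : ℂ) ^ s + (z.im : ℂ) ^ s * ((1 + I) / 2) *
      ∑' n : ℤ, 𝓕 (kernel s z.im) n * exp (2 * Real.pi * I * n * z.re) *
        LSeries (fullCoef n M) (2 * s - 1 / 2) := by
  have hy := z.im_pos
  have h2M : 2 ∣ M := (Dvd.intro 2 rfl : 2 ∣ 4).trans hM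
  have hS := summable_pairTerm M z hs
  have hF := summable_norm_fourier_kernel hy (s := s) (by linarith)
  set w : ℂ := 2 * s - 1 / 2 with hw
  have hwre : w.re = 2 * s.re - 1 / 2 := by
    rw [hw, show (1 / 2 : ℂ) = ((1 / 2 : ℝ) : ℂ) by push_cast; ring, sub_re, ofReal_re]
    simp
  let u : ℕ → ℤ → ℂ := fun c n => 𝓕 (kernel s z.im) n * exp (2 * Real.pi * I * n * z.re) *
    LSeries.term (fullCoef n M) w c
  -- `Re w > 3/2` makes the double series over `c` and `n` absolutely convergent
  have hu : ∀ c n, ‖u c n‖ ≤ (Real.sqrt 2 * (c : ℝ) ^ (1 / 2 - w.re)) * ‖𝓕 (kernel s z.im) n‖ := by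
    intro c n
    simp only [u]
    rw [norm_mul, norm_mul, norm_exp_two_pi, mul_one, mul_comm]
    refine mul_le_mul_of_nonneg_right ?_ (norm_nonneg _)
    rcases Nat.eq_zero_or_pos c with rfl | hc
    · rw [LSeries.term_zero, norm_zero]; positivity
    · have hcR : (0 : ℝ) < c := by exact_mod_cast hc
      rw [LSeries.norm_term_eq, if_neg hc.ne', div_le_iff₀ (by positivity), mul_assoc,
        ← Real.rpow_add hcR, sub_add_cancel, ← Real.sqrt_eq_rpow]
      unfold fullCoef
      split_ifs with h
      · exact norm_rootMoebius_le n c hc.ne' (hM.trans h)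
      · rw [norm_zero]; positivity
  have hB : Summable fun c : ℕ => Real.sqrt 2 * (c : ℝ) ^ (1 / 2 - w.re) :=
    (Real.summable_nat_rpow.2 (by rw [hwre]; linarith)).mul_left _
  have hu2 : Summable (Function.uncurry u) := by
    refine Summable.of_norm_bounded (hB.mul_of_nonneg hF (fun c => by positivity)
      (fun n => norm_nonneg _)) fun p => hu p.1 p.2
  -- the row `c = 0` consists of `(0, 1)` only and contributes `y^s`
  have hinner : ∀ c : ℕ, ∑' d : ℤ, pairTerm M z s (c, d) =
      (if c = 0 then (z.im : ℂ) ^ s else 0) + (z.im : ℂ) ^ s * ((1 + I) / 2) * ∑' n : ℤ, u c n := by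
    intro c
    rcases Nat.eq_zero_or_pos c with rfl | hc
    · have h0 : ∀ n, u 0 n = 0 := fun n => by simp only [u]; rw [LSeries.term_zero, mul_zero]
      simp_rw [h0]
      rw [tsum_zero, mul_zero, add_zero, if_true, tsum_eq_single 1]
      · rw [pairTerm, if_pos ⟨dvd_zero M, isCoprime_one_right, fun _ => rfl⟩]
        simp only [Nat.cast_zero]
        rw [rowTerm, rowMult_zero_one]
        simp
      · intro d hd
        rw [pairTerm, if_neg fun h => hd (h.2.2 rfl)]
    · rw [if_neg hc.ne', zero_add]
      by_cases hMc : M ∣ c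
      · have hp : ∀ d : ℤ, pairTerm M z s (c, d) =
            if IsCoprime (c : ℤ) d then rowTerm z s c d else 0 := by
          intro d
          unfold pairTerm
          refine if_congr ⟨fun h => h.2.1, fun h => ⟨hMc, h, fun h0 => absurd h0 hc.ne'⟩⟩ rfl rfl
        have hsd : Summable fun d : ℤ => pairTerm M z s (c, d) := hS.prod_factor c
        simp_rw [hp] at hsd ⊢
        rw [tsum_rowTerm_eq z hs hc (hM.trans hMc) hsd, ← tsum_mul_left, ← tsum_mul_left]
        refine tsum_congr fun n => ?_
        simp only [u]
        rw [LSeries.term_of_ne_zero hc.ne', fullCoef, if_pos hMc]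
        have hcC : (c : ℂ) ≠ 0 := by exact_mod_cast hc.ne'
        have hpw : (c : ℂ) ^ (-(2 * s)) * (Real.sqrt c : ℂ) = ((c : ℂ) ^ w)⁻¹ := by
          rw [← ofReal_cpow_half (Nat.cast_nonneg c), ofReal_natCast, ← cpow_add _ _ hcC,
            ← cpow_neg]
          congr 1
          rw [hw]; ring
        rw [div_eq_mul_inv _ ((c : ℂ) ^ w), ← hpw]
        ring
      · have hp : ∀ d : ℤ, pairTerm M z s (c, d) = 0 := fun d => if_neg fun h => hMc h.1
        have h0 : ∀ n, u c n = 0 := fun n => by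
          simp only [u]
          rw [LSeries.term_of_ne_zero hc.ne', fullCoef, if_neg hMc, zero_div, mul_zero]
        simp_rw [hp, h0]
        simp
  rw [eisenstein_eq_tsum h2M, hS.tsum_prod]
  simp_rw [hinner]
  have hs1 : Summable fun c : ℕ => if c = 0 then (z.im : ℂ) ^ s else 0 :=
    summable_of_ne_finset_zero (s := {0}) fun c hc => if_neg (by simpa using hc)
  have hs2 : Summable fun c : ℕ => ∑' n : ℤ, u c n := hu2.prod
  rw [hs1.tsum_add (hs2.mul_left _), tsum_ite_eq, tsum_mul_left, ← Summable.tsum_comm hu2]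
  congr 2
  refine tsum_congr fun n => ?_
  simp only [u]
  rw [tsum_mul_left]
  rfl

/-! ### Continuation and residue -/

open FourierTransform in
/-- The terms of the continued Fourier expansion, multiplied by `2 (s - 3/4)`; the Dirichlet series
are taken at `w = 2 s - 1/2`. -/
noncomputable def fourierTerm (M : ℕ) (z : ℍ) (n : ℤ) (s : ℂ) : ℂ :=
  𝓕 (kernel s z.im) n * exp (2 * Real.pi * I * n * z.re) * coefExt n M (2 * s - 1 / 2)

lemma two_mul_sub_half_re (s : ℂ) : (2 * s - 1 / 2).re = 2 * s.re - 1 / 2 := by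
  rw [show (1 / 2 : ℂ) = ((1 / 2 : ℝ) : ℂ) by push_cast; ring, sub_re, ofReal_re]
  simp

lemma differentiableAt_fourierTerm {M : ℕ} (hM : 4 ∣ M) (hM0 : M ≠ 0) (z : ℍ) (n : ℤ) {s : ℂ}
    (hs : 1 / 2 < s.re) : DifferentiableAt ℂ (fourierTerm M z n) s := by
  have h1 := differentiableAt_fourier_kernel z.im_pos (n : ℝ) hs
  have hd : DifferentiableAt ℂ (fun s : ℂ => 2 * s - 1 / 2) s := by fun_prop
  have h2 : DifferentiableAt ℂ (fun s => coefExt n M (2 * s - 1 / 2)) s :=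
    DifferentiableAt.comp (g := coefExt n M) s
      (differentiableAt_coefExt n hM hM0 (by rw [two_mul_sub_half_re]; linarith)) hd
  exact (h1.mul_const _).mul h2

/-- The continued Fourier expansion converges locally uniformly: the Fourier transform of the kernel
decays faster than the polynomial growth of the coefficients. -/
lemma exists_norm_fourierTerm_le {M : ℕ} (hM : 4 ∣ M) (hM0 : M ≠ 0) (z : ℍ) {δ : ℝ} (hδ : 0 < δ)
    (R : ℝ) : ∃ C : ℝ, ∀ (n : ℤ) (s : ℂ), 1 / 2 + δ ≤ s.re → ‖s‖ ≤ R →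
      ‖fourierTerm M z n s‖ ≤ C * ((1 + |(n : ℝ)|) ^ 2)⁻¹ := by
  obtain ⟨C₁, k, h1, hC₁⟩ := exists_norm_coefExt_le hM hM0 hδ (2 * R + 1)
  obtain ⟨C₂, h2, hC₂⟩ := exists_norm_fourier_kernel_le z.im_pos hδ (k + 2) R
  refine ⟨C₂ * C₁, fun n s hs hR => ?_⟩
  have e1 := hC₁ n (2 * s - 1 / 2) (by rw [two_mul_sub_half_re]; linarith) (by
    refine (norm_sub_le _ _).trans ?_
    have : ‖(1 / 2 : ℂ)‖ ≤ 1 := by norm_num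
    rw [norm_mul, RCLike.norm_ofNat]
    linarith)
  have e2 := hC₂ s hs hR n
  have hpos : 0 < 1 + |(n : ℝ)| := by positivity
  rw [fourierTerm, norm_mul, norm_mul, norm_exp_two_pi, mul_one]
  calc _ ≤ C₂ / (1 + |(n : ℝ)|) ^ (k + 2) * (C₁ * (1 + |(n : ℝ)|) ^ k) := by gcongr
    _ = _ := by rw [pow_add]; field_simp

/-- The continued Fourier expansion without the factor `y^s / (s - 3/4)`. -/
noncomputable def fourierSum (M : ℕ) (z : ℍ) (s : ℂ) : ℂ := ∑' n : ℤ, fourierTerm M z n s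

lemma differentiableOn_fourierSum {M : ℕ} (hM : 4 ∣ M) (hM0 : M ≠ 0) (z : ℍ) :
    DifferentiableOn ℂ (fourierSum M z) {s | 1 / 2 < s.re} := by
  intro s hs
  have hs' : 1 / 2 < s.re := hs
  set δ : ℝ := (s.re - 1 / 2) / 2 with hδ
  have hδ0 : 0 < δ := by rw [hδ]; linarith
  obtain ⟨C, hC⟩ := exists_norm_fourierTerm_le hM hM0 z hδ0 (‖s‖ + δ)
  have hball : ∀ s' ∈ Metric.ball s δ, 1 / 2 + δ ≤ s'.re ∧ ‖s'‖ ≤ ‖s‖ + δ := by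
    intro s' h
    have h1 : ‖s' - s‖ < δ := by simpa [dist_eq_norm] using h
    have h2 : |s'.re - s.re| ≤ ‖s' - s‖ := by rw [← sub_re]; exact abs_re_le_norm _
    have h3 := (abs_le.1 h2).1
    have h4 := norm_le_norm_add_norm_sub' s' s
    exact ⟨by linarith, by linarith⟩
  refine DifferentiableAt.differentiableWithinAt ?_
  have := differentiableOn_tsum_of_summable_norm (F := fun n s' => fourierTerm M z n s')
    (summable_inv_one_add_abs_sq.mul_left C)
    (fun n s' h => (differentiableAt_fourierTerm hM hM0 z n
      (by linarith [(hball s' h).1])).differentiableWithinAt) Metric.isOpen_ball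
    (fun n s' h => hC n s' (hball s' h).1 (hball s' h).2)
  exact this.differentiableAt (Metric.ball_mem_nhds s hδ0)

/-- The meromorphic continuation of the Eisenstein series. The constant `(1 + i) / 2` of the Fourier
expansion is halved because `coefExt` contains the factor `w - 1 = 2 (s - 3/4)`. -/
noncomputable def eisensteinExt (M : ℕ) (z : ℍ) (s : ℂ) : ℂ :=
  (z.im : ℂ) ^ s + (z.im : ℂ) ^ s * ((1 + I) / 4) * fourierSum M z s / (s - 3 / 4)

lemma eisensteinExt_eq {M : ℕ} (hM : 4 ∣ M) (hM0 : M ≠ 0) (z : ℍ) {s : ℂ} (hs : 1 < s.re) :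
    eisensteinExt M z s = eisenstein M z s := by
  have hs0 : s - 3 / 4 ≠ 0 := by
    intro h
    rw [sub_eq_zero.1 h, show (3 / 4 : ℂ) = ((3 / 4 : ℝ) : ℂ) by push_cast; ring, ofReal_re] at hs
    norm_num at hs
  rw [eisenstein_eq_fourier hM z hs, eisensteinExt, fourierSum]
  have h : ∀ n : ℤ, fourierTerm M z n s = (2 * (s - 3 / 4)) *
      (FourierTransform.fourier (kernel s z.im) (n : ℝ) * exp (2 * Real.pi * I * n * z.re) *
        LSeries (fullCoef n M) (2 * s - 1 / 2)) := by
    intro n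
    rw [fourierTerm, coefExt_eq n hM hM0 (by rw [two_mul_sub_half_re]; linarith)]
    ring
  simp_rw [h]
  rw [tsum_mul_left]
  generalize ∑' n : ℤ, FourierTransform.fourier (kernel s z.im) (n : ℝ) *
    exp (2 * Real.pi * I * n * z.re) * LSeries (fullCoef n M) (2 * s - 1 / 2) = T
  rw [show (z.im : ℂ) ^ s * ((1 + I) / 4) * (2 * (s - 3 / 4) * T) =
    (z.im : ℂ) ^ s * ((1 + I) / 2) * T * (s - 3 / 4) by ring, mul_div_cancel_right₀ _ hs0]

lemma differentiableAt_im_cpow (z : ℍ) (s : ℂ) :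
    DifferentiableAt ℂ (fun s : ℂ => (z.im : ℂ) ^ s) s :=
  DifferentiableAt.const_cpow differentiableAt_id (Or.inl (by exact_mod_cast z.im_pos.ne'))

lemma isOpen_half_lt_re : IsOpen {s : ℂ | 1 / 2 < s.re} :=
  isOpen_lt continuous_const continuous_re

lemma analyticAt_im_cpow (z : ℍ) (s : ℂ) : AnalyticAt ℂ (fun s : ℂ => (z.im : ℂ) ^ s) s :=
  Differentiable.analyticAt (fun s => differentiableAt_im_cpow z s) s

lemma differentiableOn_numerator {M : ℕ} (hM : 4 ∣ M) (hM0 : M ≠ 0) (z : ℍ) :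
    DifferentiableOn ℂ (fun s => (z.im : ℂ) ^ s * ((1 + I) / 4) * fourierSum M z s)
      {s | 1 / 2 < s.re} :=
  fun s hs => (((differentiableAt_im_cpow z s).mul_const _).differentiableWithinAt).mul
    (differentiableOn_fourierSum hM hM0 z s hs)

lemma meromorphicOn_eisensteinExt {M : ℕ} (hM : 4 ∣ M) (hM0 : M ≠ 0) (z : ℍ) :
    MeromorphicOn (eisensteinExt M z) {s : ℂ | 1 / 2 < s.re} := by
  intro s hs
  have h1 := (analyticAt_im_cpow z s).meromorphicAt
  have h2 := ((differentiableOn_numerator hM hM0 z).analyticAt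
    (isOpen_half_lt_re.mem_nhds hs)).meromorphicAt
  have h3 : AnalyticAt ℂ (fun s : ℂ => s - 3 / 4) s := by fun_prop
  exact h1.add (h2.div h3.meromorphicAt)

/-- The only denominator of the continuation is `s - 3/4`. -/
lemma hasSimplePoleResidue_eisensteinExt {M : ℕ} (hM : 4 ∣ M) (hM0 : M ≠ 0) (z : ℍ) :
    HasSimplePoleResidue (eisensteinExt M z) (3 / 4)
      ((z.im : ℂ) ^ (3 / 4 : ℂ) * ((1 + I) / 4) * fourierSum M z (3 / 4)) := by
  set Φ : ℂ → ℂ := fun s => (z.im : ℂ) ^ s * ((1 + I) / 4) * fourierSum M z s with hΦ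
  have hmem : {s : ℂ | 1 / 2 < s.re} ∈ 𝓝 (3 / 4 : ℂ) := by
    refine isOpen_half_lt_re.mem_nhds ?_
    change (1 / 2 : ℝ) < (3 / 4 : ℂ).re
    rw [show (3 / 4 : ℂ) = ((3 / 4 : ℝ) : ℂ) by push_cast; ring, ofReal_re]
    norm_num
  have hd := (differentiableOn_dslope hmem).2 (differentiableOn_numerator hM hM0 z)
  refine ⟨fun s => (z.im : ℂ) ^ s + dslope Φ (3 / 4) s,
    (analyticAt_im_cpow z _).add (hd.analyticAt hmem), ?_⟩
  filter_upwards [self_mem_nhdsWithin] with s hs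
  have hs0 : s - 3 / 4 ≠ 0 := sub_ne_zero.2 hs
  rw [dslope_of_ne _ hs, slope_def_field, eisensteinExt]
  change (z.im : ℂ) ^ s + Φ s / (s - 3 / 4) =
    Φ (3 / 4) / (s - 3 / 4) + ((z.im : ℂ) ^ s + (Φ s - Φ (3 / 4)) / (s - 3 / 4))
  field_simp
  ring

/-- The value at `w = 1` of the coefficients at squares `m²`, except that it is doubled for
`m = 0`. -/
noncomputable def squareValue (M : ℕ) (m : ℤ) : ℂ :=
  (∏ p ∈ M.primeFactors, localValue M m p * (1 - (p : ℂ)⁻¹)) * (zetaCoprime M 2)⁻¹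

lemma squareValue_neg (M : ℕ) (m : ℤ) : squareValue M (-m) = squareValue M m := by
  unfold squareValue localValue
  simp

/-- A sum over `n ∈ ℤ` supported on the squares, as a sum over their roots. -/
lemma tsum_int_eq_tsum_sq {a b : ℤ → ℂ} (ha : Summable a) (hb : Summable b)
    (h0 : ∀ n : ℤ, (∀ m : ℤ, n ≠ m ^ 2) → a n = 0) (hsq : ∀ m : ℤ, m ≠ 0 → a (m ^ 2) = b m)
    (hzero : 2 * a 0 = b 0) (hneg : ∀ m, b (-m) = b m) :
    2 * ∑' n, a n = ∑' m, b m := by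
  have h1 : ∑' n, a n = a 0 + ∑' k : ℕ, b (k + 1) := by
    rw [ha.tsum_eq_add_tsum_ite 0]
    congr 1
    let f : ℕ → ℤ := fun k => ((k : ℤ) + 1) ^ 2
    have hf : Function.Injective f := by
      intro k l h
      have h' : ((k : ℤ) + 1) = l + 1 :=
        (pow_left_inj₀ (by positivity) (by positivity) two_ne_zero).1 h
      omega
    have hsupp : Function.support (fun n : ℤ => if n = 0 then 0 else a n) ⊆ Set.range f := by
      intro n hn
      by_contra hcon
      refine hn ?_
      simp only
      split_ifs with hn0
      · rfl
      · refine h0 n fun m hm => hcon ⟨m.natAbs - 1, ?_⟩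
        have hm0 : m ≠ 0 := by rintro rfl; exact hn0 (by simpa using hm)
        have : 0 < m.natAbs := Int.natAbs_pos.2 hm0
        simp only [f]
        rw [hm, ← Int.natAbs_sq m]
        congr 1
        omega
    rw [← hf.tsum_eq hsupp]
    refine tsum_congr fun k => ?_
    have hk : ((k : ℤ) + 1) ≠ 0 := by positivity
    simp only [f]
    rw [if_neg (pow_ne_zero 2 hk), hsq _ hk]
  have h2 : ∑' m, b m = b 0 + 2 * ∑' k : ℕ, b (k + 1) := by
    have hp : Summable fun k : ℕ => b (k + 1) :=
      hb.comp_injective (i := fun k : ℕ => (k : ℤ) + 1) fun k l h => by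
        simp only at h; omega
    rw [tsum_of_nat_of_neg_add_one (hb.comp_injective Nat.cast_injective)
      (hb.comp_injective (i := fun k : ℕ => -((k : ℤ) + 1)) fun k l h => by simp only at h; omega)]
    simp_rw [hneg]
    have hn : Summable fun k : ℕ => b (k : ℤ) := hb.comp_injective Nat.cast_injective
    rw [hn.tsum_eq_zero_add]
    push_cast
    ring
  rw [h1, h2, ← hzero]
  ring

lemma exp_mul_sq_eq (z : ℍ) (m : ℤ) :
    exp (-(2 * Real.pi * ((m : ℝ) ^ 2 : ℝ) * z.im)) * exp (2 * Real.pi * I * (m ^ 2 : ℤ) * z.re) =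
      exp (2 * Real.pi * I * ((m : ℂ) ^ 2 * z)) := by
  rw [← exp_add]
  congr 1
  have hz : (z : ℂ) = z.re + z.im * I := (re_add_im (z : ℂ)).symm
  rw [hz]
  push_cast
  linear_combination (-2 * Real.pi * (m : ℂ) ^ 2 * z.im) * I_sq

lemma summable_exp_sq (z : ℍ) :
    Summable fun m : ℤ => exp (2 * Real.pi * I * ((m : ℂ) ^ 2 * z)) := by
  have h := (hasSum_jacobiTheta₂_term 0 (τ := 2 * (z : ℂ)) (by simpa using z.im_pos)).summable
  refine h.congr fun m => ?_
  rw [jacobiTheta₂_term]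
  congr 1
  ring

lemma fourierTerm_three_quarters (M : ℕ) (z : ℍ) (m : ℤ) :
    fourierTerm M z (m ^ 2) (3 / 4) =
      Real.pi * (1 - I) / Real.sqrt z.im * exp (2 * Real.pi * I * ((m : ℂ) ^ 2 * z)) *
        coefExt (m ^ 2) M 1 := by
  have h := fourier_kernel_three_quarters z.im_pos (ξ := (m : ℝ) ^ 2) (by positivity)
  rw [← exp_mul_sq_eq, fourierTerm, show (2 * (3 / 4) - 1 / 2 : ℂ) = 1 by norm_num,
    show (((m ^ 2 : ℤ) : ℤ) : ℝ) = (m : ℝ) ^ 2 by push_cast; ring, h]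
  ring

/-- The Fourier expansion at `s = 3/4` is a theta series. -/
lemma two_mul_fourierSum_three_quarters {M : ℕ} (hM : 4 ∣ M) (hM0 : M ≠ 0) (z : ℍ)
    (hbd : ∃ C, ∀ m, ‖squareValue M m‖ ≤ C) :
    2 * fourierSum M z (3 / 4) = Real.pi * (1 - I) / Real.sqrt z.im *
      ∑' m : ℤ, exp (2 * Real.pi * I * ((m : ℂ) ^ 2 * z)) * squareValue M m := by
  obtain ⟨C, hC⟩ := hbd
  have h34 : (3 / 4 : ℂ).re = 3 / 4 := by
    rw [show (3 / 4 : ℂ) = ((3 / 4 : ℝ) : ℂ) by push_cast; ring, ofReal_re]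
  rw [← tsum_mul_left]
  refine tsum_int_eq_tsum_sq ?_ ?_ (fun n hn => ?_) (fun m hm => ?_) ?_ (fun m => ?_)
  · obtain ⟨C', hC'⟩ := exists_norm_fourierTerm_le hM hM0 z (δ := 1 / 4) (by norm_num) 1
    refine Summable.of_norm_bounded (summable_inv_one_add_abs_sq.mul_left C') fun n => ?_
    exact hC' n _ (by rw [h34]; norm_num) (by norm_num)
  · refine Summable.mul_left _ (Summable.of_norm_bounded ((summable_exp_sq z).norm.mul_right C)
      fun m => ?_)
    rw [norm_mul]
    exact mul_le_mul_of_nonneg_left (hC m) (norm_nonneg _)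
  · rw [fourierTerm, show (2 * (3 / 4) - 1 / 2 : ℂ) = 1 by norm_num,
      coefExt_one_of_not_sq hn hM hM0, mul_zero]
  · rw [fourierTerm_three_quarters, coefExt_one_of_sq hm hM hM0, squareValue]
    ring
  · have h := fourierTerm_three_quarters M z 0
    rw [show (0 : ℤ) ^ 2 = 0 by norm_num] at h
    rw [h, coefExt_zero_one hM hM0, squareValue]
    ring
  · rw [squareValue_neg]
    push_cast
    rw [neg_sq]

/-! ### The local values for `M = 2^{β₀} p₁^{β₁} p₂^{β₂}` -/

lemma localValue_of_not_dvd {M p : ℕ} (hp2 : p ≠ 2) (hp : ¬ p ∣ M) (m : ℤ) :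
    localValue M m p = 1 := by
  simp [localValue, Nat.factorization_eq_zero_of_not_dvd hp, hp2]

/-- The value at the squares `m²` is constant on the multiples of `√t` and zero elsewhere. -/
lemma squareValue_eq {p₁ p₂ β₀ β₁ β₂ M : ℕ} (hp₁ : p₁.Prime) (hp₂ : p₂.Prime) (h1 : p₁ ≠ 2)
    (h2 : p₂ ≠ 2) (hne : p₁ ≠ p₂) (hβ₀ : 2 ≤ β₀) (hM : M = 2 ^ β₀ * p₁ ^ β₁ * p₂ ^ β₂) (m : ℤ) :
    squareValue M m =
      if ((2 ^ (β₀ / 2 - 1) * p₁ ^ (β₁ / 2) * p₂ ^ (β₂ / 2) : ℕ) : ℤ) ∣ m then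
        (zetaDividing M 1)⁻¹ * (zetaCoprime M 2)⁻¹ * (((2 : ℂ) ^ ((β₀ + 1) / 2))⁻¹ *
          ((p₁ : ℂ) ^ ((β₁ + 1) / 2))⁻¹ * ((p₂ : ℂ) ^ ((β₂ + 1) / 2))⁻¹)
      else 0 := by
  have c01 : Nat.Coprime 2 p₁ := (Nat.coprime_primes Nat.prime_two hp₁).2 h1.symm
  have c02 : Nat.Coprime 2 p₂ := (Nat.coprime_primes Nat.prime_two hp₂).2 h2.symm
  have c12 : Nat.Coprime p₁ p₂ := (Nat.coprime_primes hp₁ hp₂).2 hne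
  have hM0 : M ≠ 0 := by
    rw [hM]
    exact mul_ne_zero (mul_ne_zero (pow_ne_zero _ two_ne_zero) (pow_ne_zero _ hp₁.ne_zero))
      (pow_ne_zero _ hp₂.ne_zero)
  have hfac : M.factorization = Finsupp.single 2 β₀ + Finsupp.single p₁ β₁ +
      Finsupp.single p₂ β₂ := by
    rw [hM, Nat.factorization_mul (mul_ne_zero (pow_ne_zero _ two_ne_zero)
      (pow_ne_zero _ hp₁.ne_zero)) (pow_ne_zero _ hp₂.ne_zero),
      Nat.factorization_mul (pow_ne_zero _ two_ne_zero) (pow_ne_zero _ hp₁.ne_zero),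
      Nat.prime_two.factorization_pow, hp₁.factorization_pow, hp₂.factorization_pow]
  have f0 : M.factorization 2 = β₀ := by simp [hfac, h1, h2]
  have f1 : M.factorization p₁ = β₁ := by simp [hfac, h1.symm, hne.symm]
  have f2 : M.factorization p₂ = β₂ := by simp [hfac, h2.symm, hne]
  have hsub : M.primeFactors ⊆ {2, p₁, p₂} := by
    intro p hp
    have hpp := Nat.prime_of_mem_primeFactors hp
    have hd := Nat.dvd_of_mem_primeFactors hp
    rw [hM] at hd
    simp only [Finset.mem_insert, Finset.mem_singleton]
    rcases hpp.dvd_mul.1 hd with hd | hd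
    · rcases hpp.dvd_mul.1 hd with hd | hd
      · exact Or.inl ((Nat.prime_dvd_prime_iff_eq hpp Nat.prime_two).1 (hpp.dvd_of_dvd_pow hd))
      · exact Or.inr (Or.inl ((Nat.prime_dvd_prime_iff_eq hpp hp₁).1 (hpp.dvd_of_dvd_pow hd)))
    · exact Or.inr (Or.inr ((Nat.prime_dvd_prime_iff_eq hpp hp₂).1 (hpp.dvd_of_dvd_pow hd)))
  have h2M : 2 ∣ M := by
    rw [hM, mul_assoc]
    exact dvd_mul_of_dvd_left (dvd_pow_self 2 (by omega)) _
  have hprod : ∏ p ∈ M.primeFactors, localValue M m p =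
      localValue M m 2 * localValue M m p₁ * localValue M m p₂ := by
    rw [Finset.prod_subset hsub fun p hp hpM => ?_]
    · rw [Finset.prod_insert (by simp [h1.symm, h2.symm]), Finset.prod_pair hne, mul_assoc]
    · have hpp : p.Prime := by
        simp only [Finset.mem_insert, Finset.mem_singleton] at hp
        rcases hp with rfl | rfl | rfl
        exacts [Nat.prime_two, hp₁, hp₂]
      have hnd : ¬ p ∣ M := fun h => hpM (Nat.mem_primeFactors.2 ⟨hpp, h, hM0⟩)
      exact localValue_of_not_dvd (by rintro rfl; exact hnd h2M) hnd m
  have hzd : (zetaDividing M 1)⁻¹ = ∏ p ∈ M.primeFactors, (1 - (p : ℂ)⁻¹) := by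
    rw [zetaDividing, Finset.prod_inv_distrib, inv_inv]
    exact Finset.prod_congr rfl fun p _ => by rw [cpow_neg_one]
  have hdvd : ((2 ^ (β₀ / 2 - 1) * p₁ ^ (β₁ / 2) * p₂ ^ (β₂ / 2) : ℕ) : ℤ) ∣ m ↔
      (((2 : ℕ) : ℤ) ^ (β₀ / 2 - 1) ∣ m ∧ (p₁ : ℤ) ^ (β₁ / 2) ∣ m) ∧ (p₂ : ℤ) ^ (β₂ / 2) ∣ m := by
    rw [← Nat.cast_pow, ← Nat.cast_pow, ← Nat.cast_pow, Int.natCast_dvd, Int.natCast_dvd,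
      Int.natCast_dvd, Int.natCast_dvd]
    exact ⟨fun h => ⟨⟨dvd_trans ((dvd_mul_right _ _).mul_right _) h,
      dvd_trans ((dvd_mul_left _ _).mul_right _) h⟩, dvd_trans (dvd_mul_left _ _) h⟩,
      fun h => Nat.Coprime.mul_dvd_of_dvd_of_dvd
        (Nat.Coprime.mul_left (c02.pow _ _) (c12.pow _ _))
        (Nat.Coprime.mul_dvd_of_dvd_of_dvd (c01.pow _ _) h.1.1 h.1.2) h.2⟩
  rw [squareValue, Finset.prod_mul_distrib, hprod, hzd]
  simp only [localValue, f0, f1, f2, if_true, if_neg h1, if_neg h2, Nat.sub_zero, hdvd]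
  by_cases d0 : ((2 : ℕ) : ℤ) ^ (β₀ / 2 - 1) ∣ m
  · by_cases d1 : (p₁ : ℤ) ^ (β₁ / 2) ∣ m
    · by_cases d2 : (p₂ : ℤ) ^ (β₂ / 2) ∣ m
      · simp only [d0, d1, d2, and_self, if_true]
        push_cast
        ring
      · simp [d2]
    · simp [d1]
  · simp only [d0, false_and, if_false, zero_mul]

/-! ### The residue as a theta series -/

/-- A sum over the multiples of `r`, reindexed by the quotients. -/
lemma tsum_ite_dvd {r : ℤ} (hr : r ≠ 0) (f : ℤ → ℂ) :
    ∑' m : ℤ, (if r ∣ m then f m else 0) = ∑' k : ℤ, f (r * k) := by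
  have hinj : Function.Injective fun k : ℤ => r * k := fun a b h => mul_left_cancel₀ hr h
  rw [← hinj.tsum_eq (f := fun m => if r ∣ m then f m else 0)]
  · exact tsum_congr fun k => if_pos (dvd_mul_right r k)
  · intro m hm
    by_contra hcon
    exact hm (if_neg fun ⟨k, hk⟩ => hcon ⟨k, hk.symm⟩)

lemma im_cpow_three_quarters_div_sqrt (z : ℍ) :
    (z.im : ℂ) ^ (3 / 4 : ℂ) / (Real.sqrt z.im : ℂ) = ((z.im ^ (1 / 4 : ℝ) : ℝ) : ℂ) := by
  rw [Real.sqrt_eq_rpow, show (3 / 4 : ℂ) = ((3 / 4 : ℝ) : ℂ) by push_cast; ring,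
    ← ofReal_cpow z.im_pos.le, ← ofReal_div, ← Real.rpow_sub z.im_pos]
  norm_num

/-- The residue at `s = 3/4` of the continued Eisenstein series. -/
lemma residue_eisensteinExt_eq {p₁ p₂ β₀ β₁ β₂ M : ℕ} (hp₁ : p₁.Prime) (hp₂ : p₂.Prime)
    (h1 : p₁ ≠ 2) (h2 : p₂ ≠ 2) (hne : p₁ ≠ p₂) (hβ₀ : 2 ≤ β₀) (hM : M = 2 ^ β₀ * p₁ ^ β₁ * p₂ ^ β₂)
    (hM4 : 4 ∣ M) (hM0 : M ≠ 0) {t : ℝ} (ht : t = (2 : ℝ) ^ (-2 : ℤ) *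
      ((2 : ℝ) ^ (2 * (β₀ / 2)) * (p₁ : ℝ) ^ (2 * (β₁ / 2)) * (p₂ : ℝ) ^ (2 * (β₂ / 2))))
    (z : ℍ) :
    (z.im : ℂ) ^ (3 / 4 : ℂ) * ((1 + I) / 4) * fourierSum M z (3 / 4) =
      (Real.pi : ℂ) / (4 * zetaDividing M 1 * zetaCoprime M 2) *
        (((2 : ℂ) ^ ((β₀ + 1) / 2))⁻¹ * ((p₁ : ℂ) ^ ((β₁ + 1) / 2))⁻¹ *
          ((p₂ : ℂ) ^ ((β₂ + 1) / 2))⁻¹) * theta (1 : DirichletCharacter ℂ 1) t z := by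
  set r : ℕ := 2 ^ (β₀ / 2 - 1) * p₁ ^ (β₁ / 2) * p₂ ^ (β₂ / 2) with hr
  set K : ℂ := (zetaDividing M 1)⁻¹ * (zetaCoprime M 2)⁻¹ * (((2 : ℂ) ^ ((β₀ + 1) / 2))⁻¹ *
    ((p₁ : ℂ) ^ ((β₁ + 1) / 2))⁻¹ * ((p₂ : ℂ) ^ ((β₂ + 1) / 2))⁻¹) with hK
  have hval : ∀ m : ℤ, squareValue M m = if (r : ℤ) ∣ m then K else 0 :=
    squareValue_eq hp₁ hp₂ h1 h2 hne hβ₀ hM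
  have hr0 : (r : ℤ) ≠ 0 := by
    rw [hr]
    exact_mod_cast mul_ne_zero (mul_ne_zero (pow_ne_zero _ two_ne_zero)
      (pow_ne_zero _ hp₁.ne_zero)) (pow_ne_zero _ hp₂.ne_zero)
  have htr : t = (r : ℝ) ^ 2 := by
    obtain ⟨b, hb⟩ : ∃ b, β₀ / 2 = b + 1 := ⟨β₀ / 2 - 1, by omega⟩
    rw [ht, hr, hb, Nat.add_sub_cancel]
    push_cast
    rw [zpow_neg]
    norm_cast
    push_cast
    ring
  have hF := two_mul_fourierSum_three_quarters hM4 hM0 z ⟨‖K‖, fun m => by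
    rw [hval]
    split_ifs
    · exact le_rfl
    · rw [norm_zero]; exact norm_nonneg _⟩
  have hsum : ∑' m : ℤ, exp (2 * Real.pi * I * ((m : ℂ) ^ 2 * z)) * squareValue M m =
      K * ∑' k : ℤ, (1 : DirichletCharacter ℂ 1) (k : ZMod 1) *
        exp (2 * Real.pi * I * ((t : ℂ) * (k : ℂ) ^ 2 * (z : ℂ))) := by
    simp_rw [hval, mul_ite, mul_zero]
    rw [tsum_ite_dvd hr0, ← tsum_mul_left]
    refine tsum_congr fun k => ?_
    rw [MulChar.one_apply (isUnit_of_subsingleton _), one_mul, mul_comm, htr]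
    push_cast
    rw [mul_pow]
  rw [hsum] at hF
  rw [theta, ← im_cpow_three_quarters_div_sqrt]
  generalize (∑' k : ℤ, (1 : DirichletCharacter ℂ 1) (k : ZMod 1) *
        exp (2 * Real.pi * I * ((t : ℂ) * (k : ℂ) ^ 2 * (z : ℂ)))) = T at hF ⊢
  have hKT : (Real.pi : ℂ) / (4 * zetaDividing M 1 * zetaCoprime M 2) *
      (((2 : ℂ) ^ ((β₀ + 1) / 2))⁻¹ * ((p₁ : ℂ) ^ ((β₁ + 1) / 2))⁻¹ *
        ((p₂ : ℂ) ^ ((β₂ + 1) / 2))⁻¹) = Real.pi / 4 * K := by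
    rw [hK, div_eq_mul_inv, mul_inv, mul_inv]
    ring
  rw [hKT]
  linear_combination ((z.im : ℂ) ^ (3 / 4 : ℂ) * ((1 + I) / 8)) * hF -
    (z.im : ℂ) ^ (3 / 4 : ℂ) / Real.sqrt z.im * Real.pi * K * T / 8 * I_sq

end HalfIntegralEisenstein

theorem lemmaB1 (p₁ p₂ β₀ β₁ β₂ M : ℕ) (hp₁ : p₁.Prime) (hp₂ : p₂.Prime)
    (hp₁_mod : p₁ % 4 = 3) (hp₂_mod : p₂ % 4 = 3) (hne : p₁ ≠ p₂) (hβ₀ : 2 ≤ β₀)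
    (hM : M = 2 ^ β₀ * p₁ ^ β₁ * p₂ ^ β₂)
    (t : ℝ) (ht : t = (2 : ℝ) ^ (-2 : ℤ) *
      ((2 : ℝ) ^ (2 * (β₀ / 2)) * (p₁ : ℝ) ^ (2 * (β₁ / 2)) * (p₂ : ℝ) ^ (2 * (β₂ / 2))))
    (z : UpperHalfPlane) :
    (∀ s : ℂ, 1 < s.re → Summable (HalfIntegralEisenstein.cosetSummand M z s)) ∧
    ∃ E : ℂ → ℂ,
      MeromorphicOn E {s : ℂ | 1 / 2 < s.re} ∧
      (∀ s : ℂ, 1 < s.re → E s = HalfIntegralEisenstein.eisenstein M z s) ∧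
      HalfIntegralEisenstein.HasSimplePoleResidue E (3 / 4)
        ((Real.pi : ℂ) / (4 * HalfIntegralEisenstein.zetaDividing M 1 *
            HalfIntegralEisenstein.zetaCoprime M 2) *
          (((2 : ℂ) ^ ((β₀ + 1) / 2))⁻¹ * ((p₁ : ℂ) ^ ((β₁ + 1) / 2))⁻¹ *
            ((p₂ : ℂ) ^ ((β₂ + 1) / 2))⁻¹) *
          HalfIntegralEisenstein.theta (1 : DirichletCharacter ℂ 1) t z) := by
  have hM4 : 4 ∣ M := by
    rw [hM, mul_assoc]
    exact dvd_mul_of_dvd_left (pow_dvd_pow 2 hβ₀) _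
  have hM0 : M ≠ 0 := by
    rw [hM]
    exact mul_ne_zero (mul_ne_zero (pow_ne_zero _ two_ne_zero) (pow_ne_zero _ hp₁.ne_zero))
      (pow_ne_zero _ hp₂.ne_zero)
  refine ⟨fun s hs => (HalfIntegralEisenstein.summable_cosetSummand_iff
      (dvd_trans (by norm_num) hM4) z s).2 (HalfIntegralEisenstein.summable_pairTerm M z hs),
    HalfIntegralEisenstein.eisensteinExt M z,
    HalfIntegralEisenstein.meromorphicOn_eisensteinExt hM4 hM0 z,
    fun s hs => HalfIntegralEisenstein.eisensteinExt_eq hM4 hM0 z hs, ?_⟩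
  rw [← HalfIntegralEisenstein.residue_eisensteinExt_eq hp₁ hp₂ (by omega) (by omega) hne hβ₀ hM hM4
    hM0 ht z]
  exact HalfIntegralEisenstein.hasSimplePoleResidue_eisensteinExt hM4 hM0 z
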